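/- **Setting.** Let $x_1,\dots,x_N\in\mathbb R^d$, $N\ge 2$, $I=\{1,\dots,N\}$, let $\rho\ge 2$ be real, and let $\Omega=\mathbb R^d$, so that $\partial\Omega=\emptyset$ and $\operatorname{dist}(\cdot,\emptyset)=\infty$. A *reverse-maximin ordering* is an ordering $i_1\prec\dots\prec i_N$ of $I$ such that for $k=N,\dots,1$ the index $i_k$ maximizes $\operatorname{dist}(x_i,\{x_{i_{k+1}},\dots,x_{i_N}\}\cup\partial\Omega)$ over $i\in I\setminus\{i_{k+1},\dots,i_N\}$; its length scales are the maxima $\ell_{i_k}$ (ties are broken arbitrarily, $i_N$ is arbitrary and $\ell_{i_N}=\infty$). Put $S_{\prec,\ell,\rho}=\{(i,j): i\succeq j,\ \operatorname{dist}(x_i,x_j)\le\rho\,\ell_j\}$. *Intrinsic dimension* $\tilde d$ with constant $C_{\tilde d}$: for all $0<r\le R$ and $y\in\mathbb R^d$, every $A\subset I$ with $\operatorname{dist}(x_i,y)\le R$ for $i\in A$ and $\operatorname{dist}(x_i,x_j)\ge r$ for distinct $i,j\in A$ has $|A|\le C_{\tilde d}(R/r)^{\tilde d}$. *Polynomial scaling*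 with the polynomial $\mathbf p$: the points are distinct and $\max_{i\ne j}\operatorname{dist}(x_i,x_j)\le\mathbf p(N)\min_{i\ne j}\operatorname{dist}(x_i,x_j)$. **Algorithm** (truncated ordering/sparsity algorithm). It uses oracles for $\mathtt{dist}(i,j)=\operatorname{dist}(x_i,x_j)$ and $\mathtt{dist}_{\partial\Omega}(i)=\operatorname{dist}(x_i,\partial\Omega)$, arrays $l$ and $P$, linked lists $p[i],c[i]$ (parents, children), a number $l_{\mathrm{Trunc}}$, and a mutable binary heap $H$ with the largest key at the root. The operation $\mathtt{decrease}(H,j,a)$ lowers the key of $j$ to $a$ if $j\in H$ and its key exceeds $a$. 1. For all $i$: $l[i]\leftarrow\mathtt{dist}_{\partial\Omega}(i)$, $p[i],c[i]\leftarrow\emptyset$. Build $H$ from the pairs $(i,l[i])$. 2. Pop the root $i$ of $H$ and append it to $P$. For all $j$: add $j$ to $c[i]$ and $i$ to $p[j]$, and $\mathtt{decrease}(H,j,\mathtt{dist}(i,j))$. Sort $c[i]$ by distance to $i$. If $H\ne\emptyset$, set $l_{\mathrm{Trunc}}$ to twice the root key. 3. While $H\neq\emptyset$: (a) pop the root $i$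 of $H$, with its key $l$, and set $l[i]\leftarrow l$; (b) let $k$ minimize $\mathtt{dist}(i,k)$ among the $k\in p[i]$ with $\mathtt{dist}(i,k)+\rho\,l[i]\le\rho\min(l_{\mathrm{Trunc}},l[k])$; (c) for all $j\in c[k]$ with $\mathtt{dist}(j,k)\le\mathtt{dist}(i,k)+\rho\,l[i]$ (an initial piece of the sorted list): $\mathtt{decrease}(H,j,\mathtt{dist}(i,j))$, and if $\mathtt{dist}(i,j)\le\rho\,l[i]$ add $j$ to $c[i]$ and $i$ to $p[j]$; (d) append $i$ to $P$ and sort $c[i]$ by distance to $i$; (e) while $H\ne\emptyset$ and every $j\notin P$ has some $i\in P$ with $\mathtt{dist}(i,j)<l_{\mathrm{Trunc}}/4$ (that is, the root key is $<l_{\mathrm{Trunc}}/4$): set $l_{\mathrm{Trunc}}\leftarrow l_{\mathrm{Trunc}}/2$, and for all $i\in P$ and $j\in c[i]\setminus P$ with $\mathtt{dist}(i,j)>\rho\,l_{\mathrm{Trunc}}$ remove $j$ from $c[i]$ and $i$ from $p[j]$. 4. For all $i$ and all $j\in c[i]$ such that $j$ does not precede $i$ in $P$ and $\mathtt{dist}(i,j)\le\rho\,l[j]$,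 add $(i,j)$ and $(j,j)$ to $S$. Costs are those of a random access machine with real registers: elementary operations on scalars, and reading or writing a word, cost one step; an oracle call costs $C_{\mathtt{dist}}+1$ steps, $C_{\mathtt{dist}}\in\mathbb N$; heap operations and sorting (by heap sort, with one oracle call per entry) are carried out in these elementary steps. Space is the largest number of memory words in use at any time. **Theorem.** For all $\tilde d$, $C_{\tilde d}$ and $\mathbf p$ there is a constant $C=C(\tilde d,C_{\tilde d},\mathbf p)>0$ such that for all $d$, all $N\ge 2$, all $\rho\ge2$, all $C_{\mathtt{dist}}\in\mathbb N$ and all points $x_1,\dots,x_N\in\mathbb R^d$ that have intrinsic dimension $\tilde d$ with constant $C_{\tilde d}$ and polynomial scaling with $\mathbf p$: the algorithm terminates (with a $k$ to choose in every step (b)), the array $P$ is $(i_N,i_{N-1},\dots,i_1)$ for a reverse-maximin ordering $\prec$, $l$ is its vector $\ell$ of length scales, and $S=S_{\prec,\ell,\rho}$ as a set. The space used is at most $$C\rho^{\tilde d}N,$$ and the number of steps is at most $$C\,N\log(N)\,\rho^{\tilde d}\,(\log N+C_{\mathtt{dist}}).$$ -/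

import Mathlib

open scoped ENNReal

noncomputable section

namespace SparseOrdering

/-! ## Point sets, orderings and sparsity patterns -/

/-- The points `x` have intrinsic dimension `dt` with constant `Cdim`: an `r`-separated subfamily
contained in a ball of radius `R ≥ r` has at most `Cdim * (R / r) ^ dt` members. -/
def HasIntrinsicDimension {d N : ℕ} (x : Fin N → EuclideanSpace ℝ (Fin d)) (dt Cdim : ℝ) : Prop :=
  ∀ r R : ℝ, 0 < r → r ≤ R → ∀ y : EuclideanSpace ℝ (Fin d), ∀ A : Finset (Fin N),
    (∀ i ∈ A, dist (x i) y ≤ R) →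
    (∀ i ∈ A, ∀ j ∈ A, i ≠ j → r ≤ dist (x i) (x j)) →
    (A.card : ℝ) ≤ Cdim * (R / r) ^ dt

/-- The points are pairwise distinct, and the ratio of the largest to the smallest distance of two
of them is at most `p N`. -/
def HasPolynomialScaling {d N : ℕ} (x : Fin N → EuclideanSpace ℝ (Fin d))
    (p : Polynomial ℝ) : Prop :=
  ∀ i j k m : Fin N, i ≠ j → k ≠ m →
    0 < dist (x k) (x m) ∧ dist (x i) (x j) / dist (x k) (x m) ≤ p.eval (N : ℝ)

/-- For an elimination ordering `e`, which lists the indices as `e 0 ≺ e 1 ≺ ⋯`, the distance of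
`x i` to the boundary of `Ω` and to those points that come strictly after position `k`.  (The
distance to the empty set is `∞`.) -/
def distToLater {d N : ℕ} (Ω : Set (EuclideanSpace ℝ (Fin d)))
    (x : Fin N → EuclideanSpace ℝ (Fin d)) (e : Equiv.Perm (Fin N)) (k i : Fin N) : ℝ≥0∞ :=
  Metric.infEDist (x i) ({y | ∃ m : Fin N, k < m ∧ y = x (e m)} ∪ frontier Ω)

/-- `e` is a reverse-maximin ordering with length scales `ℓ`: from the last position to the first,
`e k` maximizes, among the indices that are not yet placed, the distance to the boundary and to
the points already placed, and `ℓ (e k)` is that distance. -/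
structure IsReverseMaximin {d N : ℕ} (Ω : Set (EuclideanSpace ℝ (Fin d)))
    (x : Fin N → EuclideanSpace ℝ (Fin d)) (e : Equiv.Perm (Fin N)) (ℓ : Fin N → ℝ≥0∞) :
    Prop where
  isMax : ∀ k m : Fin N, m ≤ k → distToLater Ω x e k (e m) ≤ distToLater Ω x e k (e k)
  scale : ∀ k : Fin N, ℓ (e k) = distToLater Ω x e k (e k)

/-- The sparsity pattern `{(i, j) : i ⪰ j, dist (x i) (x j) ≤ ρ ℓ j}`. -/
def sparsityPattern {d N : ℕ} (x : Fin N → EuclideanSpace ℝ (Fin d)) (e : Equiv.Perm (Fin N))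
    (ℓ : Fin N → ℝ≥0∞) (ρ : ℝ) : Set (Fin N × Fin N) :=
  {q | e.symm q.2 ≤ e.symm q.1 ∧ edist (x q.1) (x q.2) ≤ ENNReal.ofReal ρ * ℓ q.2}

/-! ## The machine: a random access machine with real registers, a clock and a space meter -/

/-- A mutable binary heap of indices: the array that holds the tree (the sons of position `q` are
at `2 * q + 1` and `2 * q + 2`), for every index its position in that array (`none` if it is
absent), and for every index its key. -/
structure Heap (N : ℕ) where
  arr : Array (Fin N)
  pos : Fin N → Option ℕ
  key : Fin N → ℝ≥0∞

/-- The machine has two heaps: the main one and a second one used for sorting. -/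
inductive HeapId where
  | main
  | aux

/-- For every index there is a linked list of parents and a linked list of children. -/
inductive ListId where
  | parents
  | children

/-- The memory. -/
structure Mem (N : ℕ) where
  /-- the array `l[:]` of distances -/
  l : Fin N → ℝ≥0∞
  /-- the array `P` of the indices in the order in which they are selected -/
  order : Array (Fin N)
  /-- the position of an index in `P` (`none` while it is not selected) -/
  rank : Fin N → Option ℕ
  /-- the linked lists `p[i]` -/
  parents : Fin N → List (Fin N)
  /-- the linked lists `c[i]` -/
  children : Fin N → List (Fin N)
  /-- a linked list used while a list is filtered -/
  buffer : List (Fin N)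
  /-- the main heap `H` -/
  main : Heap N
  /-- the heap used for sorting -/
  aux : Heap N
  /-- the truncation length `l_Trunc` -/
  trunc : ℝ≥0∞
  /-- the array `S` of index pairs -/
  S : Array (Fin N × Fin N)

/-- The number of memory words in use: `8` arrays of length `N` (`l`, `rank`, the heads of the lists
`p[i]` and `c[i]`, and the positions and keys of both heaps), one word per entry of `P` and of the
heap arrays, two words per list node and per index pair, and a bounded number of scalar
variables. -/
def Mem.space {N : ℕ} (m : Mem N) : ℕ :=
  16 + 8 * N + m.order.size + m.main.arr.size + m.aux.arr.size + 2 * m.buffer.length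
    + 2 * m.S.size + ∑ i, (2 * (m.parents i).length + 2 * (m.children i).length)

/-- The empty memory. -/
def Mem.empty (N : ℕ) : Mem N where
  l := fun _ => 0
  order := #[]
  rank := fun _ => none
  parents := fun _ => []
  children := fun _ => []
  buffer := []
  main := ⟨#[], fun _ => none, fun _ => 0⟩
  aux := ⟨#[], fun _ => none, fun _ => 0⟩
  trunc := 0
  S := #[]

def Mem.heap {N : ℕ} (m : Mem N) : HeapId → Heap N
  | .main => m.main
  | .aux => m.aux

def Mem.setHeap {N : ℕ} (m : Mem N) (h : HeapId) (a : Heap N) : Mem N :=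
  match h with
  | .main => { m with main := a }
  | .aux => { m with aux := a }

def Mem.list {N : ℕ} (m : Mem N) : ListId → Fin N → List (Fin N)
  | .parents => m.parents
  | .children => m.children

def Mem.setList {N : ℕ} (m : Mem N) (w : ListId) (i : Fin N) (a : List (Fin N)) : Mem N :=
  match w with
  | .parents => { m with parents := Function.update m.parents i a }
  | .children => { m with children := Function.update m.children i a }

/-- A configuration: the memory, the number of steps made so far, and the largest number of memory
words that were in use at any moment so far. -/
structure Config (N : ℕ) where
  mem : Mem N
  time : ℕ
  peak : ℕ

/-- Programs.  The result is `none` if the program aborts or does not terminate. -/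
abbrev Prog (N : ℕ) (α : Type) : Type := StateT (Config N) Option α

section Machine

variable {N : ℕ}

/-- Abort. -/
def abort {α : Type} : Prog N α := fun _ => none

/-- Make `t` steps. -/
def charge (t : ℕ) : Prog N Unit := fun s => some ((), { s with time := s.time + t })

/-- One elementary operation on scalars (an arithmetic operation or a comparison, with result `a`):
one step. -/
def op {α : Type} (a : α) : Prog N α := do
  charge 1
  pure a

/-- Read from the memory: one step. -/
def load {α : Type} (f : Mem N → α) : Prog N α := fun s =>
  some (f s.mem, { s with time := s.time + 1 })

/-- Change at most `t` words of the memory: `t` steps. -/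
def store (t : ℕ) (f : Mem N → Mem N) : Prog N Unit := fun s =>
  some ((), { mem := f s.mem, time := s.time + t, peak := max s.peak (f s.mem).space })

/-- Go through a list, with one step for the control of every pass. -/
def forEach {α : Type} (body : α → Prog N Unit) : List α → Prog N Unit
  | [] => charge 1
  | a :: as => do
    charge 1
    body a
    forEach body as

/-- At most `n` passes of a loop with a loop variable: a pass at `a` either ends the loop (`none`) or
gives the next value of the loop variable.  The result is `none` if `n` passes are not enough. -/
def loopFor {α : Type} (body : α → Prog N (Option α)) : ℕ → α → Prog N Unit
  | 0, _ => abort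
  | n + 1, a => do
    match ← body a with
    | none => pure ()
    | some b => loopFor body n b

open Classical in
/-- The unbounded loop: the result of `loopFor` for any sufficient number of passes, and `none` if
the loop aborts or goes on forever. -/
def loop {α : Type} (body : α → Prog N (Option α)) (a : α) : Prog N Unit := fun s =>
  if h : ∃ n, ((loopFor body n a).run s).isSome then (loopFor body (Nat.find h) a).run s else none

/-! ### Primitive memory accesses -/

def readL (i : Fin N) : Prog N ℝ≥0∞ := load fun m => m.l i

def writeL (i : Fin N) (a : ℝ≥0∞) : Prog N Unit :=
  store 1 fun m => { m with l := Function.update m.l i a }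

def readTrunc : Prog N ℝ≥0∞ := load fun m => m.trunc

def writeTrunc (a : ℝ≥0∞) : Prog N Unit := store 1 fun m => { m with trunc := a }

def readRank (i : Fin N) : Prog N (Option ℕ) := load fun m => m.rank i

/-- Append an index to `P` and record its position. -/
def pushOrder (i : Fin N) : Prog N Unit :=
  store 2 fun m =>
    { m with order := m.order.push i, rank := Function.update m.rank i (some m.order.size) }

/-- The pointer to the first node of a linked list. -/
def readList (w : ListId) (i : Fin N) : Prog N (List (Fin N)) := load fun m => m.list w i

def clearList (w : ListId) (i : Fin N) : Prog N Unit := store 1 fun m => m.setList w i []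

/-- Prepend a node to a linked list. -/
def pushList (w : ListId) (i j : Fin N) : Prog N Unit :=
  store 3 fun m => m.setList w i (j :: m.list w i)

def readBuffer : Prog N (List (Fin N)) := load fun m => m.buffer

def clearBuffer : Prog N Unit := store 1 fun m => { m with buffer := [] }

def pushBuffer (j : Fin N) : Prog N Unit :=
  store 3 fun m => { m with buffer := j :: m.buffer }

def pushS (i j : Fin N) : Prog N Unit := store 2 fun m => { m with S := m.S.push (i, j) }

/-! ### Binary heaps with the largest key at the root -/

def heapSize (h : HeapId) : Prog N ℕ := load fun m => (m.heap h).arr.size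

/-- The entry at position `q` of the heap array. -/
def heapGet (h : HeapId) (q : ℕ) : Prog N (Fin N) := do
  match ← load fun m => (m.heap h).arr[q]? with
  | some v => pure v
  | none => abort

def heapPos (h : HeapId) (v : Fin N) : Prog N (Option ℕ) := load fun m => (m.heap h).pos v

def readKey (h : HeapId) (v : Fin N) : Prog N ℝ≥0∞ := load fun m => (m.heap h).key v

def writeKey (h : HeapId) (v : Fin N) (a : ℝ≥0∞) : Prog N Unit :=
  store 1 fun m =>
    m.setHeap h { m.heap h with key := Function.update (m.heap h).key v a }

/-- The key of the entry at position `q`. -/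
def keyAt (h : HeapId) (q : ℕ) : Prog N ℝ≥0∞ := do
  let v ← heapGet h q
  readKey h v

/-- Exchange the entries at the positions `a` and `b`. -/
def heapSwap (h : HeapId) (a b : ℕ) : Prog N Unit := do
  let u ← heapGet h a
  let v ← heapGet h b
  store 4 fun m => m.setHeap h
    { m.heap h with
      arr := ((m.heap h).arr.setIfInBounds a v).setIfInBounds b u
      pos := Function.update (Function.update (m.heap h).pos v (some a)) u (some b) }

/-- Append `v` with key `a` at the end of the heap array, without restoring the heap property. -/
def heapAppend (h : HeapId) (v : Fin N) (a : ℝ≥0∞) : Prog N Unit :=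
  store 3 fun m => m.setHeap h
    { arr := (m.heap h).arr.push v
      pos := Function.update (m.heap h).pos v (some (m.heap h).arr.size)
      key := Function.update (m.heap h).key v a }

/-- Remove the last entry `v` of the heap array. -/
def heapDropLast (h : HeapId) (v : Fin N) : Prog N Unit :=
  store 2 fun m => m.setHeap h
    { m.heap h with
      arr := (m.heap h).arr.pop
      pos := Function.update (m.heap h).pos v none }

/-- The position of the son of `q` that has the larger key, where `n` is the size of the heap and
`q` has at least one son. -/
def largerSon (h : HeapId) (n q : ℕ) : Prog N ℕ := do
  if ← op (decide (2 * q + 2 < n)) then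
    let a ← keyAt h (2 * q + 1)
    let b ← keyAt h (2 * q + 2)
    if ← op (decide (a < b)) then pure (2 * q + 2) else pure (2 * q + 1)
  else pure (2 * q + 1)

/-- Restore the heap property below position `q` by moving its entry down. -/
def siftDown (h : HeapId) : ℕ → Prog N Unit := loop fun q => do
  let n ← heapSize h
  if ← op (decide (2 * q + 1 < n)) then
    let s ← largerSon h n q
    let a ← keyAt h q
    let b ← keyAt h s
    if ← op (decide (a < b)) then
      heapSwap h q s
      pure (some s)
    else pure none
  else pure none

/-- Instate the heap property. -/
def heapify (h : HeapId) : Prog N Unit := do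
  let n ← heapSize h
  forEach (siftDown h) (List.range n).reverse

/-- Remove the root, restore the heap property, and return the removed index and its key. -/
def heapPop (h : HeapId) : Prog N (Fin N × ℝ≥0∞) := do
  let n ← heapSize h
  let v ← heapGet h 0
  let a ← readKey h v
  heapSwap h 0 (n - 1)
  heapDropLast h v
  siftDown h 0
  pure (v, a)

/-- If `v` is in the heap and has a key larger than `a`, decrease its key to `a`. -/
def heapDecrease (h : HeapId) (v : Fin N) (a : ℝ≥0∞) : Prog N Unit := do
  match ← heapPos h v with
  | none => pure ()
  | some q =>
    let b ← readKey h v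
    if ← op (decide (a < b)) then
      writeKey h v a
      siftDown h q

end Machine

/-! ## The algorithm -/

/-- The input: the parameter `ρ`, the two distance oracles, and the number of steps that an oracle
needs for an answer. -/
structure Input (N : ℕ) where
  rho : ℝ≥0∞
  dist : Fin N → Fin N → ℝ≥0∞
  distBoundary : Fin N → ℝ≥0∞
  oracleCost : ℕ

section Algorithm

variable {N : ℕ} (I : Input N)

def queryDist (i j : Fin N) : Prog N ℝ≥0∞ := do
  charge (I.oracleCost + 1)
  pure (I.dist i j)

def queryBoundary (i : Fin N) : Prog N ℝ≥0∞ := do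
  charge (I.oracleCost + 1)
  pure (I.distBoundary i)

/-- Sort `c[i]` by increasing distance to `i` (heap sort, one oracle call for each entry). -/
def sortChildren (i : Fin N) : Prog N Unit := do
  let cs ← readList .children i
  forEach (fun j => do
    let a ← queryDist I j i
    heapAppend .aux j a) cs
  clearList .children i
  heapify .aux
  let n ← heapSize .aux
  forEach (fun _ => do
    let va ← heapPop .aux
    pushList .children i va.1) (List.range n)

/-- Remove from a list the entries that do not pass a test, keeping the order of the others. -/
def filterList (w : ListId) (i : Fin N) (keep : Fin N → Prog N Bool) : Prog N Unit := do
  clearBuffer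
  let js ← readList w i
  forEach (fun j => do
    if ← keep j then pushBuffer j) js
  clearList w i
  let ks ← readBuffer
  forEach (fun j => pushList w i j) ks
  clearBuffer

/-- Initialize the arrays and build the heap. -/
def initArrays : Prog N Unit := do
  forEach (fun i => do
    let b ← queryBoundary I i
    writeL i b
    clearList .parents i
    clearList .children i
    heapAppend .main i b) (List.finRange N)
  heapify .main

/-- Process the first index, and start with twice the largest remaining distance as truncation
length. -/
def processFirst : Prog N Unit := do
  let il ← heapPop .main
  let i := il.1
  pushOrder i
  forEach (fun j => do
    pushList .children i j
    pushList .parents j i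
    let a ← queryDist I i j
    heapDecrease .main j a) (List.finRange N)
  sortChildren I i
  if (← heapSize .main) ≠ 0 then
    let a ← keyAt .main 0
    writeTrunc (← op (2 * a))

/-- Among the members `j` of a list that satisfy `dist(i,j) + ρ l[i] ≤ ρ min(l_Trunc, l[j])`, find
the one closest to `i`, together with its distance; `best` is the best one found so far. -/
def selectParent (i : Fin N) (li : ℝ≥0∞) :
    Option (Fin N × ℝ≥0∞) → List (Fin N) → Prog N (Option (Fin N × ℝ≥0∞))
  | best, [] => pure best
  | best, j :: js => do
    let a ← queryDist I i j
    let lj ← readL j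
    let t ← readTrunc
    let u ← op (I.rho * li)
    let u' ← op (a + u)
    let v ← op (min t lj)
    let v' ← op (I.rho * v)
    if ← op (decide (u' ≤ v')) then
      match best with
      | none => selectParent i li (some (j, a)) js
      | some kb =>
        if ← op (decide (a < kb.2)) then selectParent i li (some (j, a)) js
        else selectParent i li best js
    else selectParent i li best js

/-- Go through the children `j` of `k`, a list sorted by distance to `k`, as long as
`dist(j,k) ≤ bound`; update the distances, and record the children of `i`. -/
def scanChildren (i : Fin N) (li : ℝ≥0∞) (k : Fin N) (bound : ℝ≥0∞) :
    List (Fin N) → Prog N Unit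
  | [] => pure ()
  | j :: js => do
    let b ← queryDist I j k
    if ← op (decide (b ≤ bound)) then
      let a ← queryDist I i j
      heapDecrease .main j a
      let u ← op (I.rho * li)
      if ← op (decide (a ≤ u)) then
        pushList .children i j
        pushList .parents j i
      scanChildren i li k bound js

/-- The test in the truncation: of the two indices `i` (a parent) and `j`, keep the pair unless
`dist(i,j) > ρ l_Trunc`. -/
def isWithinTrunc (i j : Fin N) : Prog N Bool := do
  let a ← queryDist I i j
  let t ← readTrunc
  let u ← op (I.rho * t)
  op (decide (a ≤ u))

/-- Remove from the lists of children and of parents the pairs `(i, j)` with `i` selected, `j` not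
selected and `dist(i,j) > ρ l_Trunc`. -/
def truncateLists : Prog N Unit :=
  forEach (fun v => do
    match ← readRank v with
    | some _ =>
      filterList .children v fun j => do
        match ← readRank j with
        | some _ => pure true
        | none => isWithinTrunc I v j
    | none => filterList .parents v fun i => isWithinTrunc I i v) (List.finRange N)

/-- While every index not yet selected (if there is one) has distance less than `l_Trunc / 4` to
the selected ones, halve `l_Trunc` and truncate the lists.  That largest distance is the key at the
root of the heap. -/
def truncationLoop : Prog N Unit := loop (fun _ => do
  if (← heapSize .main) ≠ 0 then
    let a ← keyAt .main 0
    let t ← readTrunc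
    let q ← op (t / 4)
    if ← op (decide (a < q)) then
      writeTrunc (← op (t / 2))
      truncateLists I
      pure (some ())
    else pure none
  else pure none) ()

/-- Process the next index. -/
def processNext : Prog N Unit := do
  let il ← heapPop .main
  let i := il.1
  let li := il.2
  writeL i li
  let ps ← readList .parents i
  match ← selectParent I i li none ps with
  | none => abort
  | some kd =>
    let u ← op (I.rho * li)
    let bound ← op (kd.2 + u)
    let cs ← readList .children kd.1
    scanChildren I i li kd.1 bound cs
    pushOrder i
    sortChildren I i
    truncationLoop I

/-- Process the remaining indices. -/
def mainLoop : Prog N Unit := loop (fun _ => do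
  if (← heapSize .main) ≠ 0 then
    processNext I
    pure (some ())
  else pure none) ()

/-- Aggregate the lists of children into the sparsity pattern: keep those pairs `(i, j)` with `j` a
child of `i` for which `j` is not selected before `i` and `dist(i,j) ≤ ρ l[j]`. -/
def aggregate : Prog N Unit :=
  forEach (fun i => do
    let cs ← readList .children i
    forEach (fun j => do
      let ri ← readRank i
      let rj ← readRank j
      let lj ← readL j
      let a ← queryDist I i j
      let u ← op (I.rho * lj)
      if ← op (decide (ri.getD 0 ≤ rj.getD 0)) then
        if ← op (decide (a ≤ u)) then
          pushS i j
          pushS j j) cs) (List.finRange N)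

/-- The whole algorithm. -/
def sortSparse : Prog N Unit := do
  initArrays I
  processFirst I
  mainLoop I
  aggregate I

/-- The configuration in which the algorithm, started on the empty memory, ends. -/
def finalConfig : Option (Config N) :=
  ((sortSparse I).run ⟨Mem.empty N, 0, (Mem.empty N).space⟩).map Prod.snd

end Algorithm

/-- The input for the points `x` in the domain `Ω`. -/
def inputOf {d N : ℕ} (Ω : Set (EuclideanSpace ℝ (Fin d)))
    (x : Fin N → EuclideanSpace ℝ (Fin d)) (ρ : ℝ) (Cdist : ℕ) : Input N where
  rho := ENNReal.ofReal ρ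
  dist := fun i j => edist (x i) (x j)
  distBoundary := fun i => Metric.infEDist (x i) (frontier Ω)
  oracleCost := Cdist

end SparseOrdering

end

/-! # Correctness and complexity of the truncated ordering algorithm -/

/-! The selection is farthest-point sampling: the scales do not increase along `P`, and two selected
points are at least the smaller of their scales apart (`IsMaximin.separated`). All bounds come from
this separation and from one packing number `K` of order `ρ ^ dt`, which bounds the size of an
`r`-separated set in a ball of radius `6 ρ r` (`IsGood`).

Correctness. The invariant `Inv` says that the heap keys are the true distances to the selected set
and that `c[k]` contains every unselected `j` with `dist(k,j) ≤ ρ min(l_Trunc, l[k])`. Let `i` be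
selected at scale `r`. Only points nearer to `i` than `r` can have their keys lowered, and only
points within `ρ r` become children. For an admissible parent `k`, the triangle inequality puts all
of them into the complete part of `c[k]`, so scanning an initial piece of this list replaces a scan
of all points (`IsNext.mem_children`, `Inv.select`). An admissible parent exists
(`IsNext.exists_candidate`): the index whose selection first brought `i` within distance `2 r` has
scale at least `2 r`, and `2 r + ρ r ≤ 2 ρ r` because `ρ ≥ 2`. A pair that the sparsity pattern
needs is present when its second index is selected, and it is never removed afterwards.

Space. Whenever the truncation loop ends with an unselected index left, `l_Trunc` is between two and
four times the largest remaining distance. Hence the selected points are `l_Trunc / 4`-separated,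
and an unselected point has at most `K` parents. A pair of selected points is charged to the one of
smaller scale, which is charged `O(K)` times. So the lists have `O(K N)` nodes
(`IsMaximin.sum_length_le`).

Time. Processing `i` tests at most `K` parents and scans and sorts points within `3 ρ l[i]` of `i`
(`IsNext.dist_le_three`). The sizes of these balls are summed by double counting: for a fixed point
`j` and a fixed dyadic range of scales, at most `K` selected `i` have `j` in their ball, and there
are `O(log N)` ranges by polynomial scaling (`IsMaximin.sum_ballCard_le`). Each visit costs `O(log N
+ C_dist)`. The truncation length is halved `O(log N)` times in all, and every halving costs `O(K N
(C_dist + 1))`; the exponent `n` in `l_Trunc < 2 δ 2 ^ n` is the potential that pays for this.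

The programs are treated by a total-correctness calculus `wp`, whose specifications give the final
memory and bound the clock and the space meter together. -/

namespace SparseOrdering

/-! ## A program logic -/

section Logic

variable {N : ℕ} {α β : Type}

/-- The program `c`, started in `s`, ends with a result and a configuration that satisfy `Q`. -/
def wp (c : Prog N α) (s : Config N) (Q : α → Config N → Prop) : Prop :=
  ∃ a s', c s = some (a, s') ∧ Q a s'

theorem wp.mono {c : Prog N α} {s : Config N} {Q R : α → Config N → Prop} (h : wp c s Q)
    (hQR : ∀ a s', Q a s' → R a s') : wp c s R := by
  obtain ⟨a, s', h1, h2⟩ := h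
  exact ⟨a, s', h1, hQR a s' h2⟩

@[simp] theorem wp_pure (a : α) (s : Config N) (Q : α → Config N → Prop) :
    wp (pure a) s Q ↔ Q a s := by
  constructor
  · rintro ⟨b, s', h, hQ⟩
    obtain ⟨rfl, rfl⟩ := Prod.mk.inj (Option.some.inj h)
    exact hQ
  · exact fun h => ⟨a, s, rfl, h⟩

@[simp] theorem wp_bind (c : Prog N α) (f : α → Prog N β) (s : Config N)
    (Q : β → Config N → Prop) :
    wp (c >>= f) s Q ↔ wp c s (fun a s' => wp (f a) s' Q) := by
  have key : (c >>= f) s = (c s).bind (fun r => f r.1 r.2) := rfl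
  constructor
  · rintro ⟨b, s', h, hQ⟩
    rw [key] at h
    obtain ⟨⟨a, s₁⟩, h1, h2⟩ := Option.bind_eq_some_iff.1 h
    exact ⟨a, s₁, h1, b, s', h2, hQ⟩
  · rintro ⟨a, s₁, h1, b, s', h2, hQ⟩
    exact ⟨b, s', by rw [key, h1]; exact h2, hQ⟩

@[simp] theorem wp_charge (k : ℕ) (m : Mem N) (t p : ℕ) (Q : Unit → Config N → Prop) :
    wp (charge k) ⟨m, t, p⟩ Q ↔ Q () ⟨m, t + k, p⟩ := by
  constructor
  · rintro ⟨b, s', h, hQ⟩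
    obtain ⟨rfl, rfl⟩ := Prod.mk.inj (Option.some.inj h)
    exact hQ
  · exact fun h => ⟨_, _, rfl, h⟩

@[simp] theorem wp_op (a : α) (m : Mem N) (t p : ℕ) (Q : α → Config N → Prop) :
    wp (op a) ⟨m, t, p⟩ Q ↔ Q a ⟨m, t + 1, p⟩ := by
  simp only [op, wp_bind, wp_charge, wp_pure]

@[simp] theorem wp_load (f : Mem N → α) (m : Mem N) (t p : ℕ) (Q : α → Config N → Prop) :
    wp (load f) ⟨m, t, p⟩ Q ↔ Q (f m) ⟨m, t + 1, p⟩ := by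
  constructor
  · rintro ⟨b, s', h, hQ⟩
    obtain ⟨rfl, rfl⟩ := Prod.mk.inj (Option.some.inj h)
    exact hQ
  · exact fun h => ⟨_, _, rfl, h⟩

@[simp] theorem wp_store (k : ℕ) (f : Mem N → Mem N) (m : Mem N) (t p : ℕ)
    (Q : Unit → Config N → Prop) :
    wp (store k f) ⟨m, t, p⟩ Q ↔ Q () ⟨f m, t + k, max p (f m).space⟩ := by
  constructor
  · rintro ⟨b, s', h, hQ⟩
    obtain ⟨rfl, rfl⟩ := Prod.mk.inj (Option.some.inj h)
    exact hQ
  · exact fun h => ⟨_, _, rfl, h⟩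

@[simp] theorem wp_queryDist (I : Input N) (i j : Fin N) (m : Mem N) (t p : ℕ)
    (Q : ℝ≥0∞ → Config N → Prop) :
    wp (queryDist I i j) ⟨m, t, p⟩ Q ↔ Q (I.dist i j) ⟨m, t + (I.oracleCost + 1), p⟩ := by
  simp only [queryDist, wp_bind, wp_charge, wp_pure]

@[simp] theorem wp_queryBoundary (I : Input N) (i : Fin N) (m : Mem N) (t p : ℕ)
    (Q : ℝ≥0∞ → Config N → Prop) :
    wp (queryBoundary I i) ⟨m, t, p⟩ Q ↔
      Q (I.distBoundary i) ⟨m, t + (I.oracleCost + 1), p⟩ := by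
  simp only [queryBoundary, wp_bind, wp_charge, wp_pure]

/-- `Inv` is indexed by the entries still to be treated, so it can record progress and the time
already spent. The `+ 1`s are the steps of loop control, one of them for the end of the list. -/
theorem wp_forEach (body : α → Prog N Unit) (Inv : List α → Config N → Prop)
    {Q : Unit → Config N → Prop} {l : List α} {s : Config N}
    (step : ∀ a as m t p, Inv (a :: as) ⟨m, t, p⟩ →
      wp (body a) ⟨m, t + 1, p⟩ (fun _ s' => Inv as s'))
    (h0 : Inv l s) (hQ : ∀ m t p, Inv [] ⟨m, t, p⟩ → Q () ⟨m, t + 1, p⟩) :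
    wp (forEach body l) s Q := by
  induction l generalizing s with
  | nil =>
    obtain ⟨m, t, p⟩ := s
    simpa [forEach] using hQ m t p h0
  | cons a as ih =>
    obtain ⟨m, t, p⟩ := s
    simp only [forEach, wp_bind, wp_charge]
    exact (step a as m t p h0).mono fun _ s' h => ih h

theorem loopFor_succ {body : α → Prog N (Option α)} {n : ℕ} {a : α} {s : Config N}
    {r : Unit × Config N} (h : loopFor body n a s = some r) :
    loopFor body (n + 1) a s = some r := by
  induction n generalizing a s with
  | zero => exact absurd h (by simp [loopFor, abort])
  | succ n ih =>
    have key : ∀ k, loopFor body (k + 1) a s = (body a s).bind (fun r =>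
        (match r.1 with
          | none => pure ()
          | some b => loopFor body k b : Prog N Unit) r.2) := fun k => rfl
    rw [key] at h ⊢
    obtain ⟨⟨o, s₁⟩, h1, h2⟩ := Option.bind_eq_some_iff.1 h
    rw [h1]
    cases o with
    | none => exact h2
    | some b => exact ih h2

theorem loopFor_mono {body : α → Prog N (Option α)} {n k : ℕ} (hnk : n ≤ k) {a : α}
    {s : Config N} {r : Unit × Config N} (h : loopFor body n a s = some r) :
    loopFor body k a s = some r := by
  induction hnk with
  | refl => exact h
  | step _ ih => exact loopFor_succ ih

/-- `loop` uses the least sufficient number of passes. That run and the given one both extend to the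
larger number of passes, where they must agree. -/
theorem wp_loop_of_loopFor {body : α → Prog N (Option α)} {n : ℕ} {a : α} {s : Config N}
    {Q : Unit → Config N → Prop} (h : wp (loopFor body n a) s Q) : wp (loop body a) s Q := by
  obtain ⟨u, s', h1, h2⟩ := h
  have hex : ∃ n, ((loopFor body n a).run s).isSome := ⟨n, by
    have : (loopFor body n a).run s = some (u, s') := h1
    rw [this]; rfl⟩
  refine ⟨u, s', ?_, h2⟩
  classical
  have h3 : loop body a s = loopFor body (Nat.find hex) a s := by
    simp only [loop]
    rw [dif_pos hex]
    congr!
  rw [h3]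
  obtain ⟨r, hr⟩ := Option.isSome_iff_exists.1 (Nat.find_spec hex)
  have h4 := loopFor_mono (le_max_left _ n) hr
  have h5 := loopFor_mono (le_max_right (Nat.find hex) n) h1
  have h6 : r = (u, s') := Option.some.inj (h4.symm.trans h5)
  rw [← h6]; exact hr

/-- The rule for loops: `Inv n a s` says that at most `n + 1` passes are left. -/
theorem wp_loop (body : α → Prog N (Option α)) (Inv : ℕ → α → Config N → Prop)
    {Q : Unit → Config N → Prop} {n : ℕ} {a : α} {s : Config N}
    (step : ∀ n a m t p, Inv n a ⟨m, t, p⟩ → wp (body a) ⟨m, t, p⟩ (fun r s' =>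
      match r with
      | none => Q () s'
      | some b => ∃ k < n, Inv k b s'))
    (h0 : Inv n a s) : wp (loop body a) s Q := by
  refine wp_loop_of_loopFor (n := n + 1) ?_
  induction n using Nat.strong_induction_on generalizing a s with
  | _ n ih =>
    obtain ⟨m, t, p⟩ := s
    simp only [loopFor, wp_bind]
    refine (step n a m t p h0).mono fun r s' h => ?_
    cases r with
    | none => simpa using h
    | some b =>
      obtain ⟨k, hk, hI⟩ := h
      obtain ⟨u, s'', h1, h2⟩ := ih k hk hI
      exact ⟨u, s'', loopFor_mono (Nat.succ_le_of_lt hk) h1, h2⟩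

end Logic

/-! ## Memory words -/

section Space

variable {N : ℕ}

theorem sum_length_update (f : Fin N → List (Fin N)) (i : Fin N) (a : List (Fin N)) :
    ∑ v, (Function.update f i a v).length + (f i).length = ∑ v, (f v).length + a.length := by
  classical
  rw [← Finset.add_sum_erase _ _ (Finset.mem_univ i),
    ← Finset.add_sum_erase (s := Finset.univ) (fun v => (f v).length) (Finset.mem_univ i)]
  have : ∑ v ∈ Finset.univ.erase i, (Function.update f i a v).length
      = ∑ v ∈ Finset.univ.erase i, (f v).length :=
    Finset.sum_congr rfl fun v hv => by rw [Function.update_of_ne (Finset.ne_of_mem_erase hv)]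
  rw [this, Function.update_self]
  omega

theorem Mem.space_eq (m : Mem N) : m.space = 16 + 8 * N + m.order.size + m.main.arr.size
    + m.aux.arr.size + 2 * m.buffer.length + 2 * m.S.size
    + (2 * ∑ i, (m.parents i).length + 2 * ∑ i, (m.children i).length) := by
  simp only [Mem.space, Finset.sum_add_distrib, Finset.mul_sum]

theorem Mem.space_setList (m : Mem N) (w : ListId) (i : Fin N) (a : List (Fin N)) :
    (m.setList w i a).space + 2 * (m.list w i).length = m.space + 2 * a.length := by
  cases w
  · have := sum_length_update m.parents i a
    simp only [Mem.space_eq, Mem.setList, Mem.list]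
    omega
  · have := sum_length_update m.children i a
    simp only [Mem.space_eq, Mem.setList, Mem.list]
    omega

theorem Mem.space_setHeap (m : Mem N) (h : HeapId) (a : Heap N) :
    (m.setHeap h a).space + (m.heap h).arr.size = m.space + a.arr.size := by
  cases h <;> simp only [Mem.space_eq, Mem.setHeap, Mem.heap] <;> omega

@[simp] theorem Mem.heap_setHeap (m : Mem N) (h : HeapId) (a : Heap N) :
    (m.setHeap h a).heap h = a := by cases h <;> rfl

@[simp] theorem Mem.setHeap_setHeap (m : Mem N) (h : HeapId) (a b : Heap N) :
    (m.setHeap h a).setHeap h b = m.setHeap h b := by cases h <;> rfl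

@[simp] theorem Mem.setHeap_heap (m : Mem N) (h : HeapId) :
    m.setHeap h (m.heap h) = m := by cases h <;> rfl

@[simp] theorem Mem.list_setList (m : Mem N) (w : ListId) (i : Fin N) (a : List (Fin N)) :
    (m.setList w i a).list w i = a := by cases w <;> simp [Mem.list, Mem.setList]

@[simp] theorem Mem.setList_setList (m : Mem N) (w : ListId) (i : Fin N) (a b : List (Fin N)) :
    (m.setList w i a).setList w i b = m.setList w i b := by cases w <;> simp [Mem.setList]

theorem Mem.setList_setHeap (m : Mem N) (w : ListId) (i : Fin N) (l : List (Fin N)) (h : HeapId)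
    (a : Heap N) : (m.setList w i l).setHeap h a = (m.setHeap h a).setList w i l := by
  cases w <;> cases h <;> rfl

@[simp] theorem Mem.heap_setList (m : Mem N) (w : ListId) (i : Fin N) (l : List (Fin N))
    (h : HeapId) : (m.setList w i l).heap h = m.heap h := by
  cases w <;> cases h <;> rfl

end Space

/-! ## Binary heaps -/

section HeapOrder

/-- The heap order holds for the keys `f` at all positions from `b` on. -/
def OrderedFrom (b : ℕ) (f : ℕ → ℝ≥0∞) : Prop :=
  ∀ p, b ≤ p → f (2 * p + 1) ≤ f p ∧ f (2 * p + 2) ≤ f p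

/-- The heap order holds from `b` on, except that the key at `q` may be too small. -/
def OrderedExcept (b q : ℕ) (f : ℕ → ℝ≥0∞) : Prop :=
  (∀ p, b ≤ p → p ≠ q → f (2 * p + 1) ≤ f p ∧ f (2 * p + 2) ≤ f p) ∧
    -- The sons of the defective position stay below its parent, so lifting one of them into `q`
    -- does no harm above `q`.
    ∀ r, b ≤ r → (q = 2 * r + 1 ∨ q = 2 * r + 2) → f (2 * q + 1) ≤ f r ∧ f (2 * q + 2) ≤ f r

theorem OrderedExcept.orderedFrom {b q : ℕ} {f : ℕ → ℝ≥0∞} (h : OrderedExcept b q f)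
    (h1 : f (2 * q + 1) ≤ f q) (h2 : f (2 * q + 2) ≤ f q) : OrderedFrom b f := fun p hp => by
  by_cases hpq : p = q
  · subst hpq; exact ⟨h1, h2⟩
  · exact h.1 p hp hpq

theorem OrderedFrom.le_root {f : ℕ → ℝ≥0∞} (h : OrderedFrom 0 f) (q : ℕ) : f q ≤ f 0 := by
  induction q using Nat.strong_induction_on with
  | _ q ih =>
    rcases Nat.eq_zero_or_pos q with rfl | hq
    · exact le_rfl
    · have h1 := h ((q - 1) / 2) (Nat.zero_le _)
      have h2 := ih ((q - 1) / 2) (by omega)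
      rcases (by omega : q = 2 * ((q - 1) / 2) + 1 ∨ q = 2 * ((q - 1) / 2) + 2) with h3 | h3
      · exact (le_of_eq (congrArg f h3)).trans (h1.1.trans h2)
      · exact (le_of_eq (congrArg f h3)).trans (h1.2.trans h2)

/-- The larger son moves up and the defect moves down to `s`. Above `q` the order survives by the
second clause of `OrderedExcept`. The sons of `s` are below the old key of `s`, which is now the key
of its parent; this is the second clause for `s`. -/
theorem OrderedExcept.swap {b q s s' : ℕ} {f g : ℕ → ℝ≥0∞} (h : OrderedExcept b q f)
    (hb : b ≤ q) (hs : s = 2 * q + 1 ∧ s' = 2 * q + 2 ∨ s = 2 * q + 2 ∧ s' = 2 * q + 1)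
    (hlt : f q ≤ f s) (hle : f s' ≤ f s) (hgq : g q = f s) (hgs : g s = f q)
    (hg : ∀ p, p ≠ q → p ≠ s → g p = f p) : OrderedExcept b s g := by
  have hgs' : g s' = f s' := hg s' (by omega) (by omega)
  refine ⟨fun p hp hps => ?_, fun r hr hrs => ?_⟩
  · by_cases hpq : p = q
    · subst hpq
      rcases hs with ⟨rfl, rfl⟩ | ⟨rfl, rfl⟩
      · rw [hgq, hgs, hgs']; exact ⟨hlt, hle⟩
      · rw [hgq, hgs, hgs']; exact ⟨hle, hlt⟩
    · have h1 := h.1 p hp hpq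
      rw [hg p hpq hps]
      constructor
      · by_cases hq : 2 * p + 1 = q
        · rw [hq, hgq]
          have := h.2 p hp (by omega)
          rcases hs with ⟨rfl, _⟩ | ⟨rfl, _⟩
          exacts [this.1, this.2]
        · rw [hg _ hq (by omega)]; exact h1.1
      · by_cases hq : 2 * p + 2 = q
        · rw [hq, hgq]
          have := h.2 p hp (by omega)
          rcases hs with ⟨rfl, _⟩ | ⟨rfl, _⟩
          exacts [this.1, this.2]
        · rw [hg _ hq (by omega)]; exact h1.2
  · obtain rfl : r = q := by omega
    have h1 := h.1 s (by omega) (by omega)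
    rw [hg (2 * s + 1) (by omega) (by omega), hg (2 * s + 2) (by omega) (by omega), hgq]
    exact h1

end HeapOrder

/-! ### The heap operations: what they preserve and what they cost -/

section HeapOps

variable {N : ℕ}

/-- The positions of the entries of a heap are recorded correctly. -/
def Heap.IsValid (a : Heap N) : Prop :=
  ∀ v q, a.pos v = some q ↔ a.arr[q]? = some v

/-- The key at a position of the heap array; `0` if there is no entry. -/
def Heap.keyPos (a : Heap N) (q : ℕ) : ℝ≥0∞ := (a.arr[q]?).elim 0 a.key

theorem Heap.keyPos_of_getElem? {a : Heap N} {q : ℕ} {v : Fin N} (h : a.arr[q]? = some v) :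
    a.keyPos q = a.key v := by simp [Heap.keyPos, h]

theorem Heap.keyPos_of_size_le {a : Heap N} {q : ℕ} (h : a.arr.size ≤ q) : a.keyPos q = 0 := by
  simp [Heap.keyPos, Array.getElem?_eq_none h]

theorem Heap.IsValid.mem_iff {a : Heap N} (h : a.IsValid) (v : Fin N) :
    v ∈ a.arr ↔ ∃ q, a.pos v = some q := by
  rw [Array.mem_iff_getElem?]
  exact exists_congr fun q => (h v q).symm

theorem Heap.IsValid.nodup {a : Heap N} (h : a.IsValid) : a.arr.toList.Nodup := by
  rw [List.nodup_iff_injective_get]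
  intro i j hij
  have hi : a.arr[i.1]? = some (a.arr.toList.get i) := by simp
  have hj : a.arr[j.1]? = some (a.arr.toList.get i) := by rw [hij]; simp
  rw [← h] at hi hj
  exact Fin.ext (Option.some.inj (hi.symm.trans hj))

theorem Heap.IsValid.size_le {a : Heap N} (h : a.IsValid) : a.arr.size ≤ N := by
  simpa using h.nodup.length_le_card

/-- `b` is obtained from `a` by moving entries around. -/
structure Heap.Rearranges (a b : Heap N) : Prop where
  valid : b.IsValid
  key : b.key = a.key
  size : b.arr.size = a.arr.size
  mem : ∀ v, v ∈ b.arr ↔ v ∈ a.arr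

theorem Heap.Rearranges.refl {a : Heap N} (h : a.IsValid) : a.Rearranges a :=
  ⟨h, rfl, rfl, fun _ => Iff.rfl⟩

theorem Heap.Rearranges.trans {a b c : Heap N} (h : a.Rearranges b) (h' : b.Rearranges c) :
    a.Rearranges c :=
  ⟨h'.valid, h'.key.trans h.key, h'.size.trans h.size, fun v => (h'.mem v).trans (h.mem v)⟩

/-- The heap with the entries `u` at `i` and `v` at `j` exchanged. -/
def Heap.exchange (a : Heap N) (i j : ℕ) (u v : Fin N) : Heap N where
  arr := (a.arr.setIfInBounds i v).setIfInBounds j u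
  pos := Function.update (Function.update a.pos v (some i)) u (some j)
  key := a.key

theorem Heap.exchange_getElem? {a : Heap N} {i j : ℕ} {u v : Fin N} (hi : a.arr[i]? = some u)
    (hj : a.arr[j]? = some v) (q : ℕ) :
    (a.exchange i j u v).arr[q]? = if q = j then some u else if q = i then some v
      else a.arr[q]? := by
  have h1 : i < a.arr.size := (Array.getElem?_eq_some_iff.1 hi).1
  have h2 : j < a.arr.size := (Array.getElem?_eq_some_iff.1 hj).1
  simp only [Heap.exchange, Array.getElem?_setIfInBounds, Array.size_setIfInBounds, h1, h2, if_true,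
    eq_comm (a := j), eq_comm (a := i)]

theorem Heap.exchange_rearranges {a : Heap N} (h : a.IsValid) {i j : ℕ} {u v : Fin N}
    (hi : a.arr[i]? = some u) (hj : a.arr[j]? = some v) :
    a.Rearranges (a.exchange i j u v) := by
  have hpu := (h u i).2 hi
  have hpv := (h v j).2 hj
  have hval : (a.exchange i j u v).IsValid := by
    intro w q
    rw [Heap.exchange_getElem? hi hj]
    simp only [Heap.exchange, Function.update_apply]
    have hw := h w q
    have hu := h u q
    have hv := h v q
    grind
  refine ⟨hval, rfl, by simp [Heap.exchange], fun w => ?_⟩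
  rw [hval.mem_iff, h.mem_iff]
  simp only [Heap.exchange, Function.update_apply]
  grind

@[simp] theorem wp_heapSize (h : HeapId) (m : Mem N) (t p : ℕ) (Q : ℕ → Config N → Prop) :
    wp (heapSize h) ⟨m, t, p⟩ Q ↔ Q (m.heap h).arr.size ⟨m, t + 1, p⟩ := wp_load ..

theorem wp_heapGet {h : HeapId} {q : ℕ} {m : Mem N} {t p : ℕ} {v : Fin N}
    {Q : Fin N → Config N → Prop} (hv : (m.heap h).arr[q]? = some v) :
    wp (heapGet h q) ⟨m, t, p⟩ Q ↔ Q v ⟨m, t + 1, p⟩ := by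
  simp only [heapGet, wp_bind, wp_load, hv, wp_pure]

@[simp] theorem wp_readKey (h : HeapId) (v : Fin N) (m : Mem N) (t p : ℕ)
    (Q : ℝ≥0∞ → Config N → Prop) :
    wp (readKey h v) ⟨m, t, p⟩ Q ↔ Q ((m.heap h).key v) ⟨m, t + 1, p⟩ := wp_load ..

@[simp] theorem wp_heapPos (h : HeapId) (v : Fin N) (m : Mem N) (t p : ℕ)
    (Q : Option ℕ → Config N → Prop) :
    wp (heapPos h v) ⟨m, t, p⟩ Q ↔ Q ((m.heap h).pos v) ⟨m, t + 1, p⟩ := wp_load ..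

theorem wp_keyAt {h : HeapId} {q : ℕ} {m : Mem N} {t p : ℕ}
    {Q : ℝ≥0∞ → Config N → Prop} (hq : q < (m.heap h).arr.size) :
    wp (keyAt h q) ⟨m, t, p⟩ Q ↔ Q ((m.heap h).keyPos q) ⟨m, t + 2, p⟩ := by
  have hv := Array.getElem?_eq_getElem hq
  simp only [keyAt, wp_bind, wp_heapGet hv, wp_readKey, Heap.keyPos_of_getElem? hv]

theorem wp_heapSwap {h : HeapId} {i j : ℕ} {m : Mem N} {t p : ℕ} {u v : Fin N}
    {Q : Unit → Config N → Prop} (hu : (m.heap h).arr[i]? = some u)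
    (hv : (m.heap h).arr[j]? = some v) :
    wp (heapSwap h i j) ⟨m, t, p⟩ Q ↔ Q () ⟨m.setHeap h ((m.heap h).exchange i j u v), t + 6,
      max p (m.setHeap h ((m.heap h).exchange i j u v)).space⟩ := by
  simp only [heapSwap, wp_bind, wp_heapGet hu, wp_heapGet hv, wp_store, Heap.exchange]

theorem wp_largerSon {h : HeapId} {q : ℕ} {m : Mem N} {t p : ℕ} {Q : ℕ → Config N → Prop}
    (hq : 2 * q + 1 < (m.heap h).arr.size)
    (hQ : ∀ s s' k, (s = 2 * q + 1 ∧ s' = 2 * q + 2 ∨ s = 2 * q + 2 ∧ s' = 2 * q + 1) →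
      s < (m.heap h).arr.size → (m.heap h).keyPos s' ≤ (m.heap h).keyPos s → k ≤ 6 →
      Q s ⟨m, t + k, p⟩) :
    wp (largerSon h (m.heap h).arr.size q) ⟨m, t, p⟩ Q := by
  simp only [largerSon, wp_bind, wp_op, decide_eq_true_eq]
  split_ifs with h1
  · simp only [wp_bind, wp_op, decide_eq_true_eq, wp_keyAt h1, wp_keyAt hq, Nat.add_assoc]
    split_ifs with h2
    · rw [wp_pure]
      exact hQ _ (2 * q + 1) _ (Or.inr ⟨rfl, rfl⟩) h1 h2.le (by norm_num)
    · rw [wp_pure]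
      exact hQ _ (2 * q + 2) _ (Or.inl ⟨rfl, rfl⟩) hq (not_lt.1 h2) (by norm_num)
  · rw [wp_pure]
    refine hQ _ (2 * q + 2) _ (Or.inl ⟨rfl, rfl⟩) hq ?_ (by norm_num)
    rw [Heap.keyPos_of_size_le (not_lt.1 h1)]
    exact zero_le

/-- The cost of moving an entry down in a heap of at most `N` entries. -/
def siftCost (N : ℕ) : ℕ := 19 * (Nat.log 2 N + 2)

theorem siftDown_spec {h : HeapId} {b q : ℕ} {m : Mem N} {t p M : ℕ}
    (hval : (m.heap h).IsValid) (hbq : b ≤ q) (hord : OrderedExcept b q (m.heap h).keyPos)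
    (hM : m.space ≤ M) (hp : p ≤ M) :
    wp (siftDown h q) ⟨m, t, p⟩ (fun _ s' => ∃ a, s'.mem = m.setHeap h a ∧
      (m.heap h).Rearranges a ∧ OrderedFrom b a.keyPos ∧ s'.time ≤ t + siftCost N ∧
      s'.peak ≤ M) := by
  -- In `size < (q + 1) * 2 ^ n` the number `n` bounds the levels left, since going to a son at
  -- least doubles `q + 1`. A pass with an exchange costs at most 19 steps.
  refine wp_loop _ (fun n q s => ∃ a, s.mem = m.setHeap h a ∧ (m.heap h).Rearranges a ∧
    OrderedExcept b q a.keyPos ∧ b ≤ q ∧ (m.heap h).arr.size < (q + 1) * 2 ^ n ∧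
    s.time + 19 * (n + 1) ≤ t + siftCost N ∧ s.peak ≤ M)
    (n := Nat.log 2 N + 1) ?_ ?_
  · rintro n q m₁ t p ⟨a, hm, hR, hO, hbq, hn, ht, hp⟩
    simp only at hm ht hp
    subst hm
    simp only [wp_bind, wp_heapSize, wp_op, Mem.heap_setHeap, decide_eq_true_eq]
    split_ifs with h1
    · rw [wp_bind]
      have hls := @wp_largerSon N h q (m.setHeap h a) (t + 1 + 1) p
      rw [Mem.heap_setHeap] at hls
      refine hls h1 fun s s' k hs hsz hle hk => ?_
      have hq : q < a.arr.size := by omega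
      have hq' : q < ((m.setHeap h a).heap h).arr.size := by simpa using hq
      have hs' : s < ((m.setHeap h a).heap h).arr.size := by simpa using hsz
      simp only [wp_bind, wp_keyAt hq', wp_keyAt hs', wp_op, decide_eq_true_eq, Mem.heap_setHeap]
      split_ifs with h2
      · have gu := Array.getElem?_eq_getElem hq
        have gv := Array.getElem?_eq_getElem hsz
        have gu' : ((m.setHeap h a).heap h).arr[q]? = some a.arr[q] := by simp
        have gv' : ((m.setHeap h a).heap h).arr[s]? = some a.arr[s] := by simp
        simp only [wp_bind, wp_heapSwap gu' gv', Mem.heap_setHeap, Mem.setHeap_setHeap, wp_pure]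
        have hR' := Heap.exchange_rearranges hR.valid gu gv
        have hkey : ∀ w, (a.exchange q s a.arr[q] a.arr[s]).keyPos w
            = if w = s then a.keyPos q else if w = q then a.keyPos s else a.keyPos w := by
          intro w
          simp only [Heap.keyPos, Heap.exchange_getElem? gu gv, gu, gv]
          split_ifs <;> rfl
        cases n with
        | zero =>
          have h3 := hR.size
          omega
        | succ n =>
          refine ⟨n, Nat.lt_succ_self n, _, rfl, hR.trans hR', ?_, by omega, ?_, ?_, ?_⟩
          · refine hO.swap hbq hs h2.le hle ?_ ?_ ?_
            · rw [hkey, if_neg (by omega), if_pos rfl]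
            · rw [hkey, if_pos rfl]
            · intro w h3 h4
              rw [hkey, if_neg h4, if_neg h3]
          · refine hn.trans_le ?_
            rw [pow_succ, mul_comm (2 ^ n) 2, ← mul_assoc]
            exact Nat.mul_le_mul_right _ (by omega)
          · omega
          · have h3 := m.space_setHeap h (a.exchange q s a.arr[q] a.arr[s])
            have h4 := (hR.trans hR').size
            omega
      · rw [wp_pure]
        refine ⟨a, rfl, hR, ?_, by dsimp only; omega, hp⟩
        have h3 := not_lt.1 h2
        rcases hs with ⟨rfl, rfl⟩ | ⟨rfl, rfl⟩
        · exact hO.orderedFrom h3 (hle.trans h3)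
        · exact hO.orderedFrom (hle.trans h3) h3
    · rw [wp_pure]
      refine ⟨a, rfl, hR, hO.orderedFrom ?_ ?_, by dsimp only; omega, hp⟩
      · rw [Heap.keyPos_of_size_le (by omega)]; exact zero_le
      · rw [Heap.keyPos_of_size_le (by omega)]; exact zero_le
  · refine ⟨m.heap h, by simp, .refl hval, hord, hbq, ?_, ?_, hp⟩
    · have h1 : (m.heap h).arr.size < 2 ^ (Nat.log 2 N + 1) :=
        lt_of_le_of_lt hval.size_le (Nat.lt_pow_succ_log_self (by norm_num) N)
      exact h1.trans_le (Nat.le_mul_of_pos_left _ (Nat.succ_pos q))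
    · simp only [siftCost]; omega

theorem heapify_spec {h : HeapId} {m : Mem N} {t p M : ℕ}
    (hval : (m.heap h).IsValid) (hM : m.space ≤ M) (hp : p ≤ M) :
    wp (heapify h) ⟨m, t, p⟩ (fun _ s' => ∃ a, s'.mem = m.setHeap h a ∧
      (m.heap h).Rearranges a ∧ OrderedFrom 0 a.keyPos ∧
      s'.time ≤ t + 2 + (m.heap h).arr.size * (siftCost N + 1) ∧ s'.peak ≤ M) := by
  simp only [heapify, wp_bind, wp_heapSize]
  refine wp_forEach _ (fun l s => ∃ n a, l = (List.range n).reverse ∧ s.mem = m.setHeap h a ∧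
    (m.heap h).Rearranges a ∧ OrderedFrom n a.keyPos ∧
    s.time + n * (siftCost N + 1) ≤ t + 1 + (m.heap h).arr.size * (siftCost N + 1) ∧ s.peak ≤ M)
    ?_ ?_ ?_
  · rintro q as m₁ t₁ p ⟨n, a, hl, hm, hR, hO, ht, hp⟩
    simp only at hm ht hp
    subst hm
    cases n with
    | zero => simp at hl
    | succ n =>
      rw [List.range_succ, List.reverse_append] at hl
      obtain ⟨rfl, rfl⟩ := List.cons.inj hl
      have h1 := m.space_setHeap h a
      have h2 := hR.size
      refine (siftDown_spec (h := h) (b := q) (M := M) (by simpa using hR.valid) le_rfl ?_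
        (by omega) hp).mono ?_
      · rw [Mem.heap_setHeap]
        -- No position `r ≥ q` has `q` as a son, so the clause about the parent of the defect is
        -- vacuous.
        exact ⟨fun p hp hpq => hO p (by omega), fun r hr hrq => by omega⟩
      · rintro _ s' ⟨a', hm', hR', hO', ht', hp'⟩
        rw [Mem.heap_setHeap] at hR'
        rw [Mem.setHeap_setHeap] at hm'
        refine ⟨q, a', rfl, hm', hR.trans hR', hO', ?_, hp'⟩
        rw [Nat.add_mul] at ht
        omega
  · refine ⟨_, m.heap h, rfl, by simp, .refl hval, ?_, le_rfl, hp⟩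
    -- Beyond the end of the array `keyPos` is `0`, so the order holds there for free.
    intro p hp
    rw [Heap.keyPos_of_size_le (q := 2 * p + 1) (by omega),
      Heap.keyPos_of_size_le (q := 2 * p + 2) (by omega)]
    exact ⟨zero_le, zero_le⟩
  · rintro m₁ t₁ p ⟨n, a, hl, hm, hR, hO, ht, hp⟩
    cases n with
    | zero =>
      refine ⟨a, hm, hR, hO, ?_, hp⟩
      simp only at ht ⊢
      omega
    | succ n => simp [List.range_succ] at hl

/-- Once the last entry has replaced the root and the array is shortened, no key at a positive
position has grown, so only the root can be too small. -/
theorem heapPop_spec {h : HeapId} {m : Mem N} {t p M : ℕ}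
    (hval : (m.heap h).IsValid) (hord : OrderedFrom 0 (m.heap h).keyPos)
    (hne : (m.heap h).arr.size ≠ 0) (hM : m.space ≤ M) (hp : p ≤ M) :
    wp (heapPop h) ⟨m, t, p⟩ (fun r s' => r.2 = (m.heap h).key r.1 ∧ r.1 ∈ (m.heap h).arr ∧
      (∀ v ∈ (m.heap h).arr, (m.heap h).key v ≤ (m.heap h).key r.1) ∧
      ∃ a, s'.mem = m.setHeap h a ∧ a.IsValid ∧ OrderedFrom 0 a.keyPos ∧
        a.key = (m.heap h).key ∧ a.arr.size + 1 = (m.heap h).arr.size ∧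
        (∀ v, v ∈ a.arr ↔ v ∈ (m.heap h).arr ∧ v ≠ r.1) ∧
        s'.time ≤ t + (siftCost N + 11) ∧ s'.peak ≤ M) := by
  have hs0 : 0 < (m.heap h).arr.size := by omega
  have hs1 : (m.heap h).arr.size - 1 < (m.heap h).arr.size := by omega
  have gu := Array.getElem?_eq_getElem hs0
  have gv := Array.getElem?_eq_getElem hs1
  set u := (m.heap h).arr[0] with hu
  set v := (m.heap h).arr[(m.heap h).arr.size - 1] with hv
  simp only [heapPop, wp_bind, wp_heapSize, wp_heapGet gu, wp_readKey, wp_heapSwap gu gv,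
    heapDropLast, wp_store, Mem.heap_setHeap, Mem.setHeap_setHeap]
  have hR := Heap.exchange_rearranges hval gu gv
  have hg := Heap.exchange_getElem? gu gv
  set e := (m.heap h).exchange 0 ((m.heap h).arr.size - 1) u v with he
  set b : Heap N := ⟨e.arr.pop, Function.update e.pos u none, e.key⟩ with hb
  have hbg : ∀ q, b.arr[q]? = if q < (m.heap h).arr.size - 1 then e.arr[q]? else none := by
    intro q
    simp only [hb, Array.getElem?_pop, hR.size]
  have hbval : b.IsValid := by
    intro w q
    rw [hbg]
    have h1 := hR.valid w q
    have h2 := hR.valid u q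
    have h3 := hR.valid u ((m.heap h).arr.size - 1)
    have h4 : q < (m.heap h).arr.size - 1 ∨ q = (m.heap h).arr.size - 1 ∨
      (e.arr.size ≤ q) := by rw [hR.size]; omega
    have h5 := hg ((m.heap h).arr.size - 1)
    rw [if_pos rfl] at h5
    have h6 : e.arr.size ≤ q → e.arr[q]? = none := fun h => Array.getElem?_eq_none h
    have h7 := hR.size
    simp only [hb, Function.update_apply]
    grind
  have hbmem : ∀ w, w ∈ b.arr ↔ w ∈ (m.heap h).arr ∧ w ≠ u := by
    intro w
    rw [← hR.mem, hbval.mem_iff, hR.valid.mem_iff]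
    simp only [hb, Function.update_apply]
    grind
  have hbsize : b.arr.size + 1 = (m.heap h).arr.size := by
    simp only [hb, Array.size_pop, hR.size]; omega
  have hroot : ∀ w ∈ (m.heap h).arr, (m.heap h).key w ≤ (m.heap h).key u := by
    intro w hw
    obtain ⟨q, hq⟩ := Array.mem_iff_getElem?.1 hw
    have := hord.le_root q
    rwa [Heap.keyPos_of_getElem? hq, Heap.keyPos_of_getElem? gu] at this
  have hbord : OrderedExcept 0 0 b.keyPos := by
    refine ⟨fun p _ hp => ?_, fun r _ hr => by omega⟩
    have hle : ∀ q, 0 < q → b.keyPos q ≤ (m.heap h).keyPos q := by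
      intro q hq
      simp only [Heap.keyPos, hbg, hg]
      split_ifs with h1 h2 h3
      · omega
      · omega
      · exact le_of_eq rfl
      · exact zero_le
    have heq : ∀ q, 0 < q → q < (m.heap h).arr.size - 1 → b.keyPos q = (m.heap h).keyPos q := by
      intro q hq hq'
      simp only [Heap.keyPos, hbg, hg]
      rw [if_pos hq', if_neg (by omega), if_neg (by omega)]
      rfl
    by_cases h1 : p < (m.heap h).arr.size - 1
    · rw [heq p (by omega) h1]
      exact ⟨(hle _ (by omega)).trans (hord p (by omega)).1,
        (hle _ (by omega)).trans (hord p (by omega)).2⟩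
    · rw [Heap.keyPos_of_size_le (q := 2 * p + 1) (by omega),
        Heap.keyPos_of_size_le (q := 2 * p + 2) (by omega)]
      exact ⟨zero_le, zero_le⟩
  have hsp1 := m.space_setHeap h e
  have hsp2 := m.space_setHeap h b
  have hsz := hR.size
  refine (siftDown_spec (h := h) (b := 0) (M := M) (by simpa using hbval) le_rfl
    (by simpa using hbord) (by omega) (by omega)).mono ?_
  rintro _ s' ⟨a, hm, hRa, hO, ht, hp⟩
  rw [Mem.heap_setHeap] at hRa
  rw [Mem.setHeap_setHeap] at hm
  rw [wp_pure]
  refine ⟨rfl, Array.mem_iff_getElem?.2 ⟨0, gu⟩, hroot, a, hm, hRa.valid, hO,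
    hRa.key, by rw [hRa.size]; exact hbsize, fun w => by rw [hRa.mem]; exact hbmem w, ?_, hp⟩
  omega

/-- A lowered key can only be too small for its sons, so moving it down suffices. The parent of the
position still dominates these sons, because the old key lay in between. -/
theorem heapDecrease_spec {h : HeapId} {v : Fin N} {c : ℝ≥0∞} {m : Mem N} {t p M : ℕ}
    (hval : (m.heap h).IsValid) (hord : OrderedFrom 0 (m.heap h).keyPos)
    (hM : m.space ≤ M) (hp : p ≤ M) :
    wp (heapDecrease h v c) ⟨m, t, p⟩ (fun _ s' => ∃ a, s'.mem = m.setHeap h a ∧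
      a.IsValid ∧ OrderedFrom 0 a.keyPos ∧ a.arr.size = (m.heap h).arr.size ∧
      (∀ w, w ∈ a.arr ↔ w ∈ (m.heap h).arr) ∧
      (∀ w ∈ a.arr, a.key w = if w = v then min ((m.heap h).key w) c else (m.heap h).key w) ∧
      s'.time ≤ t + (siftCost N + 4) ∧ s'.peak ≤ M) := by
  simp only [heapDecrease, wp_bind, wp_heapPos]
  cases hq : (m.heap h).pos v with
  | none =>
    rw [wp_pure]
    refine ⟨m.heap h, by simp, hval, hord, rfl, fun _ => Iff.rfl, fun w hw => ?_,
      by dsimp only; omega, hp⟩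
    rw [if_neg]
    rintro rfl
    obtain ⟨q, hq'⟩ := (hval.mem_iff w).1 hw
    rw [hq] at hq'
    cases hq'
  | some q =>
    simp only [wp_bind, wp_readKey, wp_op, decide_eq_true_eq]
    have hvq := (hval v q).1 hq
    split_ifs with hlt
    · simp only [wp_bind, writeKey, wp_store]
      set b : Heap N := ⟨(m.heap h).arr, (m.heap h).pos, Function.update (m.heap h).key v c⟩ with hb
      have hbk : ∀ r, r ≠ q → b.keyPos r = (m.heap h).keyPos r := by
        intro r hr
        simp only [Heap.keyPos, hb]
        cases hw : (m.heap h).arr[r]? with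
        | none => rfl
        | some w =>
          have : w ≠ v := by
            rintro rfl
            exact hr (Option.some.inj (((hval w r).2 hw).symm.trans hq))
          simp [Function.update_of_ne this]
      have hbq : b.keyPos q ≤ (m.heap h).keyPos q := by
        simp only [Heap.keyPos, hb, hvq, Option.elim, Function.update_self]
        exact hlt.le
      have hbord : OrderedExcept 0 q b.keyPos := by
        refine ⟨fun r _ hr => ?_, fun r _ hr => ?_⟩
        · have h1 := hord r (Nat.zero_le r)
          have hle : ∀ r, b.keyPos r ≤ (m.heap h).keyPos r := fun r => by
            by_cases h : r = q
            · subst h; exact hbq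
            · exact (hbk r h).le
          rw [hbk r hr]
          exact ⟨(hle _).trans h1.1, (hle _).trans h1.2⟩
        · have h1 := hord q (Nat.zero_le q)
          have h2 : (m.heap h).keyPos q ≤ (m.heap h).keyPos r := by
            rcases hr with rfl | rfl
            exacts [(hord r (Nat.zero_le r)).1, (hord r (Nat.zero_le r)).2]
          rw [hbk r (by omega), hbk _ (by omega), hbk _ (by omega)]
          exact ⟨h1.1.trans h2, h1.2.trans h2⟩
      have hsp := m.space_setHeap h b
      have hbs : b.arr.size = (m.heap h).arr.size := rfl
      refine (siftDown_spec (h := h) (b := 0) (M := M) (m := m.setHeap h b)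
        (by rw [Mem.heap_setHeap]; exact hval) (Nat.zero_le q)
        (by simpa using hbord) (by omega) (by omega)).mono ?_
      rintro _ s' ⟨a, hm, hRa, hO, ht, hp⟩
      rw [Mem.heap_setHeap] at hRa
      rw [Mem.setHeap_setHeap] at hm
      refine ⟨a, hm, hRa.valid, hO, hRa.size, hRa.mem, fun w _ => ?_, by omega, hp⟩
      rw [hRa.key]
      simp only [hb, Function.update_apply]
      split_ifs with h1
      · subst h1; exact (min_eq_right hlt.le).symm
      · rfl
    · rw [wp_pure]
      refine ⟨m.heap h, by simp, hval, hord, rfl, fun _ => Iff.rfl, fun w hw => ?_,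
        by dsimp only; omega, hp⟩
      split_ifs with h1
      · subst h1; exact (min_eq_left (not_lt.1 hlt)).symm
      · rfl

/-- Append an entry to the heap array. -/
def Heap.append (a : Heap N) (v : Fin N) (c : ℝ≥0∞) : Heap N where
  arr := a.arr.push v
  pos := Function.update a.pos v (some a.arr.size)
  key := Function.update a.key v c

@[simp] theorem wp_heapAppend (h : HeapId) (v : Fin N) (c : ℝ≥0∞) (m : Mem N) (t p : ℕ)
    (Q : Unit → Config N → Prop) :
    wp (heapAppend h v c) ⟨m, t, p⟩ Q ↔ Q () ⟨m.setHeap h ((m.heap h).append v c), t + 3,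
      max p (m.setHeap h ((m.heap h).append v c)).space⟩ := wp_store ..

theorem Heap.IsValid.append {a : Heap N} (ha : a.IsValid) {v : Fin N} (hv : v ∉ a.arr)
    (c : ℝ≥0∞) : (a.append v c).IsValid := by
  have h1 := mt (ha.mem_iff v).2 hv
  intro w q
  have h2 := ha w q
  have h3 := ha v q
  have h4 : a.arr.size ≤ q → a.arr[q]? = none := fun h => Array.getElem?_eq_none h
  simp only [Heap.append, Function.update_apply, Array.getElem?_push]
  grind

@[simp] theorem Heap.mem_append (a : Heap N) (v : Fin N) (c : ℝ≥0∞) (w : Fin N) :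
    w ∈ (a.append v c).arr ↔ w ∈ a.arr ∨ w = v := by
  simp [Heap.append]

end HeapOps

/-! ## Sorting and filtering lists -/

section Lists

variable {N : ℕ}

@[simp] theorem wp_readList (w : ListId) (i : Fin N) (m : Mem N) (t p : ℕ)
    (Q : List (Fin N) → Config N → Prop) :
    wp (readList w i) ⟨m, t, p⟩ Q ↔ Q (m.list w i) ⟨m, t + 1, p⟩ := wp_load ..

@[simp] theorem wp_clearList (w : ListId) (i : Fin N) (m : Mem N) (t p : ℕ)
    (Q : Unit → Config N → Prop) :
    wp (clearList w i) ⟨m, t, p⟩ Q ↔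
      Q () ⟨m.setList w i [], t + 1, max p (m.setList w i []).space⟩ := wp_store ..

@[simp] theorem wp_pushList (w : ListId) (i j : Fin N) (m : Mem N) (t p : ℕ)
    (Q : Unit → Config N → Prop) :
    wp (pushList w i j) ⟨m, t, p⟩ Q ↔ Q () ⟨m.setList w i (j :: m.list w i), t + 3,
      max p (m.setList w i (j :: m.list w i)).space⟩ := wp_store ..

theorem length_le_of_nodup {l : List (Fin N)} (h : l.Nodup) : l.length ≤ N := by
  simpa using h.length_le_card

/-- The cost that sorting causes for every entry of the list. -/
def sortCost (I : Input N) : ℕ := I.oracleCost + 2 * siftCost N + 40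

/-- The largest distance is popped first and entries are prepended, so the list becomes increasing.
The margin in `hM` is the auxiliary heap, which is filled while the old list still exists. -/
theorem sortChildren_spec (I : Input N) {i : Fin N} {m : Mem N} {t p M : ℕ}
    (hval : m.aux.IsValid) (hempty : m.aux.arr = #[]) (hnd : (m.children i).Nodup)
    (hM : m.space + (m.children i).length ≤ M) (hp : p ≤ M) :
    wp (sortChildren I i) ⟨m, t, p⟩ (fun _ s' => ∃ a cs,
      s'.mem = (m.setHeap .aux a).setList .children i cs ∧
      a.IsValid ∧ a.arr = #[] ∧ cs.Nodup ∧ (∀ w, w ∈ cs ↔ w ∈ m.children i) ∧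
      cs.Pairwise (fun v w => I.dist v i ≤ I.dist w i) ∧
      s'.time ≤ t + ((m.children i).length + 1) * sortCost I ∧ s'.peak ≤ M) := by
  have hsz0 : m.aux.arr.size = 0 := by simp [hempty]
  simp only [sortChildren, wp_bind, wp_readList]
  have hcs : m.list .children i = m.children i := rfl
  rw [hcs]
  set cs := m.children i with hcs0
  refine (wp_forEach _ (fun as s => ∃ pre a, pre ++ as = cs ∧ s.mem = m.setHeap .aux a ∧
    a.IsValid ∧ (∀ w, w ∈ a.arr ↔ w ∈ pre) ∧ (∀ w ∈ pre, a.key w = I.dist w i) ∧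
    a.arr.size = pre.length ∧ s.time ≤ t + 1 + pre.length * (I.oracleCost + 5) ∧ s.peak ≤ M)
    (Q := fun _ s => ∃ a, s.mem = m.setHeap .aux a ∧
    a.IsValid ∧ (∀ w, w ∈ a.arr ↔ w ∈ cs) ∧ (∀ w ∈ cs, a.key w = I.dist w i) ∧
    a.arr.size = cs.length ∧ s.time ≤ t + 2 + cs.length * (I.oracleCost + 5) ∧ s.peak ≤ M)
    ?_ ?_ ?_).mono ?_
  · rintro j as m₁ t₁ p₁ ⟨pre, a, hpre, hm, ha, hmem, hkey, hsz, ht, hp₁⟩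
    simp only at hm ht hp₁
    subst hm
    simp only [wp_bind, wp_queryDist, wp_heapAppend, Mem.heap_setHeap, Mem.setHeap_setHeap]
    have hj : j ∉ pre := by
      intro hj
      rw [← hpre] at hnd
      exact (List.nodup_append.1 hnd).2.2 j hj j (by simp) rfl
    have hlen : pre.length + (as.length + 1) = cs.length := by rw [← hpre]; simp
    have hsp := m.space_setHeap .aux (a.append j (I.dist j i))
    have hsz' : (a.append j (I.dist j i)).arr.size = pre.length + 1 := by
      simp [Heap.append, hsz]
    have hsz1 : (m.heap .aux).arr.size = 0 := hsz0
    refine ⟨pre ++ [j], a.append j (I.dist j i), by simpa using hpre, rfl,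
      ha.append (by rwa [hmem]) _, fun w => by simp [hmem], fun w hw => ?_, by simpa using hsz',
      ?_, by omega⟩
    · simp only [Heap.append, Function.update_apply]
      split_ifs with h1
      · rw [h1]
      · exact hkey w (by simpa [h1] using hw)
    · simp only [List.length_append, List.length_singleton, Nat.add_mul]
      omega
  · refine ⟨[], m.aux, rfl, (m.setHeap_heap .aux).symm, hval, by simp [hempty], by simp, hsz0,
      by simp, hp⟩
  · rintro m₁ t₁ p₁ ⟨pre, a, hpre, hm, ha, hmem, hkey, hsz, ht, hp₁⟩
    rw [List.append_nil] at hpre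
    subst hpre
    exact ⟨a, hm, ha, hmem, hkey, hsz, by dsimp only at ht ⊢; omega, hp₁⟩
  rintro _ ⟨m₁, t₁, p₁⟩ ⟨a, hm, ha, hmem, hkey, hsz, ht, hp₁⟩
  simp only at hm ht hp₁
  subst hm
  simp only [wp_clearList]
  have hsp1 := m.space_setHeap .aux a
  have hsp2 := (m.setHeap .aux a).space_setList .children i []
  have hl1 : ((m.setHeap .aux a).list .children i).length = cs.length := rfl
  have hsz1 : (m.heap .aux).arr.size = 0 := hsz0
  simp only [List.length_nil, Nat.mul_zero] at hsp2
  refine (heapify_spec (h := .aux) (M := M)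
    (m := (m.setHeap .aux a).setList .children i []) (by simpa using ha)
    (by omega) (by omega)).mono ?_
  rintro _ ⟨m₂, t₂, p₂⟩ ⟨b, hm₂, hR, hO, ht₂, hp₂⟩
  simp only at hm₂ ht₂ hp₂
  subst hm₂
  simp only [Mem.heap_setList, Mem.heap_setHeap] at hR ht₂
  rw [Mem.setList_setHeap, Mem.setHeap_setHeap]
  simp only [wp_heapSize, Mem.heap_setList, Mem.heap_setHeap]
  have hnc : cs.length * (I.oracleCost + 5) + cs.length * (siftCost N + 1)
      + cs.length * (siftCost N + 15) = cs.length * (I.oracleCost + 2 * siftCost N + 21) := by ring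
  -- Every key left in the heap is at most every key in `L`; therefore the next maximum may be put
  -- in front of `L`.
  refine wp_forEach _ (fun as s => ∃ c L, s.mem = (m.setHeap .aux c).setList .children i L ∧
    c.IsValid ∧ OrderedFrom 0 c.keyPos ∧ c.key = b.key ∧ c.arr.size = as.length ∧ L.Nodup ∧
    (∀ w, w ∈ cs ↔ w ∈ L ∨ w ∈ c.arr) ∧ (∀ w ∈ L, w ∉ c.arr) ∧
    (∀ v ∈ c.arr, ∀ w ∈ L, b.key v ≤ b.key w) ∧ L.Pairwise (fun v w => b.key v ≤ b.key w) ∧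
    L.length + as.length = cs.length ∧
    s.time + as.length * (siftCost N + 15) ≤ t₂ + 1 + cs.length * (siftCost N + 15) ∧
    s.peak ≤ M) ?_ ?_ ?_
  · rintro _ as m₃ t₃ p₃ ⟨c, L, hm, hc, hcO, hck, hcs, hL, hLmem, hdis, hle, hLs, hlen, ht₃, hp₃⟩
    simp only at hm ht₃ hp₃
    subst hm
    simp only [List.length_cons] at hcs hlen ht₃
    have hsp1 := m.space_setHeap .aux c
    have hsp2 := (m.setHeap .aux c).space_setList .children i L
    have hl1 : ((m.setHeap .aux c).list .children i).length = cs.length := rfl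
    rw [wp_bind]
    refine (heapPop_spec (h := .aux) (M := M) (by simpa using hc) (by simpa using hcO)
      (by simp [hcs]) (by omega) hp₃).mono ?_
    rintro ⟨v, kv⟩ ⟨m₄, t₄, p₄⟩ ⟨-, hv, hmax, d, hm₄, hd, hdO, hdk, hds, hdm, ht₄, hp₄⟩
    simp only at hm₄ ht₄ hp₄ hdm hv hmax
    subst hm₄
    simp only [Mem.heap_setList, Mem.heap_setHeap] at hv hmax hdk hds hdm
    rw [Mem.setList_setHeap, Mem.setHeap_setHeap]
    simp only [wp_pushList, Mem.list_setList, Mem.setList_setList]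
    have hsp3 := m.space_setHeap .aux d
    have hsp4 := (m.setHeap .aux d).space_setList .children i (v :: L)
    have hl2 : ((m.setHeap .aux d).list .children i).length = cs.length := rfl
    simp only [List.length_cons] at hsp4
    refine ⟨d, v :: L, rfl, hd, hdO, hdk.trans hck, by omega, ?_, fun w => ?_, ?_, ?_, ?_,
      by simp only [List.length_cons]; omega, ?_, by omega⟩
    · exact List.nodup_cons.2 ⟨fun h => hdis v h hv, hL⟩
    · rw [hLmem, hdm, List.mem_cons]
      by_cases h : w = v
      · subst h; simp [hv]
      · simp [h]
    · intro w hw hwd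
      rw [hdm] at hwd
      rcases List.mem_cons.1 hw with rfl | hw
      · exact hwd.2 rfl
      · exact hdis w hw hwd.1
    · intro u hu w hw
      rw [hdm] at hu
      rcases List.mem_cons.1 hw with rfl | hw
      · rw [← hck]; exact hmax u hu.1
      · exact hle u hu.1 w hw
    · exact List.pairwise_cons.2 ⟨fun w hw => hle v hv w hw, hLs⟩
    · rw [Nat.add_mul] at ht₃
      omega
  · refine ⟨b, [], rfl, hR.valid, hO, rfl, by simp, by simp, fun w => ?_, by simp, by simp, by simp,
      ?_, ?_, hp₂⟩
    · rw [hR.mem, hmem]; simp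
    · simp [hR.size, hsz]
    · simp [hR.size, hsz]
  · rintro m₃ t₃ p₃ ⟨c, L, hm, hc, hcO, hck, hcs, hL, hLmem, hdis, hle, hLs, hlen, ht₃, hp₃⟩
    have hc0 : c.arr = #[] := by simpa using hcs
    refine ⟨c, L, hm, hc, hc0, hL, fun w => by rw [hLmem]; simp [hc0], ?_, ?_, hp₃⟩
    · have hL' : ∀ w ∈ L, b.key w = I.dist w i := fun w hw => by
        rw [hR.key]; exact hkey w ((hLmem w).2 (Or.inl hw))
      refine hLs.imp_of_mem ?_
      intro v w hv hw h
      rwa [hL' v hv, hL' w hw] at h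
    · simp only [List.length_nil, Nat.zero_mul, Nat.add_zero] at ht₃ ⊢
      rw [hsz] at ht₂
      have : cs.length * (I.oracleCost + 2 * siftCost N + 21) ≤ cs.length * sortCost I :=
        Nat.mul_le_mul_left _ (by unfold sortCost; omega)
      rw [Nat.add_mul, Nat.one_mul]
      have : 40 ≤ sortCost I := by unfold sortCost; omega
      omega

/-- Both passes prepend, so the second restores the order that the first reverses. The test runs
while the buffer fills up, hence `hkeep` quantifies over its content. The margin in `hM` is the
buffer. -/
theorem filterList_spec {w : ListId} {i : Fin N} {keep : Fin N → Prog N Bool} {f : Fin N → Bool}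
    {m : Mem N} {t p M k : ℕ} (hbuf : m.buffer = [])
    (hkeep : ∀ j ∈ m.list w i, ∀ B t p, p ≤ M → wp (keep j) ⟨{ m with buffer := B }, t, p⟩
      (fun r s' => r = f j ∧ s'.mem = { m with buffer := B } ∧ s'.time ≤ t + k ∧ s'.peak ≤ M))
    (hM : m.space + 2 * (m.list w i).length ≤ M) (hp : p ≤ M) :
    wp (filterList w i keep) ⟨m, t, p⟩ (fun _ s' =>
      s'.mem = m.setList w i ((m.list w i).filter f) ∧
      s'.time ≤ t + 7 + (m.list w i).length * (k + 8) ∧ s'.peak ≤ M) := by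
  have hbspace : ∀ (m' : Mem N) (B : List (Fin N)),
      ({ m' with buffer := B } : Mem N).space + 2 * m'.buffer.length = m'.space + 2 * B.length := by
    intro m' B
    simp only [Mem.space_eq]; omega
  have hm0 : ({ m with buffer := [] } : Mem N) = m := by rw [← hbuf]
  have hlb : ∀ B, ({ m with buffer := B } : Mem N).list w i = m.list w i := fun B => by
    cases w <;> rfl
  simp only [filterList, wp_bind, clearBuffer, wp_store, wp_readList, hm0]
  set js := m.list w i with hjs
  have hbl : m.buffer.length = 0 := by simp [hbuf]
  refine (wp_forEach _ (fun as s => ∃ pre, pre ++ as = js ∧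
    s.mem = { m with buffer := (pre.filter f).reverse } ∧
    s.time ≤ t + 2 + pre.length * (k + 4) ∧ s.peak ≤ M)
    (Q := fun _ s => s.mem = { m with buffer := (js.filter f).reverse } ∧
    s.time ≤ t + 3 + js.length * (k + 4) ∧ s.peak ≤ M) ?_ ?_ ?_).mono ?_
  · rintro j as m₁ t₁ p₁ ⟨pre, hpre, hm, ht, hp₁⟩
    simp only at hm ht hp₁
    subst hm
    have hlen : pre.length + (as.length + 1) = js.length := by rw [← hpre]; simp
    rw [wp_bind]
    refine (hkeep j (by rw [← hpre]; simp) _ _ _ hp₁).mono ?_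
    rintro _ ⟨m₂, t₂, p₂⟩ ⟨rfl, hm₂, ht₂, hp₂⟩
    simp only at hm₂ ht₂ hp₂
    subst hm₂
    split_ifs with h1
    · simp only [pushBuffer, wp_store]
      refine ⟨pre ++ [j], by simpa using hpre, by simp [h1], ?_, ?_⟩
      · simp only [List.length_append, List.length_singleton, Nat.add_mul]; omega
      · have h2 := hbspace m (j :: (pre.filter f).reverse)
        have h3 : ((pre.filter f).reverse).length ≤ pre.length := by
          simpa using List.length_filter_le f pre
        simp only [List.length_cons] at h2 ⊢
        omega
    · rw [wp_pure]
      refine ⟨pre ++ [j], by simpa using hpre, by simp [h1], ?_, hp₂⟩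
      simp only [List.length_append, List.length_singleton, Nat.add_mul]; omega
  · refine ⟨[], rfl, hm0.symm, by simp, ?_⟩
    dsimp only; omega
  · rintro m₁ t₁ p₁ ⟨pre, hpre, hm, ht, hp₁⟩
    rw [List.append_nil] at hpre
    subst hpre
    exact ⟨hm, by dsimp only at ht ⊢; omega, hp₁⟩
  rintro _ ⟨m₁, t₁, p₁⟩ ⟨hm, ht, hp₁⟩
  simp only at hm ht hp₁
  subst hm
  simp only [wp_clearList, readBuffer, wp_load]
  set F := js.filter f with hF
  have hFlen : F.length ≤ js.length := List.length_filter_le f js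
  have hbuf' : (({ m with buffer := F.reverse } : Mem N).setList w i []).buffer = F.reverse := by
    cases w <;> rfl
  rw [hbuf']
  have hsp1 := hbspace m F.reverse
  rw [List.length_reverse] at hsp1
  have hsp2 : ∀ L, (({ m with buffer := F.reverse } : Mem N).setList w i L).space
      + 2 * js.length = ({ m with buffer := F.reverse } : Mem N).space + 2 * L.length := by
    intro L
    rw [← hlb F.reverse]
    exact Mem.space_setList _ _ _ _
  have hsp3 := hsp2 []
  simp only [List.length_nil] at hsp3
  refine (wp_forEach _ (fun as s => ∃ L, as.reverse ++ L = F ∧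
    s.mem = ({ m with buffer := F.reverse } : Mem N).setList w i L ∧
    s.time + as.length * 4 ≤ t₁ + 2 + F.length * 4 ∧ s.peak ≤ M)
    (Q := fun _ s => s.mem = ({ m with buffer := F.reverse } : Mem N).setList w i F ∧
    s.time ≤ t₁ + 3 + F.length * 4 ∧ s.peak ≤ M) ?_ ?_ ?_).mono ?_
  · rintro j as m₂ t₂ p₂ ⟨L, hL, hm, ht₂, hp₂⟩
    simp only at hm ht₂ hp₂
    subst hm
    have hlen : as.length + 1 + L.length = F.length := by rw [← hL]; simp; omega
    simp only [wp_pushList, Mem.list_setList, Mem.setList_setList]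
    have h2 := hsp2 (j :: L)
    simp only [List.length_cons] at h2 ht₂
    refine ⟨j :: L, by simpa using hL, rfl, by omega, by omega⟩
  · refine ⟨[], by simp, rfl, by simp, ?_⟩
    dsimp only; omega
  · rintro m₂ t₂ p₂ ⟨L, hL, hm, ht₂, hp₂⟩
    simp only [List.reverse_nil, List.nil_append] at hL
    subst hL
    simp only [List.length_nil] at ht₂
    exact ⟨hm, by dsimp only; omega, hp₂⟩
  rintro _ ⟨m₂, t₂, p₂⟩ ⟨hm, ht₂, hp₂⟩
  simp only at hm ht₂ hp₂
  subst hm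
  have hfin : ∀ m' : Mem N, m' = ({ m with buffer := F.reverse } : Mem N).setList w i F →
      ({ m' with buffer := [] } : Mem N) = m.setList w i F := by
    rintro _ rfl
    cases w <;> simp [Mem.setList, hbuf]
  have hsp4 := m.space_setList w i F
  rw [← hjs] at hsp4
  rw [wp_store, hfin _ rfl]
  refine ⟨rfl, ?_, by dsimp only; omega⟩
  have h5 : js.length * (k + 8) = js.length * (k + 4) + js.length * 4 := by ring
  dsimp only; omega

end Lists

/-! ## The inner loops of the algorithm -/

section InnerLoops

variable {N : ℕ} (I : Input N)

@[simp] theorem wp_readL (i : Fin N) (m : Mem N) (t p : ℕ) (Q : ℝ≥0∞ → Config N → Prop) :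
    wp (readL i) ⟨m, t, p⟩ Q ↔ Q (m.l i) ⟨m, t + 1, p⟩ := wp_load ..

@[simp] theorem wp_readTrunc (m : Mem N) (t p : ℕ) (Q : ℝ≥0∞ → Config N → Prop) :
    wp readTrunc ⟨m, t, p⟩ Q ↔ Q m.trunc ⟨m, t + 1, p⟩ := wp_load ..

@[simp] theorem wp_readRank (i : Fin N) (m : Mem N) (t p : ℕ) (Q : Option ℕ → Config N → Prop) :
    wp (readRank i) ⟨m, t, p⟩ Q ↔ Q (m.rank i) ⟨m, t + 1, p⟩ := wp_load ..

/-- The index `j` may serve as the parent whose children are scanned. -/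
def Mem.IsCandidate (m : Mem N) (i : Fin N) (li : ℝ≥0∞) (j : Fin N) : Prop :=
  I.dist i j + I.rho * li ≤ I.rho * min m.trunc (m.l j)

/-- The clause on `best` carries minimality through the recursion: the result is never farther away
than the best index found so far. -/
theorem selectParent_spec (i : Fin N) (li : ℝ≥0∞) (best : Option (Fin N × ℝ≥0∞))
    (js : List (Fin N)) (m : Mem N) (t p : ℕ) :
    wp (selectParent I i li best js) ⟨m, t, p⟩ (fun r s' => s'.mem = m ∧ s'.peak = p ∧
      s'.time ≤ t + js.length * (I.oracleCost + 9) ∧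
      (∀ j ∈ js, m.IsCandidate I i li j → ∃ kd, r = some kd ∧ kd.2 ≤ I.dist i j) ∧
      (∀ kb, best = some kb → ∃ kd, r = some kd ∧ kd.2 ≤ kb.2) ∧
      ∀ kd, r = some kd →
        best = some kd ∨ (kd.1 ∈ js ∧ m.IsCandidate I i li kd.1 ∧ kd.2 = I.dist i kd.1)) := by
  induction js generalizing best t with
  | nil =>
    rw [selectParent, wp_pure]
    exact ⟨rfl, rfl, by simp, by simp, fun kb h => ⟨kb, h, le_rfl⟩, fun kd h => Or.inl h⟩
  | cons j js ih =>
    simp only [selectParent, wp_bind, wp_queryDist, wp_readL, wp_readTrunc, wp_op,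
      decide_eq_true_eq]
    split_ifs with h1
    · have hj : m.IsCandidate I i li j := h1
      cases best with
      | none =>
        refine (ih _ _).mono ?_
        rintro r s' ⟨hm, hp, ht, hc, hb, hr⟩
        refine ⟨hm, hp, ?_, ?_, by simp, fun kd hkd => ?_⟩
        · simp only [List.length_cons, Nat.add_mul]; omega
        · intro v hv hcv
          rcases List.mem_cons.1 hv with rfl | hv
          · exact hb _ rfl
          · exact hc v hv hcv
        · rcases hr kd hkd with h | ⟨h2, h3⟩
          · obtain rfl := Option.some.inj h
            exact Or.inr ⟨by simp, hj, rfl⟩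
          · exact Or.inr ⟨List.mem_cons_of_mem _ h2, h3⟩
      | some kb =>
        simp only [wp_bind, wp_op, decide_eq_true_eq]
        split_ifs with h2
        · refine (ih _ _).mono ?_
          rintro r s' ⟨hm, hp, ht, hc, hb, hr⟩
          obtain ⟨kd', hkd', hle⟩ := hb _ rfl
          refine ⟨hm, hp, ?_, ?_, ?_, fun kd hkd => ?_⟩
          · simp only [List.length_cons, Nat.add_mul]; omega
          · intro v hv hcv
            rcases List.mem_cons.1 hv with rfl | hv
            · exact ⟨kd', hkd', hle⟩
            · exact hc v hv hcv
          · rintro _ ⟨rfl⟩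
            exact ⟨kd', hkd', hle.trans h2.le⟩
          · rcases hr kd hkd with h | ⟨h2, h3⟩
            · obtain rfl := Option.some.inj h
              exact Or.inr ⟨by simp, hj, rfl⟩
            · exact Or.inr ⟨List.mem_cons_of_mem _ h2, h3⟩
        · refine (ih _ _).mono ?_
          rintro r s' ⟨hm, hp, ht, hc, hb, hr⟩
          obtain ⟨kd', hkd', hle⟩ := hb _ rfl
          refine ⟨hm, hp, ?_, ?_, hb, fun kd hkd => ?_⟩
          · simp only [List.length_cons, Nat.add_mul]; omega
          · intro v hv hcv
            rcases List.mem_cons.1 hv with rfl | hv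
            · exact ⟨kd', hkd', hle.trans (not_lt.1 h2)⟩
            · exact hc v hv hcv
          · rcases hr kd hkd with h | ⟨h2, h3⟩
            · exact Or.inl h
            · exact Or.inr ⟨List.mem_cons_of_mem _ h2, h3⟩
    · have hj : ¬ m.IsCandidate I i li j := h1
      refine (ih _ _).mono ?_
      rintro r s' ⟨hm, hp, ht, hc, hb, hr⟩
      refine ⟨hm, hp, ?_, ?_, hb, fun kd hkd => ?_⟩
      · simp only [List.length_cons, Nat.add_mul]; omega
      · intro v hv hcv
        rcases List.mem_cons.1 hv with rfl | hv
        · exact absurd hcv hj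
        · exact hc v hv hcv
      · rcases hr kd hkd with h | ⟨h2, h3⟩
        · exact Or.inl h
        · exact Or.inr ⟨List.mem_cons_of_mem _ h2, h3⟩

open Classical in
/-- The memory after `a` has become the main heap and the members of `G` children of `i`. -/
noncomputable def Mem.link (m : Mem N) (i : Fin N) (G : List (Fin N)) (a : Heap N) : Mem N :=
  { m with
    children := Function.update m.children i (G.reverse ++ m.children i)
    parents := fun j => if j ∈ G then i :: m.parents j else m.parents j
    main := a }

theorem Mem.link_nil (m : Mem N) (i : Fin N) (a : Heap N) :
    m.link i [] a = m.setHeap .main a := by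
  simp [Mem.link, Mem.setHeap]

/-- One pass of the scan that records `j`, followed by the passes that record `G`. Children are
prepended, which is why `link` stores `G` reversed. -/
theorem Mem.link_cons (m : Mem N) (i j : Fin N) (G : List (Fin N)) (hj : j ∉ G) (a b : Heap N) :
    (((m.setHeap .main b).setList .children i (j :: (m.setHeap .main b).list .children i)).setList
      .parents j (i :: ((m.setHeap .main b).setList .children i
        (j :: (m.setHeap .main b).list .children i)).list .parents j)).link i G a
      = m.link i (j :: G) a := by
  simp only [Mem.link, Mem.setHeap, Mem.setList, Mem.list, Mem.mk.injEq, true_and, and_true,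
    Function.update_self, List.reverse_cons, List.append_assoc, List.singleton_append,
    Function.update_idem]
  funext v
  by_cases h : v = j
  · subst h; simp [hj]
  · simp [h]

theorem Mem.setHeap_link (m : Mem N) (i : Fin N) (G : List (Fin N)) (a b : Heap N) :
    (m.setHeap .main b).link i G a = m.link i G a := rfl

/-- The cost of scanning one child. -/
def scanCost : ℕ := 2 * I.oracleCost + siftCost N + 15

-- Since the list is sorted by distance to `k`, stopping at the first child beyond `bound` treats
-- exactly the filtered list. The time is therefore charged to the filtered list and not to all of
-- `js`.
open Classical in
theorem scanChildren_spec (i : Fin N) (li : ℝ≥0∞) (k : Fin N) (bound : ℝ≥0∞)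
    (js : List (Fin N)) (hnd : js.Nodup)
    (hs : js.Pairwise fun v w => I.dist v k ≤ I.dist w k) {m : Mem N} {t p M : ℕ}
    (hval : m.main.IsValid) (hord : OrderedFrom 0 m.main.keyPos)
    (hM : m.space + 4 * js.length ≤ M) (hp : p ≤ M) :
    wp (scanChildren I i li k bound js) ⟨m, t, p⟩ (fun _ s' => ∃ a,
      s'.mem = m.link i ((js.filter fun j => I.dist j k ≤ bound).filter
        fun j => I.dist i j ≤ I.rho * li) a ∧ a.IsValid ∧ OrderedFrom 0 a.keyPos ∧
      a.arr.size = m.main.arr.size ∧ (∀ w, w ∈ a.arr ↔ w ∈ m.main.arr) ∧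
      (∀ w ∈ a.arr, a.key w = if w ∈ js ∧ I.dist w k ≤ bound
        then min (m.main.key w) (I.dist i w) else m.main.key w) ∧
      s'.time ≤ t + ((js.filter fun j => I.dist j k ≤ bound).length + 1) * scanCost I ∧
      s'.peak ≤ M) := by
  induction js generalizing m t p with
  | nil =>
    simp only [scanChildren, wp_pure]
    exact ⟨m.main, (m.link_nil i m.main).symm, hval, hord, rfl, fun _ => Iff.rfl, by simp, by simp, hp⟩
  | cons j js ih =>
    obtain ⟨hjs, hnd⟩ := List.nodup_cons.1 hnd
    obtain ⟨hj, hs⟩ := List.pairwise_cons.1 hs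
    simp only [scanChildren, wp_bind, wp_queryDist, wp_op, decide_eq_true_eq]
    split_ifs with h1
    · simp only [wp_bind, wp_queryDist]
      simp only [List.length_cons] at hM
      refine (heapDecrease_spec (h := .main) (M := M) hval hord (by omega) hp).mono ?_
      rintro _ ⟨m₁, t₁, p₁⟩ ⟨b, hm₁, hb, hbO, hbs, hbm, hbk, ht₁, hp₁⟩
      simp only at hm₁ ht₁ hp₁
      subst hm₁
      have hsp := m.space_setHeap .main b
      simp only [List.filter_cons, h1, decide_true, if_true, wp_op, decide_eq_true_eq]
      have hkey : ∀ a : Heap N, (∀ w, w ∈ a.arr ↔ w ∈ b.arr) →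
          (∀ w ∈ a.arr, a.key w = if w ∈ js ∧ I.dist w k ≤ bound
            then min (b.key w) (I.dist i w) else b.key w) →
          ∀ w ∈ a.arr, a.key w = if w ∈ j :: js ∧ I.dist w k ≤ bound
            then min (m.main.key w) (I.dist i w) else m.main.key w := by
        intro a ham hak w hw
        rw [hak w hw, hbk w ((ham w).1 hw)]
        have hbe : ∀ w, (m.heap .main).key w = m.main.key w := fun _ => rfl
        by_cases hwj : w = j
        · subst hwj; simp [hjs, h1, hbe]
        · simp [hwj, hbe]
      split_ifs with h2
      · simp only [wp_bind, wp_pushList]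
        set m₂ := (m.setHeap .main b).setList .children i
          (j :: (m.setHeap .main b).list .children i) with hm₂
        set m₃ := m₂.setList .parents j (i :: m₂.list .parents j) with hm₃
        have hsp₂ := (m.setHeap .main b).space_setList .children i
          (j :: (m.setHeap .main b).list .children i)
        have hsp₃ := m₂.space_setList .parents j (i :: m₂.list .parents j)
        rw [← hm₂, List.length_cons] at hsp₂
        rw [← hm₃, List.length_cons] at hsp₃
        refine (ih hnd hs (m := m₃) hb hbO (by omega) (by omega)).mono ?_
        rintro _ ⟨m₄, t₄, p₄⟩ ⟨a, hm₄, ha, haO, has, ham, hak, ht₄, hp₄⟩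
        simp only at hm₄ ht₄ hp₄
        refine ⟨a, ?_, ha, haO, has.trans hbs, fun w => (ham w).trans (hbm w), hkey a ham hak, ?_,
          hp₄⟩
        · simp only [hm₄, hm₃, hm₂]
          exact m.link_cons i j _ (fun h => hjs (List.mem_of_mem_filter (List.mem_of_mem_filter h))) a b
        · simp only [List.length_cons]
          rw [Nat.add_mul (_ + 1) 1, Nat.one_mul]
          have : scanCost I = 2 * I.oracleCost + siftCost N + 15 := rfl
          omega
      · refine (ih hnd hs (m := m.setHeap .main b) hb hbO (by omega) (by omega)).mono ?_
        rintro _ ⟨m₄, t₄, p₄⟩ ⟨a, hm₄, ha, haO, has, ham, hak, ht₄, hp₄⟩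
        simp only at hm₄ ht₄ hp₄
        refine ⟨a, ?_, ha, haO, has.trans hbs, fun w => (ham w).trans (hbm w), hkey a ham hak, ?_,
          hp₄⟩
        · simp only [hm₄, Mem.setHeap_link]
        · simp only [List.length_cons]
          rw [Nat.add_mul (_ + 1) 1, Nat.one_mul]
          have : scanCost I = 2 * I.oracleCost + siftCost N + 15 := rfl
          omega
    · rw [wp_pure]
      have hF : (j :: js).filter (fun j => I.dist j k ≤ bound) = [] := by
        rw [List.filter_eq_nil_iff]
        intro v hv
        rcases List.mem_cons.1 hv with rfl | hv
        · simpa using h1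
        · simpa using lt_of_lt_of_le (not_le.1 h1) (hj v hv)
      refine ⟨m.main, ?_, hval, hord, rfl, fun _ => Iff.rfl, fun w _ => ?_, ?_, hp⟩
      · rw [hF, List.filter_nil, Mem.link_nil]; rfl
      · rw [if_neg]
        rintro ⟨h2, h3⟩
        have := List.filter_eq_nil_iff.1 hF w h2
        exact this (by simpa using h3)
      · have : scanCost I = 2 * I.oracleCost + siftCost N + 15 := rfl
        simp only [hF, List.length_nil]
        omega

open Classical in
/-- The memory after the truncation of the lists. -/
noncomputable def Mem.truncate (m : Mem N) : Mem N :=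
  { m with
    children := fun v => if (m.rank v).isSome
      then (m.children v).filter fun j =>
        (m.rank j).isSome || decide (I.dist v j ≤ I.rho * m.trunc)
      else m.children v
    parents := fun v => if (m.rank v).isSome then m.parents v
      else (m.parents v).filter fun i => I.dist i v ≤ I.rho * m.trunc }

/-- The cost of the truncation of the lists. -/
def truncateCost (m : Mem N) : ℕ :=
  1 + ∑ v, (9 + ((m.children v).length + (m.parents v).length) * (I.oracleCost + 13))

theorem truncateLists_spec {m : Mem N} {t p M : ℕ} (hbuf : m.buffer = [])
    (hc : ∀ v, (m.children v).Nodup) (hpn : ∀ v, (m.parents v).Nodup)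
    (hM : m.space + 2 * N ≤ M) (hp : p ≤ M) :
    wp (truncateLists I) ⟨m, t, p⟩ (fun _ s' => s'.mem = m.truncate I ∧
      s'.time ≤ t + truncateCost I m ∧ s'.peak ≤ M) := by
  classical
  set cost : Fin N → ℕ := fun v =>
    9 + ((m.children v).length + (m.parents v).length) * (I.oracleCost + 13) with hcost
  -- In `mid as` the lists of the indices in `as` are the ones still to be truncated. The passes do
  -- not interfere, because the test reads only ranks, distances and the truncation length.
  set mid : List (Fin N) → Mem N := fun as => { m with
    children := fun v => if v ∈ as then m.children v else (m.truncate I).children v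
    parents := fun v => if v ∈ as then m.parents v else (m.truncate I).parents v } with hmid
  have hTc : ∀ v, ((m.truncate I).children v).length ≤ (m.children v).length := by
    intro v
    simp only [Mem.truncate]
    split_ifs
    exacts [List.length_filter_le _ _, le_rfl]
  have hTp : ∀ v, ((m.truncate I).parents v).length ≤ (m.parents v).length := by
    intro v
    simp only [Mem.truncate]
    split_ifs
    exacts [le_rfl, List.length_filter_le _ _]
  have hmsp : ∀ as, (mid as).space ≤ m.space := by
    intro as
    simp only [Mem.space, hmid]
    refine Nat.add_le_add_left (Finset.sum_le_sum fun v _ => ?_) _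
    have h1 := hTc v
    have h2 := hTp v
    split_ifs <;> omega
  have hpass : ∀ (v j : Fin N) (m' : Mem N) (t p : ℕ) (Q : Bool → Config N → Prop),
      wp (isWithinTrunc I v j) ⟨m', t, p⟩ Q ↔
        Q (decide (I.dist v j ≤ I.rho * m'.trunc)) ⟨m', t + (I.oracleCost + 1) + 1 + 1 + 1, p⟩ := by
    intro v j m' t p Q
    simp only [isWithinTrunc, wp_bind, wp_queryDist, wp_readTrunc, wp_op]
  refine wp_forEach _ (fun as s => as.Nodup ∧ s.mem = mid as ∧
    s.time + (as.map cost).sum + 1 ≤ t + truncateCost I m ∧ s.peak ≤ M) ?_ ?_ ?_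
  · rintro v as m₁ t₁ p₁ ⟨hnd, hm, ht, hp₁⟩
    simp only at hm ht hp₁
    subst hm
    obtain ⟨hv, hnd⟩ := List.nodup_cons.1 hnd
    have hsp := hmsp (v :: as)
    simp only [List.map_cons, List.sum_cons] at ht
    have hcv : cost v = 9 + ((m.children v).length * (I.oracleCost + 13)
      + (m.parents v).length * (I.oracleCost + 13)) := by simp only [hcost, Nat.add_mul]
    simp only [wp_bind, wp_readRank]
    have hrank : (mid (v :: as)).rank = m.rank := rfl
    have htr : (mid (v :: as)).trunc = m.trunc := rfl
    rw [hrank]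
    cases hr : m.rank v with
    | some q =>
      have hl : (mid (v :: as)).list .children v = m.children v := by simp [Mem.list, hmid]
      dsimp only
      refine (filterList_spec (m := mid (v :: as)) (f := fun j =>
        (m.rank j).isSome || decide (I.dist v j ≤ I.rho * m.trunc)) (M := M)
        (k := I.oracleCost + 5) hbuf ?_ ?_ hp₁).mono ?_
      · intro j _ B t p hp
        simp only [wp_bind, wp_readRank, hrank]
        cases hj : m.rank j with
        | some _ =>
          rw [wp_pure]
          exact ⟨by simp, rfl, by dsimp only; omega, hp⟩
        | none =>
          simp only [hpass]
          exact ⟨by simp [htr], trivial, by omega, hp⟩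
      · have := length_le_of_nodup (hc v)
        rw [hl]; omega
      · rintro _ ⟨m₂, t₂, p₂⟩ ⟨hm₂, ht₂, hp₂⟩
        simp only at hm₂ ht₂ hp₂
        rw [hl] at hm₂ ht₂
        rw [Nat.add_assoc I.oracleCost] at ht₂
        norm_num only at ht₂
        refine ⟨hnd, ?_, ?_, hp₂⟩
        · simp only [hm₂, hmid, Mem.setList, Mem.mk.injEq, true_and, and_true]
          constructor
          · funext w
            by_cases hw : w = v
            · subst hw; simp [hv, Mem.truncate, hr]
            · simp [hw]
          · funext w
            by_cases hw : w = v
            · subst hw; simp [hv, Mem.truncate, hr]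
            · simp [hw]
        · dsimp only
          omega
    | none =>
      have hl : (mid (v :: as)).list .parents v = m.parents v := by simp [Mem.list, hmid]
      dsimp only
      refine (filterList_spec (m := mid (v :: as)) (f := fun i => decide (I.dist i v ≤ I.rho * m.trunc)) (M := M)
        (k := I.oracleCost + 5) hbuf ?_ ?_ hp₁).mono ?_
      · intro j _ B t p hp
        simp only [hpass]
        exact ⟨by simp [htr], trivial, by omega, hp⟩
      · have := length_le_of_nodup (hpn v)
        rw [hl]; omega
      · rintro _ ⟨m₂, t₂, p₂⟩ ⟨hm₂, ht₂, hp₂⟩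
        simp only at hm₂ ht₂ hp₂
        rw [hl] at hm₂ ht₂
        rw [Nat.add_assoc I.oracleCost] at ht₂
        norm_num only at ht₂
        refine ⟨hnd, ?_, ?_, hp₂⟩
        · simp only [hm₂, hmid, Mem.setList, Mem.mk.injEq, true_and, and_true]
          constructor
          · funext w
            by_cases hw : w = v
            · subst hw; simp [hv, Mem.truncate, hr]
            · simp [hw]
          · funext w
            by_cases hw : w = v
            · subst hw; simp [hv, Mem.truncate, hr]
            · simp [hw]
        · dsimp only
          omega
  · refine ⟨List.nodup_finRange N, ?_, ?_, hp⟩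
    · simp [hmid]
    · simp only [truncateCost, Fin.sum_univ_def, hcost]
      omega
  · rintro m₁ t₁ p₁ ⟨_, hm, ht, hp₁⟩
    simp only [List.map_nil, List.sum_nil] at ht
    refine ⟨?_, by dsimp only; omega, hp₁⟩
    simp only at hm
    rw [hm]
    simp [hmid, Mem.truncate]

end InnerLoops

/-! ## Maximin lists and packing -/

section Maximin

variable {N : ℕ} {I : Input N}

/-- The oracles describe at least two points without boundary, of pairwise distances between `δ`
and `Δ < 2 ^ lv * δ`, such that `K` is a packing number at the ratio `6 ρ`. -/
structure IsGood (I : Input N) (δ Δ : ℝ≥0∞) (K lv : ℕ) : Prop where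
  symm : ∀ i j, I.dist i j = I.dist j i
  self : ∀ i, I.dist i i = 0
  triangle : ∀ i j k, I.dist i k ≤ I.dist i j + I.dist j k
  dist_le : ∀ i j, I.dist i j ≤ Δ
  le_dist : ∀ i j, i ≠ j → δ ≤ I.dist i j
  pos : δ ≠ 0
  lt_top : Δ ≠ ⊤
  lt_pow : Δ < δ * 2 ^ lv
  two_le : 2 ≤ I.rho
  boundary : ∀ i, I.distBoundary i = ⊤
  two_le_card : 2 ≤ N
  packing : ∀ r : ℝ≥0∞, r ≠ 0 → r ≠ ⊤ → ∀ (y : Fin N) (A : Finset (Fin N)),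
    (∀ i ∈ A, I.dist i y ≤ 6 * I.rho * r) → (∀ i ∈ A, ∀ j ∈ A, i ≠ j → r ≤ I.dist i j) →
    A.card ≤ K

theorem IsGood.one_le {δ Δ : ℝ≥0∞} {K lv : ℕ} (h : IsGood I δ Δ K lv) : 1 ≤ K := by
  have := h.two_le_card
  have := h.packing 1 one_ne_zero ENNReal.one_ne_top ⟨0, by omega⟩ {⟨0, by omega⟩}
    (by simp [h.self]) (by simp)
  simpa using this

theorem IsGood.dist_ne_top {δ Δ : ℝ≥0∞} {K lv : ℕ} (h : IsGood I δ Δ K lv) (i j : Fin N) :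
    I.dist i j ≠ ⊤ := ((h.dist_le i j).trans_lt (lt_top_iff_ne_top.2 h.lt_top)).ne

theorem IsGood.ne_top {δ Δ : ℝ≥0∞} {K lv : ℕ} (h : IsGood I δ Δ K lv) : δ ≠ ⊤ := by
  intro hδ
  have h2 := h.two_le_card
  have h01 : (⟨0, by omega⟩ : Fin N) ≠ ⟨1, by omega⟩ := by simp
  exact h.dist_ne_top _ _ (top_le_iff.1 (hδ.symm.le.trans (h.le_dist _ _ h01)))

/-- The radius `⊤` is admitted because the first index has scale `⊤`. Distances are finite, so a
`⊤`-separated set has at most one member, and `1 ≤ K`. -/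
theorem IsGood.packing' {δ Δ : ℝ≥0∞} {K lv : ℕ} (h : IsGood I δ Δ K lv) {r : ℝ≥0∞} (hr : r ≠ 0)
    (y : Fin N) (A : Finset (Fin N)) (hA : ∀ i ∈ A, I.dist i y ≤ 6 * I.rho * r)
    (hsep : ∀ i ∈ A, ∀ j ∈ A, i ≠ j → r ≤ I.dist i j) : A.card ≤ K := by
  by_cases htop : r = ⊤
  · refine le_trans (Finset.card_le_one.2 fun i hi j hj => ?_) h.one_le
    by_contra hij
    have := hsep i hi j hj hij
    rw [htop, top_le_iff] at this
    exact h.dist_ne_top i j this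
  · exact h.packing r hr htop y A hA hsep

/-- The distance of the index `v` to the members of a list. -/
noncomputable def distTo (I : Input N) (L : List (Fin N)) (v : Fin N) : ℝ≥0∞ :=
  ⨅ i ∈ L, I.dist i v

theorem distTo_le {L : List (Fin N)} {i : Fin N} (hi : i ∈ L) (v : Fin N) :
    distTo I L v ≤ I.dist i v := iInf₂_le i hi

@[simp] theorem distTo_nil (v : Fin N) : distTo I [] v = ⊤ := by simp [distTo]

theorem distTo_append (L M : List (Fin N)) (v : Fin N) :
    distTo I (L ++ M) v = min (distTo I L v) (distTo I M v) := by
  simp only [distTo, List.mem_append, iInf_or, iInf_inf_eq]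

@[simp] theorem distTo_singleton (a v : Fin N) : distTo I [a] v = I.dist a v := by
  simp [distTo]

theorem distTo_append_le (L M : List (Fin N)) (v : Fin N) :
    distTo I (L ++ M) v ≤ distTo I L v := by
  rw [distTo_append]; exact min_le_left _ _

theorem le_distTo {L : List (Fin N)} {v : Fin N} {c : ℝ≥0∞} (h : ∀ i ∈ L, c ≤ I.dist i v) :
    c ≤ distTo I L v := le_iInf₂ h

/-- The list `L` begins anywhere, each further member is one that is farthest from those before
it, and `l` records these distances. -/
structure IsMaximin (I : Input N) (l : Fin N → ℝ≥0∞) (L : List (Fin N)) : Prop where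
  nodup : L.Nodup
  isMax : ∀ L₁ a L₂, L = L₁ ++ a :: L₂ → ∀ v ∉ L₁, distTo I L₁ v ≤ distTo I L₁ a
  scale : ∀ L₁ a L₂, L = L₁ ++ a :: L₂ → l a = distTo I L₁ a

theorem append_singleton_eq_append_cons {L : List (Fin N)} {i : Fin N} (L₁ : List (Fin N))
    (a : Fin N) (L₂ : List (Fin N)) (hL : L ++ [i] = L₁ ++ a :: L₂) :
    (L₁ = L ∧ a = i) ∨ ∃ L₃, L = L₁ ++ a :: L₃ := by
  rcases List.eq_nil_or_concat L₂ with rfl | ⟨L₃, b, rfl⟩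
  · obtain ⟨h1, h2⟩ := List.append_inj' hL (by simp)
    exact Or.inl ⟨h1.symm, (List.cons.inj h2).1.symm⟩
  · right
    refine ⟨L₃, ?_⟩
    have : L ++ [i] = (L₁ ++ a :: L₃) ++ [b] := by rw [hL]; simp
    exact (List.append_inj' this (by simp)).1

/-! ### Separation of maximin lists and the counting arguments -/

namespace IsMaximin

variable {l : Fin N → ℝ≥0∞} {L M : List (Fin N)}

theorem of_append (h : IsMaximin I l (L ++ M)) : IsMaximin I l L where
  nodup := (List.nodup_append.1 h.nodup).1
  isMax L₁ a L₂ hL := h.isMax L₁ a (L₂ ++ M) (by rw [hL]; simp)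
  scale L₁ a L₂ hL := h.scale L₁ a (L₂ ++ M) (by rw [hL]; simp)

theorem append (h : IsMaximin I l L) {i : Fin N} (hi : i ∉ L)
    (hmax : ∀ v ∉ L, distTo I L v ≤ distTo I L i) {l' : Fin N → ℝ≥0∞}
    (hl : ∀ v ∈ L, l' v = l v) (hli : l' i = distTo I L i) : IsMaximin I l' (L ++ [i]) := by
  have key := @append_singleton_eq_append_cons N L i
  refine ⟨?_, fun L₁ a L₂ hL => ?_, fun L₁ a L₂ hL => ?_⟩
  · rw [List.nodup_append]
    exact ⟨h.nodup, by simp, by rintro a ha b hb rfl; simp at hb; exact hi (hb ▸ ha)⟩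
  · rcases key _ _ _ hL with ⟨rfl, rfl⟩ | ⟨L₃, hL₃⟩
    · exact hmax
    · exact h.isMax _ _ _ hL₃
  · rcases key _ _ _ hL with ⟨rfl, rfl⟩ | ⟨L₃, hL₃⟩
    · exact hli
    · rw [hl a (by rw [hL₃]; simp)]; exact h.scale _ _ _ hL₃

/-- The scale of the later of the two is its distance to a set that contains the earlier one. -/
theorem separated (h : IsMaximin I l L) (hsymm : ∀ i j, I.dist i j = I.dist j i) {a b : Fin N}
    (ha : a ∈ L) (hb : b ∈ L) (hab : a ≠ b) : min (l a) (l b) ≤ I.dist a b := by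
  obtain ⟨L₁, L₂, rfl⟩ := List.append_of_mem ha
  rcases List.mem_append.1 hb with hb | hb
  · refine (min_le_left _ _).trans ?_
    rw [h.scale L₁ a L₂ rfl, hsymm a b]
    exact distTo_le hb a
  · have hb : b ∈ L₂ := (List.mem_cons.1 hb).resolve_left (Ne.symm hab)
    obtain ⟨X, Y, rfl⟩ := List.append_of_mem hb
    refine (min_le_right _ _).trans ?_
    rw [h.scale (L₁ ++ a :: X) b Y (by simp)]
    exact distTo_le (by simp) b

/-- `v` was available when `a` was chosen as farthest, and its distance to the selected set has only
decreased since. -/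
theorem distTo_le_scale (h : IsMaximin I l L) {v a : Fin N} (hv : v ∉ L) (ha : a ∈ L) :
    distTo I L v ≤ l a := by
  obtain ⟨L₁, L₂, rfl⟩ := List.append_of_mem ha
  rw [h.scale L₁ a L₂ rfl]
  exact (distTo_append_le _ _ _).trans (h.isMax L₁ a L₂ rfl v (fun h => hv (by simp [h])))

/-- Take for `k` the member whose selection first brings `v` within distance `c`. Just before that,
`v` was farther than `c`, and `k` was at least as far as `v`. Finiteness of `c` excludes the empty
list. -/
theorem exists_coarse (h : IsMaximin I l L) {v : Fin N} (hv : v ∉ L) {c : ℝ≥0∞} (hc : c ≠ ⊤)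
    (hle : distTo I L v ≤ c) : ∃ k ∈ L, c ≤ l k ∧ I.dist k v ≤ c := by
  induction L using List.reverseRecOn with
  | nil => simp only [distTo_nil, top_le_iff] at hle; exact absurd hle hc
  | append_singleton L a ih =>
    simp only [List.mem_append, List.mem_singleton, not_or] at hv
    by_cases h1 : distTo I L v ≤ c
    · obtain ⟨k, hk, h2⟩ := ih h.of_append hv.1 h1
      exact ⟨k, by simp [hk], h2⟩
    · refine ⟨a, by simp, ?_, ?_⟩
      · rw [h.scale L a [] rfl]
        exact (not_le.1 h1).le.trans (h.isMax L a [] rfl v hv.1)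
      · rw [distTo_append, distTo_singleton, min_le_iff] at hle
        exact hle.resolve_left h1

variable {δ Δ : ℝ≥0∞} {K lv : ℕ}

theorem le_scale (h : IsMaximin I l L) (hI : IsGood I δ Δ K lv) {a : Fin N} (ha : a ∈ L) :
    δ ≤ l a := by
  obtain ⟨L₁, L₂, rfl⟩ := List.append_of_mem ha
  rw [h.scale L₁ a L₂ rfl]
  refine le_distTo fun i hi => hI.le_dist i a ?_
  exact (List.nodup_append.1 h.nodup).2.2 i hi a (by simp)

theorem scale_le (h : IsMaximin I l L) (hI : IsGood I δ Δ K lv) {a : Fin N} (ha : a ∈ L)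
    (hne : l a ≠ ⊤) : l a ≤ Δ := by
  obtain ⟨L₁, L₂, rfl⟩ := List.append_of_mem ha
  rw [h.scale L₁ a L₂ rfl] at hne ⊢
  cases L₁ with
  | nil => simp at hne
  | cons b L₁ => exact (distTo_le (by simp) a).trans (hI.dist_le b a)

-- Members of scale at least `l v` are `l v`-separated, so this is packing at `r = l v`.
open Classical in
theorem card_near_le (h : IsMaximin I l L) (hI : IsGood I δ Δ K lv) {v : Fin N} (hv : v ∈ L) :
    (Finset.univ.filter fun u => u ∈ L ∧ l v ≤ l u ∧ I.dist u v ≤ 4 * (I.rho * l v)).card ≤ K := by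
  refine hI.packing' (r := l v) ?_ v _ ?_ ?_
  · exact fun h0 => hI.pos (le_zero_iff.1 (h0 ▸ h.le_scale hI hv))
  · intro i hi
    simp only [Finset.mem_filter, Finset.mem_univ, true_and] at hi
    refine hi.2.2.trans ?_
    rw [mul_assoc]
    gcongr
    norm_num
  · intro i hi j hj hij
    simp only [Finset.mem_filter, Finset.mem_univ, true_and] at hi hj
    exact (le_min hi.2.1 hj.2.1).trans (h.separated hI.symm hi.1 hj.1 hij)

-- All scales are at least `T / 4`, hence the members are `T / 4`-separated, and the radius `ρ T` is
-- `4 ρ` times this separation.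
open Classical in
theorem card_within_le (h : IsMaximin I l L) (hI : IsGood I δ Δ K lv) {T : ℝ≥0∞} (hT0 : T ≠ 0)
    (hT : ∀ i ∈ L, T ≤ 4 * l i) (v : Fin N) :
    (Finset.univ.filter fun u => u ∈ L ∧ I.dist u v ≤ I.rho * T).card ≤ K := by
  have h4 : (4 : ℝ≥0∞) * (T / 4) = T := ENNReal.mul_div_cancel (by norm_num) (by norm_num)
  refine hI.packing' (r := T / 4) ?_ v _ ?_ ?_
  · intro h0
    rw [h0, mul_zero] at h4
    exact hT0 h4.symm
  · intro i hi
    simp only [Finset.mem_filter, Finset.mem_univ, true_and] at hi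
    refine hi.2.trans ?_
    calc I.rho * T = 4 * I.rho * (T / 4) := by rw [mul_comm 4, mul_assoc, h4]
      _ ≤ 6 * I.rho * (T / 4) := by gcongr; norm_num
  · intro i hi j hj hij
    simp only [Finset.mem_filter, Finset.mem_univ, true_and] at hi hj
    have hle : ∀ i ∈ L, T / 4 ≤ l i := fun i hi => by
      rw [ENNReal.div_le_iff_le_mul (by norm_num) (by norm_num), mul_comm]
      exact hT i hi
    exact (le_min (hle i hi.1) (hle j hj.1)).trans (h.separated hI.symm hi.1 hj.1 hij)

/-- A double count of the pairs `(i, j)` with `j ∈ c i`. A pair with `j` not selected is charged to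
`j`, a pair of selected indices to the one of smaller scale. Each index is charged at most `K` times
as a child and at most `K` times as a parent. -/
theorem sum_length_le (h : IsMaximin I l L) (hI : IsGood I δ Δ K lv) {T : ℝ≥0∞} (hT0 : T ≠ 0)
    (hT : ∀ i ∈ L, T ≤ 4 * l i) (c : Fin N → List (Fin N)) (hnd : ∀ i, (c i).Nodup)
    (hc : ∀ i, ∀ j ∈ c i, i ∈ L ∧ I.dist i j ≤ I.rho * l i ∧ (j ∉ L → I.dist i j ≤ I.rho * T) ∧
      (j ∈ L → I.dist i j ≤ 4 * (I.rho * l j))) :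
    ∑ i, (c i).length ≤ 2 * K * N := by
  classical
  set near : Fin N → Finset (Fin N) := fun v =>
    Finset.univ.filter fun u => u ∈ L ∧ l v ≤ l u ∧ I.dist u v ≤ 4 * (I.rho * l v) with hnear
  set within : Fin N → Finset (Fin N) := fun v =>
    Finset.univ.filter fun u => u ∈ L ∧ I.dist u v ≤ I.rho * T with hwithin
  have h1 : ∀ i, (c i).length = (Finset.univ.filter fun j => j ∈ c i).card := fun i => by
    rw [← List.toFinset_card_of_nodup (hnd i)]
    congr 1
    ext j; simp
  have h2 : ∀ i, (Finset.univ.filter fun j => j ∈ c i) ⊆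
      (Finset.univ.filter fun j => (j ∈ L ∧ i ∈ near j) ∨ (j ∉ L ∧ i ∈ within j)) ∪
        (Finset.univ.filter fun j => i ∈ L ∧ j ∈ near i) := by
    intro i j hj
    simp only [Finset.mem_filter, Finset.mem_univ, true_and, Finset.mem_union, hnear,
      hwithin] at hj ⊢
    obtain ⟨hi, hr, hT, h4⟩ := hc i j hj
    by_cases hjL : j ∈ L
    · rcases le_total (l j) (l i) with h5 | h5
      · exact Or.inl (Or.inl ⟨hjL, hi, h5, h4 hjL⟩)
      · refine Or.inr ⟨hi, hjL, h5, ?_⟩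
        rw [hI.symm]
        refine hr.trans ?_
        calc I.rho * l i = 1 * (I.rho * l i) := (one_mul _).symm
          _ ≤ 4 * (I.rho * l i) := by gcongr; norm_num
    · exact Or.inl (Or.inr ⟨hjL, hi, hT hjL⟩)
  calc ∑ i, (c i).length
      ≤ ∑ i, ((Finset.univ.filter fun j => (j ∈ L ∧ i ∈ near j) ∨ (j ∉ L ∧ i ∈ within j)).card
        + (Finset.univ.filter fun j => i ∈ L ∧ j ∈ near i).card) := by
        refine Finset.sum_le_sum fun i _ => ?_
        rw [h1 i]
        exact (Finset.card_le_card (h2 i)).trans (Finset.card_union_le _ _)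
    _ = ∑ j, (Finset.univ.filter fun i =>
          (j ∈ L ∧ i ∈ near j) ∨ (j ∉ L ∧ i ∈ within j)).card
        + ∑ i, (Finset.univ.filter fun j => i ∈ L ∧ j ∈ near i).card := by
        rw [Finset.sum_add_distrib]
        congr 1
        simp only [Finset.card_filter]
        exact Finset.sum_comm
    _ ≤ ∑ _j : Fin N, K + ∑ _i : Fin N, K := by
        refine Nat.add_le_add (Finset.sum_le_sum fun j _ => ?_) (Finset.sum_le_sum fun i _ => ?_)
        · by_cases hj : j ∈ L
          · refine (Finset.card_le_card fun i hi => ?_).trans (h.card_near_le hI hj)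
            simpa [hj, hnear] using hi
          · refine (Finset.card_le_card fun i hi => ?_).trans (h.card_within_le hI hT0 hT j)
            simpa [hj, hwithin] using hi
        · by_cases hi : i ∈ L
          · refine (Finset.card_le_card fun j hj => ?_).trans (h.card_near_le hI hi)
            simpa [hi, hnear] using hj
          · simp [hi]
    _ = 2 * K * N := by simp; ring

open Classical in
/-- The number of indices whose distance to `i` is at most `3 ρ r`. -/
noncomputable def _root_.SparseOrdering.ballCard (I : Input N) (i : Fin N) (r : ℝ≥0∞) : ℕ :=
  (Finset.univ.filter fun j => I.dist i j ≤ 3 * (I.rho * r)).card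

theorem _root_.SparseOrdering.exists_dyadic {δ a : ℝ≥0∞} {n : ℕ} (h1 : δ ≤ a) (h2 : a < δ * 2 ^ n) :
    ∃ k < n, δ * 2 ^ k ≤ a ∧ a < δ * 2 ^ (k + 1) := by
  induction n with
  | zero => simp only [pow_zero, mul_one] at h2; exact absurd h1 (not_le.2 h2)
  | succ n ih =>
    by_cases h : a < δ * 2 ^ n
    · obtain ⟨k, hk, h3⟩ := ih h
      exact ⟨k, by omega, h3⟩
    · exact ⟨n, by omega, not_lt.1 h, h2⟩

-- The pairs `(i, j)` with `j` in the ball of `i` are counted for fixed `j`, the indices `i` being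
-- sorted by the dyadic range of their scale. The first index is left out, as its scale is `⊤`; all
-- its pairs are paid for separately.
open Classical in
theorem sum_ballCard_le (h : IsMaximin I l L) (hI : IsGood I δ Δ K lv) :
    (L.map fun i => if l i = ⊤ then 0 else ballCard I i (l i)).sum ≤ N * (lv * K) := by
  rw [← List.sum_toFinset _ h.nodup]
  set F := L.toFinset.filter fun i => l i ≠ ⊤ with hF
  have h1 : ∑ i ∈ L.toFinset, (if l i = ⊤ then 0 else ballCard I i (l i))
      = ∑ j, (F.filter fun i => I.dist i j ≤ 3 * (I.rho * l i)).card := by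
    calc ∑ i ∈ L.toFinset, (if l i = ⊤ then 0 else ballCard I i (l i))
        = ∑ i ∈ F, ballCard I i (l i) := by
          rw [hF, Finset.sum_filter]
          exact Finset.sum_congr rfl fun i _ => by by_cases h : l i = ⊤ <;> simp [h]
      _ = _ := by
          simp only [ballCard, Finset.card_filter]
          exact Finset.sum_comm
  rw [h1]
  have hδ := hI.ne_top
  calc ∑ j, (F.filter fun i => I.dist i j ≤ 3 * (I.rho * l i)).card
      ≤ ∑ _j : Fin N, lv * K := Finset.sum_le_sum fun j _ => ?_
    _ = N * (lv * K) := by simp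
  -- Members of `A k` are `δ 2 ^ k`-separated and within `3 ρ l i ≤ 6 ρ (δ 2 ^ k)` of `j`. This is
  -- where the packing ratio `6 ρ` comes from.
  set A : ℕ → Finset (Fin N) := fun k => F.filter fun i => I.dist i j ≤ 3 * (I.rho * l i) ∧
    δ * 2 ^ k ≤ l i ∧ l i < δ * 2 ^ (k + 1) with hA
  have hsub : (F.filter fun i => I.dist i j ≤ 3 * (I.rho * l i)) ⊆ (Finset.range lv).biUnion A := by
    intro i hi
    simp only [Finset.mem_filter, hF, List.mem_toFinset] at hi
    obtain ⟨k, hk, h2, h3⟩ := exists_dyadic (h.le_scale hI hi.1.1)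
      ((h.scale_le hI hi.1.1 hi.1.2).trans_lt hI.lt_pow)
    simp only [Finset.mem_biUnion, Finset.mem_range, hA, hF, Finset.mem_filter, List.mem_toFinset]
    exact ⟨k, hk, hi.1, hi.2, h2, h3⟩
  refine (Finset.card_le_card hsub).trans (Finset.card_biUnion_le.trans ?_)
  refine (Finset.sum_le_card_nsmul _ _ K fun k _ => ?_).trans (by simp)
  refine hI.packing (δ * 2 ^ k) (mul_ne_zero hI.pos (by simp))
    (ENNReal.mul_ne_top hδ (by simp)) j _ ?_ ?_
  · intro i hi
    simp only [hA, Finset.mem_filter] at hi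
    refine hi.2.1.trans ?_
    calc 3 * (I.rho * l i) ≤ 3 * (I.rho * (δ * 2 ^ (k + 1))) := by gcongr; exact hi.2.2.2.le
      _ = 6 * I.rho * (δ * 2 ^ k) := by rw [pow_succ]; ring
  · intro i hi i' hi' hne
    simp only [hA, hF, Finset.mem_filter, List.mem_toFinset] at hi hi'
    exact (le_min hi.2.2.1 hi'.2.2.1).trans (h.separated hI.symm hi.1.1 hi'.1.1 hne)

end IsMaximin

theorem sum_length_comm {c p : Fin N → List (Fin N)} (hc : ∀ i, (c i).Nodup)
    (hp : ∀ i, (p i).Nodup) (h : ∀ i j, i ∈ p j ↔ j ∈ c i) :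
    ∑ j, (p j).length = ∑ i, (c i).length := by
  classical
  have h1 : ∀ (c : Fin N → List (Fin N)), (∀ i, (c i).Nodup) → ∀ i,
      (c i).length = ∑ j, if j ∈ c i then 1 else 0 := fun c hc i => by
    rw [← List.toFinset_card_of_nodup (hc i), ← Finset.card_filter]
    congr 1
    ext j; simp
  simp only [h1 c hc, h1 p hp, h]
  exact Finset.sum_comm

end Maximin

/-! ## The invariant -/

section Invariant

variable {N : ℕ} {I : Input N}

/-- The selected indices, in the order of their selection. -/
abbrev Mem.sel (m : Mem N) : List (Fin N) := m.order.toList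

/-- The properties that hold whenever an index has been processed; `δ` is a lower bound of the
distances. -/
structure Inv (I : Input N) (δ : ℝ≥0∞) (m : Mem N) : Prop where
  maximin : IsMaximin I m.l m.sel
  rank : ∀ v q, m.rank v = some q ↔ m.order[q]? = some v
  main_valid : m.main.IsValid
  main_ordered : OrderedFrom 0 m.main.keyPos
  mem_main : ∀ v, v ∈ m.main.arr ↔ v ∉ m.sel
  main_key : ∀ v, v ∉ m.sel → m.main.key v = distTo I m.sel v
  aux_valid : m.aux.IsValid
  aux_empty : m.aux.arr = #[]
  buffer : m.buffer = []
  pairs : m.S = #[]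
  trunc_ne_top : m.trunc ≠ ⊤
  le_trunc : 2 * δ ≤ m.trunc
  -- This separation of the selected indices at the truncation length makes packing applicable to
  -- the lists.
  trunc_le : ∀ i ∈ m.sel, m.trunc ≤ 4 * m.l i
  -- This lets the parent supplied by `exists_coarse` pass the test with `l_Trunc`.
  dist_le_trunc : ∀ v, v ∉ m.sel → 2 * distTo I m.sel v ≤ m.trunc
  dual : ∀ i j, i ∈ m.parents j ↔ j ∈ m.children i
  nodup_children : ∀ i, (m.children i).Nodup
  nodup_parents : ∀ i, (m.parents i).Nodup
  -- Soundness of the lists, used for counting. The factor `4` arises when `j` is selected: up to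
  -- then only `ρ l_Trunc` bounds the distance, and `l_Trunc ≤ 4 l[j]`.
  child : ∀ i, ∀ j ∈ m.children i, i ∈ m.sel ∧ I.dist i j ≤ I.rho * m.l i ∧
    (j ∉ m.sel → I.dist i j ≤ I.rho * m.trunc) ∧
    (j ∈ m.sel → I.dist i j ≤ 4 * (I.rho * m.l j))
  -- Completeness among unselected indices: it justifies scanning one list instead of all points.
  mem_of_not_mem : ∀ i ∈ m.sel, ∀ j, j ∉ m.sel → I.dist i j ≤ I.rho * m.trunc →
    I.dist i j ≤ I.rho * m.l i → j ∈ m.children i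
  -- Completeness for the final sparsity pattern; truncation spares selected children.
  mem_of_mem : ∀ L₁ j L₂, m.sel = L₁ ++ j :: L₂ → ∀ i, i ∈ L₁ ∨ i = j →
    I.dist i j ≤ I.rho * m.l j → j ∈ m.children i
  sorted : ∀ i, (m.children i).Pairwise fun v w => I.dist v i ≤ I.dist w i

/-- The truncation length is not too large for the indices that are left. -/
def Tight (I : Input N) (m : Mem N) : Prop :=
  ∀ v, v ∉ m.sel → ∃ w, w ∉ m.sel ∧ m.trunc ≤ 4 * distTo I m.sel w

variable {δ Δ : ℝ≥0∞} {K lv : ℕ} {m : Mem N}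

theorem rank_isSome_iff (h : ∀ v q, m.rank v = some q ↔ m.order[q]? = some v) (v : Fin N) :
    (m.rank v).isSome ↔ v ∈ m.sel := by
  rw [Option.isSome_iff_exists]
  simp only [h, Mem.sel, Array.mem_toList_iff, Array.mem_iff_getElem?]

namespace Inv

theorem trunc_ne_zero (h : Inv I δ m) (hI : IsGood I δ Δ K lv) : m.trunc ≠ 0 := by
  intro h0
  have := h.le_trunc
  rw [h0, le_zero_iff, mul_eq_zero] at this
  exact this.elim (by norm_num) hI.pos

theorem sum_children_le (h : Inv I δ m) (hI : IsGood I δ Δ K lv) :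
    ∑ i, (m.children i).length ≤ 2 * K * N :=
  h.maximin.sum_length_le hI (h.trunc_ne_zero hI) h.trunc_le m.children h.nodup_children h.child

theorem sum_parents_le (h : Inv I δ m) (hI : IsGood I δ Δ K lv) :
    ∑ i, (m.parents i).length ≤ 2 * K * N := by
  rw [sum_length_comm h.nodup_children h.nodup_parents h.dual]
  exact h.sum_children_le hI

theorem space_le (h : Inv I δ m) (hI : IsGood I δ Δ K lv) :
    m.space ≤ 16 + 10 * N + 8 * K * N := by
  have h1 := h.sum_children_le hI
  have h2 := h.sum_parents_le hI
  have h3 : m.order.size ≤ N := by simpa using length_le_of_nodup h.maximin.nodup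
  have h4 := h.main_valid.size_le
  rw [Mem.space_eq]
  simp only [h.aux_empty, h.buffer, h.pairs, List.length_nil, List.size_toArray]
  have : 8 * K * N = 4 * (2 * K * N) := by ring
  omega

theorem length_parents_le (h : Inv I δ m) (hI : IsGood I δ Δ K lv) {i : Fin N} (hi : i ∉ m.sel) :
    (m.parents i).length ≤ K := by
  classical
  refine le_trans ?_ (h.maximin.card_within_le hI (h.trunc_ne_zero hI) h.trunc_le i)
  rw [← List.toFinset_card_of_nodup (h.nodup_parents i)]
  refine Finset.card_le_card fun u hu => ?_
  rw [List.mem_toFinset, h.dual] at hu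
  have := h.child u i hu
  simp only [Finset.mem_filter, Finset.mem_univ, true_and]
  exact ⟨this.1, this.2.2.1 hi⟩

/-- Only pairs whose child is unselected and farther than `ρ T` disappear. The completeness clauses
concern selected children and unselected ones within `ρ T`, so they survive. -/
theorem truncate (h : Inv I δ m) {T : ℝ≥0∞} (hT : T ≤ m.trunc) (h1 : 2 * δ ≤ T)
    (h2 : ∀ v, v ∉ m.sel → 2 * distTo I m.sel v ≤ T) :
    Inv I δ (({ m with trunc := T } : Mem N).truncate I) := by
  have hr := rank_isSome_iff h.rank
  have hc : ∀ i j, j ∈ (({ m with trunc := T } : Mem N).truncate I).children i ↔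
      j ∈ m.children i ∧ (j ∈ m.sel ∨ I.dist i j ≤ I.rho * T) := by
    intro i j
    simp only [Mem.truncate]
    split_ifs with hi
    · simp only [List.mem_filter, Bool.or_eq_true, decide_eq_true_eq, hr]
    · rw [iff_self_and]
      intro hj
      exact absurd ((hr i).2 (h.child i j hj).1) hi
  refine { h with
    trunc_ne_top := ?_
    le_trunc := h1
    trunc_le := ?_
    dist_le_trunc := h2
    dual := ?_
    nodup_children := ?_
    nodup_parents := ?_
    child := ?_
    mem_of_not_mem := ?_
    mem_of_mem := ?_
    sorted := ?_ }
  · exact (hT.trans_lt (lt_top_iff_ne_top.2 h.trunc_ne_top)).ne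
  · exact fun i hi => hT.trans (h.trunc_le i hi)
  · intro i j
    rw [hc]
    simp only [Mem.truncate]
    split_ifs with hj
    · rw [h.dual, iff_self_and]
      exact fun _ => Or.inl ((hr j).1 hj)
    · simp only [List.mem_filter, decide_eq_true_eq, h.dual]
      have : j ∉ m.sel := mt (hr j).2 hj
      simp [this]
  · intro i
    simp only [Mem.truncate]
    split_ifs
    exacts [(h.nodup_children i).filter _, h.nodup_children i]
  · intro i
    simp only [Mem.truncate]
    split_ifs
    exacts [h.nodup_parents i, (h.nodup_parents i).filter _]
  · intro i j hj
    rw [hc] at hj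
    have h3 := h.child i j hj.1
    exact ⟨h3.1, h3.2.1, fun h4 => hj.2.resolve_left h4, h3.2.2.2⟩
  · intro i hi j hj h3 h4
    rw [hc]
    exact ⟨h.mem_of_not_mem i hi j hj (h3.trans (by dsimp only [Mem.truncate]; gcongr)) h4, Or.inr h3⟩
  · intro L₁ j L₂ hL i hi h3
    rw [hc]
    refine ⟨h.mem_of_mem L₁ j L₂ hL i hi h3, Or.inl ?_⟩
    have hL' : m.sel = L₁ ++ j :: L₂ := hL
    rw [hL']; simp
  · intro i
    simp only [Mem.truncate]
    split_ifs
    exacts [(h.sorted i).filter _, h.sorted i]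

end Inv

@[simp] theorem wp_writeTrunc (a : ℝ≥0∞) (m : Mem N) (t p : ℕ) (Q : Unit → Config N → Prop) :
    wp (writeTrunc a) ⟨m, t, p⟩ Q ↔
      Q () ⟨{ m with trunc := a }, t + 1, max p ({ m with trunc := a } : Mem N).space⟩ :=
  wp_store ..

/-- The cost of a pass of the truncation loop. -/
def passCost (I : Input N) (K : ℕ) : ℕ := 10 + 9 * N + 4 * K * N * (I.oracleCost + 13)

theorem exists_root {a : Heap N} (ho : OrderedFrom 0 a.keyPos)
    (hne : a.arr.size ≠ 0) :
    ∃ v ∈ a.arr, a.keyPos 0 = a.key v ∧ ∀ w ∈ a.arr, a.key w ≤ a.key v := by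
  have h0 : 0 < a.arr.size := by omega
  have hg := Array.getElem?_eq_getElem h0
  refine ⟨a.arr[0], Array.getElem_mem h0, Heap.keyPos_of_getElem? hg, fun w hw => ?_⟩
  obtain ⟨q, hq⟩ := Array.mem_iff_getElem?.1 hw
  rw [← Heap.keyPos_of_getElem? hq, ← Heap.keyPos_of_getElem? hg]
  exact ho.le_root q

/-- The exponent `n` is a potential handed from call to call: each halving lowers it by one and is
paid for by this decrease. Thus the total number of halvings is bounded by the initial exponent. -/
theorem truncationLoop_spec (hI : IsGood I δ Δ K lv) (hinv : Inv I δ m) {t p M n : ℕ}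
    (hn : m.trunc < 2 * δ * 2 ^ n) (hM : 16 + 12 * N + 8 * K * N ≤ M) (hp : p ≤ M) :
    wp (truncationLoop I) ⟨m, t, p⟩ (fun _ s' => ∃ n', Inv I δ s'.mem ∧ Tight I s'.mem ∧
      s'.mem.order = m.order ∧ s'.mem.l = m.l ∧ s'.mem.main = m.main ∧
      s'.mem.trunc < 2 * δ * 2 ^ n' ∧
      s'.time + n' * passCost I K ≤ t + 6 + n * passCost I K ∧ s'.peak ≤ M) := by
  refine wp_loop _ (fun n₁ _ s => Inv I δ s.mem ∧
      s.mem.order = m.order ∧ s.mem.l = m.l ∧ s.mem.main = m.main ∧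
      s.mem.trunc < 2 * δ * 2 ^ n₁ ∧
      s.time + n₁ * passCost I K ≤ t + n * passCost I K ∧ s.peak ≤ M) (n := n) ?_
    ⟨hinv, rfl, rfl, rfl, hn, le_rfl, hp⟩
  rintro n₁ _ m₁ t₁ p₁ ⟨h, ho, hl, hmain, hn₁, ht, hp₁⟩
  simp only at h ho hl hmain hn₁ ht hp₁
  simp only [wp_bind, wp_heapSize]
  have hheap : m₁.heap .main = m₁.main := rfl
  split_ifs with h0
  · have hlt : 0 < (m₁.heap .main).arr.size := Nat.pos_of_ne_zero h0
    obtain ⟨v, hv, hroot, hmax⟩ := exists_root h.main_ordered h0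
    have hvs := (h.mem_main v).1 hv
    rw [h.main_key v hvs] at hroot hmax
    have hmax' : ∀ w, w ∉ m₁.sel → distTo I m₁.sel w ≤ distTo I m₁.sel v := fun w hw => by
      rw [← h.main_key w hw]; exact hmax w ((h.mem_main w).2 hw)
    simp only [wp_bind, wp_keyAt hlt, wp_readTrunc, wp_op, decide_eq_true_eq, hheap, hroot]
    split_ifs with h1
    · simp only [wp_bind, wp_op, wp_writeTrunc]
      have h4 : m₁.trunc / 4 = m₁.trunc / 2 / 2 := by
        rw [div_eq_mul_inv, div_eq_mul_inv, div_eq_mul_inv, mul_assoc,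
          ← ENNReal.mul_inv (by norm_num) (by norm_num)]
        norm_num
      -- The root key is below `l_Trunc / 4`, which is the clause `dist_le_trunc` for the halved
      -- length.
      have hdist : ∀ w, w ∉ m₁.sel → 2 * distTo I m₁.sel w ≤ m₁.trunc / 2 := fun w hw => by
        rw [mul_comm, ← ENNReal.le_div_iff_mul_le (by norm_num) (by norm_num), ← h4]
        exact (hmax' w hw).trans h1.le
      have hδv : δ ≤ distTo I m₁.sel v :=
        le_distTo fun i hi => hI.le_dist i v (by rintro rfl; exact hvs hi)
      have hδ : 2 * δ ≤ m₁.trunc / 2 := le_trans (by gcongr) (hdist v hvs)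
      have hsp := h.space_le hI
      have hsp' : ({ m₁ with trunc := m₁.trunc / 2 } : Mem N).space = m₁.space := rfl
      refine (truncateLists_spec I (m := { m₁ with trunc := m₁.trunc / 2 }) (M := M)
        h.buffer h.nodup_children h.nodup_parents (by omega) (by omega)).mono ?_
      rintro _ ⟨m₂, t₂, p₂⟩ ⟨hm₂, ht₂, hp₂⟩
      simp only at hm₂ ht₂ hp₂
      subst hm₂
      rw [wp_pure]
      cases n₁ with
      -- With exponent `0` the truncation length would be below `2 δ`.
      | zero =>
        rw [pow_zero, mul_one] at hn₁
        exact absurd h.le_trunc (not_le.2 hn₁)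
      | succ n₁ =>
        refine ⟨n₁, Nat.lt_succ_self _, h.truncate ENNReal.half_le_self hδ hdist, ho, hl, hmain,
          ?_, ?_, hp₂⟩
        · have : m₁.trunc / 2 < 2 * δ * 2 ^ n₁ := by
            rw [ENNReal.div_lt_iff (Or.inl (by norm_num)) (Or.inl (by norm_num)), mul_assoc,
              ← pow_succ]
            exact hn₁
          exact this
        · have hc := h.sum_children_le hI
          have hpa := h.sum_parents_le hI
          have hcost : truncateCost I ({ m₁ with trunc := m₁.trunc / 2 } : Mem N) + 9
              ≤ passCost I K := by
            simp only [truncateCost, Finset.sum_add_distrib, ← Finset.sum_mul, passCost,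
              Finset.sum_const, Finset.card_univ, Fintype.card_fin, smul_eq_mul]
            have h6 : (∑ i, (m₁.children i).length + ∑ i, (m₁.parents i).length)
                * (I.oracleCost + 13) ≤ 4 * K * N * (I.oracleCost + 13) :=
              Nat.mul_le_mul_right _ (by nlinarith)
            omega
          rw [Nat.add_mul] at ht
          dsimp only
          omega
    · rw [wp_pure]
      refine ⟨n₁, h, fun w _ => ⟨v, hvs, ?_⟩, ho, hl, hmain, hn₁, by dsimp only; omega, hp₁⟩
      have := not_lt.1 h1
      rwa [ENNReal.div_le_iff_le_mul (by norm_num) (by norm_num), mul_comm] at this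
  · rw [wp_pure]
    refine ⟨n₁, h, fun w hw => ?_, ho, hl, hmain, hn₁, by dsimp only; omega, hp₁⟩
    have := (h.mem_main w).2 hw
    rw [hheap, not_not, Array.size_eq_zero_iff] at h0
    rw [h0] at this
    simp at this

end Invariant

/-! ## Processing one index -/

section ProcessNext

variable {N : ℕ} {I : Input N} {δ Δ : ℝ≥0∞} {K lv : ℕ} {m : Mem N}

@[simp] theorem wp_writeL (i : Fin N) (a : ℝ≥0∞) (m : Mem N) (t p : ℕ)
    (Q : Unit → Config N → Prop) :
    wp (writeL i a) ⟨m, t, p⟩ Q ↔ Q () ⟨{ m with l := Function.update m.l i a }, t + 1,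
      max p ({ m with l := Function.update m.l i a } : Mem N).space⟩ := wp_store ..

@[simp] theorem wp_pushOrder (i : Fin N) (m : Mem N) (t p : ℕ) (Q : Unit → Config N → Prop) :
    wp (pushOrder i) ⟨m, t, p⟩ Q ↔ Q () ⟨{ m with
      order := m.order.push i, rank := Function.update m.rank i (some m.order.size) }, t + 2,
      max p ({ m with
        order := m.order.push i
        rank := Function.update m.rank i (some m.order.size) } : Mem N).space⟩ := wp_store ..

theorem rank_push {m : Mem N} (h : ∀ v q, m.rank v = some q ↔ m.order[q]? = some v) {i : Fin N}
    (hi : i ∉ m.sel) (v : Fin N) (q : ℕ) :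
    Function.update m.rank i (some m.order.size) v = some q ↔ (m.order.push i)[q]? = some v := by
  have h1 : ∀ q, m.order[q]? ≠ some i := fun q hq =>
    hi (by rw [Mem.sel, Array.mem_toList_iff]; exact Array.mem_iff_getElem?.2 ⟨q, hq⟩)
  have h2 := h v q
  have h3 := h1 q
  have h4 : m.order.size ≤ q → m.order[q]? = none := fun h => Array.getElem?_eq_none h
  simp only [Function.update_apply, Array.getElem?_push]
  grind

/-- What is known of the index `i` to be processed and of the parent `k` of it that has been
chosen. -/
structure IsNext (I : Input N) (m : Mem N) (i k : Fin N) : Prop where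
  not_mem : i ∉ m.sel
  isMax : ∀ v, v ∉ m.sel → distTo I m.sel v ≤ distTo I m.sel i
  mem_sel : k ∈ m.sel
  candidate : I.dist i k + I.rho * distTo I m.sel i ≤ I.rho * min m.trunc (m.l k)
  dist_le : I.dist i k ≤ 2 * distTo I m.sel i

namespace IsNext

variable {i k : Fin N}

theorem distTo_ne_top (h : IsNext I m i k) (hinv : Inv I δ m) : distTo I m.sel i ≠ ⊤ := by
  intro h0
  have := hinv.dist_le_trunc i h.not_mem
  rw [h0, ENNReal.mul_top (by norm_num), top_le_iff] at this
  exact hinv.trunc_ne_top this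

theorem dist_le_bound (hI : IsGood I δ Δ K lv) {j : Fin N}
    (hj : I.dist i j ≤ I.rho * distTo I m.sel i) :
    I.dist j k ≤ I.dist i k + I.rho * distTo I m.sel i := by
  refine (hI.triangle j i k).trans ?_
  rw [hI.symm j i, add_comm]
  gcongr

/-- By `candidate`, the bound of the scan is at most `ρ min(l_Trunc, l[k])`, the range in which
`c[k]` is complete. -/
theorem mem_children (h : IsNext I m i k) (hI : IsGood I δ Δ K lv) (hinv : Inv I δ m) {j : Fin N}
    (hj : j ∉ m.sel) (hij : I.dist i j ≤ I.rho * distTo I m.sel i) : j ∈ m.children k := by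
  have h1 : I.dist k j ≤ I.rho * min m.trunc (m.l k) := by
    rw [hI.symm]; exact (dist_le_bound hI hij).trans h.candidate
  exact hinv.mem_of_not_mem k h.mem_sel j hj
    (h1.trans (by gcongr; exact min_le_left _ _)) (h1.trans (by gcongr; exact min_le_right _ _))

theorem le_rho_mul (hI : IsGood I δ Δ K lv) (r : ℝ≥0∞) : r ≤ I.rho * r := by
  calc r = 1 * r := (one_mul r).symm
    _ ≤ I.rho * r := by gcongr; exact le_trans (by norm_num) hI.two_le

/-- The way from `i` to `j` through `k` has length at most `2 r + 2 r + ρ r`, and each summand is at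
most `ρ r`. This makes the cost of the scan a ball count. -/
theorem dist_le_three (h : IsNext I m i k) (hI : IsGood I δ Δ K lv) {j : Fin N}
    (hj : I.dist j k ≤ I.dist i k + I.rho * distTo I m.sel i) :
    I.dist i j ≤ 3 * (I.rho * distTo I m.sel i) := by
  have h1 := hI.triangle i k j
  rw [hI.symm k j] at h1
  calc I.dist i j ≤ I.dist i k + I.dist j k := h1
    _ ≤ 2 * distTo I m.sel i + (2 * distTo I m.sel i + I.rho * distTo I m.sel i) := by
        gcongr
        · exact h.dist_le
        · exact hj.trans (by gcongr; exact h.dist_le)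
    _ ≤ I.rho * distTo I m.sel i + (I.rho * distTo I m.sel i + I.rho * distTo I m.sel i) := by
        gcongr <;> exact hI.two_le
    _ = 3 * (I.rho * distTo I m.sel i) := by ring

/-- `exists_coarse` at `c = 2 r` gives `k` within `2 r` of `i` and of scale at least `2 r`. The test
holds because `2 r + ρ r ≤ ρ (2 r)` for `ρ ≥ 2` and `2 r ≤ l_Trunc`. The closest candidate inherits
the bound `2 r`, on which the time bound rests. -/
theorem exists_candidate (hI : IsGood I δ Δ K lv) (hinv : Inv I δ m) (hi : i ∉ m.sel) :
    ∃ k ∈ m.parents i, m.IsCandidate I i (distTo I m.sel i) k ∧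
      I.dist i k ≤ 2 * distTo I m.sel i := by
  set r := distTo I m.sel i with hr
  have hT := hinv.dist_le_trunc i hi
  have hr2 : 2 * r ≠ ⊤ := (hT.trans_lt (lt_top_iff_ne_top.2 hinv.trunc_ne_top)).ne
  have hle : r ≤ 2 * r := by
    calc r = 1 * r := (one_mul r).symm
      _ ≤ 2 * r := by gcongr; norm_num
  obtain ⟨k, hk, hlk, hdk⟩ := hinv.maximin.exists_coarse hi hr2 hle
  refine ⟨k, ?_, ?_, by rwa [hI.symm]⟩
  · rw [hinv.dual]
    exact hinv.mem_of_not_mem k hk i hi (hdk.trans (hT.trans (le_rho_mul hI _)))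
      (hdk.trans (hlk.trans (le_rho_mul hI _)))
  · simp only [Mem.IsCandidate]
    calc I.dist i k + I.rho * r ≤ 2 * r + I.rho * r := by gcongr; rwa [hI.symm]
      _ ≤ I.rho * r + I.rho * r := by gcongr; exact hI.two_le
      _ = I.rho * (2 * r) := by ring
      _ ≤ I.rho * min m.trunc (m.l k) := by gcongr; exact le_min hT hlk

end IsNext

/-- The memory after the index `i` has been processed, where `a` and `b` are the heaps, `G` are the
new children in the order in which they were found, and `cs` is the sorted list of them. -/
noncomputable def Mem.select (m : Mem N) (i : Fin N) (li : ℝ≥0∞) (G cs : List (Fin N))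
    (a b : Heap N) : Mem N :=
  { m.link i G a with
    l := Function.update m.l i li
    order := m.order.push i
    rank := Function.update m.rank i (some m.order.size)
    children := Function.update m.children i cs
    aux := b }

/-- Two points need an argument: indices that were not scanned already have correct keys, and the
lists of the older indices remain sound and complete although `i` changes from unselected to
selected. -/
theorem Inv.select {i k : Fin N} (h : IsNext I m i k) (hI : IsGood I δ Δ K lv) (hinv : Inv I δ m)
    (htight : Tight I m) {G cs : List (Fin N)} {a b : Heap N}
    (hG : ∀ j, j ∈ G ↔ j ∈ m.children k ∧ I.dist i j ≤ I.rho * distTo I m.sel i)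
    (hcs : ∀ j, j ∈ cs ↔ j ∈ G) (hcsnd : cs.Nodup)
    (hsort : cs.Pairwise fun v w => I.dist v i ≤ I.dist w i)
    (ha : a.IsValid) (hao : OrderedFrom 0 a.keyPos) (ham : ∀ v, v ∈ a.arr ↔ v ∉ m.sel ∧ v ≠ i)
    (hak : ∀ v ∈ a.arr, a.key v = if v ∈ m.children k ∧
      I.dist v k ≤ I.dist i k + I.rho * distTo I m.sel i
      then min (distTo I m.sel v) (I.dist i v) else distTo I m.sel v)
    (hb : b.IsValid) (hbe : b.arr = #[]) :
    Inv I δ (m.select i (distTo I m.sel i) G cs a b) := by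
  classical
  set r := distTo I m.sel i with hr
  have hi := h.not_mem
  have hsel : (m.select i r G cs a b).sel = m.sel ++ [i] := by
    simp [Mem.select, Mem.sel]
  have hli : (m.select i r G cs a b).l i = r := by simp [Mem.select]
  have hlv : ∀ v ∈ m.sel, (m.select i r G cs a b).l v = m.l v := fun v hv => by
    have : v ≠ i := by rintro rfl; exact hi hv
    simp [Mem.select, this]
  have hci : (m.select i r G cs a b).children i = cs := by simp [Mem.select]
  have hcv : ∀ v, v ≠ i → (m.select i r G cs a b).children v = m.children v := fun v hv => by
    simp [Mem.select, hv]
  have hpar : ∀ j, (m.select i r G cs a b).parents j =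
      if j ∈ G then i :: m.parents j else m.parents j := fun j => by
    simp [Mem.select, Mem.link]
  have htr : (m.select i r G cs a b).trunc = m.trunc := rfl
  have hc0 : ∀ j, j ∉ m.children i := fun j hj => hi (hinv.child i j hj).1
  have hp0 : ∀ j, i ∉ m.parents j := fun j hj => hc0 j ((hinv.dual i j).1 hj)
  have hmemG : ∀ j, j ∉ m.sel → I.dist i j ≤ I.rho * r → j ∈ G := fun j hj hij =>
    (hG j).2 ⟨h.mem_children hI hinv hj hij, hij⟩
  have hT2 := hinv.dist_le_trunc i hi
  have hrT : r ≤ m.trunc := le_trans (by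
    calc r = 1 * r := (one_mul r).symm
      _ ≤ 2 * r := by gcongr; norm_num) hT2
  -- `i` is farthest, so `Tight` bounds `l_Trunc` by four times its scale.
  have hTr : m.trunc ≤ 4 * r := by
    obtain ⟨w, hw, hw'⟩ := htight i hi
    exact hw'.trans (by gcongr; exact h.isMax w hw)
  have hmem : ∀ j, j ∈ (m.select i r G cs a b).sel ↔ j ∈ m.sel ∨ j = i := fun j => by
    rw [hsel]; simp
  have h14 : ∀ c : ℝ≥0∞, c ≤ 4 * c := fun c => by
    calc c = 1 * c := (one_mul c).symm
      _ ≤ 4 * c := by gcongr; norm_num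
  refine
    { maximin := ?_
      rank := rank_push hinv.rank hi
      main_valid := ha
      main_ordered := hao
      mem_main := ?_
      main_key := ?_
      aux_valid := hb
      aux_empty := hbe
      buffer := hinv.buffer
      pairs := hinv.pairs
      trunc_ne_top := hinv.trunc_ne_top
      le_trunc := hinv.le_trunc
      trunc_le := ?_
      dist_le_trunc := ?_
      dual := ?_
      nodup_children := ?_
      nodup_parents := ?_
      child := ?_
      mem_of_not_mem := ?_
      mem_of_mem := ?_
      sorted := ?_ }
  · rw [hsel]
    exact hinv.maximin.append hi h.isMax hlv hli
  · intro v
    rw [hmem, not_or]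
    exact ham v
  · intro v hv
    rw [hmem, not_or] at hv
    have hk := hak v ((ham v).2 hv)
    rw [hsel, distTo_append, distTo_singleton]
    refine hk.trans ?_
    split_ifs with h1
    · rfl
    · rw [eq_comm, min_eq_left_iff]
      -- A key that had to drop would put `v` within `r ≤ ρ r` of `i`, hence into `c[k]` and within
      -- the bound of the scan.
      by_contra h2
      have h3 : I.dist i v ≤ I.rho * r :=
        (not_le.1 h2).le.trans ((h.isMax v hv.1).trans (IsNext.le_rho_mul hI _))
      exact h1 ⟨h.mem_children hI hinv hv.1 h3, IsNext.dist_le_bound hI h3⟩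
  · intro v hv
    rw [htr]
    rcases (hmem v).1 hv with hv | rfl
    · rw [hlv v hv]; exact hinv.trunc_le v hv
    · rw [hli]; exact hTr
  · intro v hv
    rw [hmem, not_or] at hv
    rw [htr, hsel]
    refine le_trans ?_ (hinv.dist_le_trunc v hv.1)
    gcongr
    exact distTo_append_le _ _ _
  · intro v j
    rw [hpar]
    by_cases hv : v = i
    · subst hv
      rw [hci, hcs]
      split_ifs with h1
      · simp [h1]
      · simp [h1, hp0]
    · rw [hcv v hv]
      split_ifs with h1
      · simp [hv, hinv.dual]
      · exact hinv.dual v j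
  · intro v
    by_cases hv : v = i
    · subst hv; rwa [hci]
    · rw [hcv v hv]; exact hinv.nodup_children v
  · intro v
    rw [hpar]
    split_ifs
    · exact List.nodup_cons.2 ⟨hp0 v, hinv.nodup_parents v⟩
    · exact hinv.nodup_parents v
  · intro v j hj
    rw [htr]
    simp only [hmem]
    by_cases hv : v = i
    · subst hv
      rw [hci, hcs, hG] at hj
      rw [hli]
      refine ⟨Or.inr rfl, hj.2, fun _ => hj.2.trans (by gcongr), ?_⟩
      rintro (hjs | rfl)
      · rw [hlv j hjs]
        refine hj.2.trans (le_trans ?_ (h14 _))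
        gcongr
        exact hinv.maximin.distTo_le_scale hi hjs
      · rw [hI.self]; exact zero_le
    · rw [hcv v hv] at hj
      have h1 := hinv.child v j hj
      rw [hlv v h1.1]
      refine ⟨Or.inl h1.1, h1.2.1, fun h2 => h1.2.2.1 fun h3 => h2 (Or.inl h3), ?_⟩
      rintro (hjs | rfl)
      · rw [hlv j hjs]; exact h1.2.2.2 hjs
      -- Here `i` itself is the child: its distance was bounded by `ρ l_Trunc`, and `l_Trunc ≤ 4 r`.
      · rw [hli]
        refine (h1.2.2.1 hi).trans ?_
        calc I.rho * m.trunc ≤ I.rho * (4 * r) := by gcongr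
          _ = 4 * (I.rho * r) := by ring
  · intro v hv j hj
    rw [htr]
    rw [hmem, not_or] at hj
    by_cases hvi : v = i
    · subst hvi
      rw [hli, hci, hcs]
      exact fun _ h1 => hmemG j hj.1 h1
    · have hv := ((hmem v).1 hv).resolve_right hvi
      rw [hlv v hv, hcv v hvi]
      exact hinv.mem_of_not_mem v hv j hj.1
  · intro L₁ j L₂ hL v hv hd
    rw [hsel] at hL
    rcases append_singleton_eq_append_cons _ _ _ hL with ⟨rfl, rfl⟩ | ⟨L₃, hL₃⟩
    · rw [hli] at hd
      rcases hv with hv | rfl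
      · rw [hcv v (by rintro rfl; exact hi hv)]
        -- Until now `j` was unselected, and `r` is at most both `l_Trunc` and `l[v]`, so
        -- completeness for unselected children applies.
        refine hinv.mem_of_not_mem v hv j hi (hd.trans (by gcongr)) (hd.trans ?_)
        gcongr
        exact hinv.maximin.distTo_le_scale hi hv
      · rw [hci, hcs]
        exact hmemG v hi hd
    · have hj : j ∈ m.sel := by rw [hL₃]; simp
      have hvs : v ∈ m.sel := by
        rw [hL₃]
        rcases hv with hv | rfl
        · simp [hv]
        · simp
      rw [hlv j hj] at hd
      rw [hcv v (by rintro rfl; exact hi hvs)]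
      exact hinv.mem_of_mem L₁ j L₃ hL₃ v hv hd
  · intro v
    by_cases hv : v = i
    · subst hv; rwa [hci]
    · rw [hcv v hv]; exact hinv.sorted v

/-- The unit of the time bounds. -/
def unitCost (I : Input N) : ℕ := 2 * I.oracleCost + 2 * siftCost N + 40

/-- The factor `K + 2 * ballCard + 4` accounts for the test of at most `K` parents, for scanning and
for sorting at most `ballCard` children, and for fixed costs. Truncations are paid for by `n - n'`
units of potential. -/
theorem processNext_spec (hI : IsGood I δ Δ K lv) (hinv : Inv I δ m) (htight : Tight I m)
    (hne : m.main.arr.size ≠ 0) {t p M n : ℕ} (hn : m.trunc < 2 * δ * 2 ^ n)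
    (hM : 16 + 16 * N + 8 * K * N ≤ M) (hp : p ≤ M) :
    wp (processNext I) ⟨m, t, p⟩ (fun _ s' => ∃ i n', i ∉ m.sel ∧ Inv I δ s'.mem ∧
      Tight I s'.mem ∧ s'.mem.sel = m.sel ++ [i] ∧ (∀ v ∈ m.sel, s'.mem.l v = m.l v) ∧
      s'.mem.l i ≠ ⊤ ∧ s'.mem.main.arr.size + 1 = m.main.arr.size ∧
      s'.mem.trunc < 2 * δ * 2 ^ n' ∧
      s'.time + n' * passCost I K ≤
        t + n * passCost I K + (K + 2 * ballCard I i (s'.mem.l i) + 4) * unitCost I ∧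
      s'.peak ≤ M) := by
  classical
  have hsp := hinv.space_le hI
  simp only [processNext, wp_bind]
  refine (heapPop_spec (h := .main) (M := M) hinv.main_valid hinv.main_ordered hne (by omega)
    hp).mono ?_
  rintro ⟨i, li⟩ ⟨m₁, t₁, p₁⟩ ⟨hli, hi, hmax, a, hm₁, ha, hao, hak, has, ham, ht₁, hp₁⟩
  have hheap : m.heap .main = m.main := rfl
  simp only [hheap] at hm₁ ht₁ hp₁ hli hi hmax hak has ham
  subst hm₁
  have hi := (hinv.mem_main i).1 hi
  rw [hinv.main_key i hi] at hli hmax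
  subst hli
  have hmax : ∀ v, v ∉ m.sel → distTo I m.sel v ≤ distTo I m.sel i := fun v hv => by
    rw [← hinv.main_key v hv]; exact hmax v ((hinv.mem_main v).2 hv)
  set r := distTo I m.sel i with hr
  have hsp1 := m.space_setHeap .main a
  rw [hheap] at hsp1
  simp only [wp_writeL, wp_readList]
  set m₂ : Mem N := { m.setHeap .main a with l := Function.update (m.setHeap .main a).l i r } with hm₂
  have hsp2 : m₂.space = (m.setHeap .main a).space := rfl
  have hps : m₂.list .parents i = m.parents i := rfl
  rw [hps]
  refine (selectParent_spec I i r none (m.parents i) m₂ _ _).mono ?_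
  rintro o ⟨m₃, t₃, p₃⟩ ⟨hm₃, hp₃, ht₃, hall, -, hsome⟩
  simp only at hm₃ ht₃ hp₃
  subst hm₃
  -- `l[i]` is already overwritten when the candidates are tested. This is harmless: an unselected
  -- index is not its own parent.
  have hcand : ∀ k ∈ m.parents i, m₂.IsCandidate I i r k ↔ m.IsCandidate I i r k := fun k hk => by
    have hk' : k ≠ i := by
      rintro rfl
      exact hi (hinv.child k k ((hinv.dual k k).1 hk)).1
    simp [Mem.IsCandidate, hm₂, Mem.setHeap, hk']
  obtain ⟨k₀, hk₀, hc₀, hd₀⟩ := IsNext.exists_candidate hI hinv hi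
  obtain ⟨⟨k, d⟩, rfl, hd⟩ := hall k₀ hk₀ ((hcand k₀ hk₀).2 hc₀)
  obtain ⟨hk, hck, hkd⟩ := (hsome _ rfl).resolve_left (by simp)
  simp only at hk hck hkd hd
  subst hkd
  have hnext : IsNext I m i k := ⟨hi, hmax,
    (hinv.child k i ((hinv.dual k i).1 hk)).1, (hcand k hk).1 hck, hd.trans hd₀⟩
  have hcs : m₂.list .children k = m.children k := rfl
  simp only [wp_bind, wp_op, wp_readList, hcs]
  have hlen := length_le_of_nodup (hinv.nodup_children k)
  refine (scanChildren_spec I i r k (I.dist i k + I.rho * r) (m.children k)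
    (hinv.nodup_children k) (hinv.sorted k) (m := m₂) (M := M) ha hao (by omega)
    (by omega)).mono ?_
  rintro _ ⟨m₄, t₄, p₄⟩ ⟨a', hm₄, ha', hao', has', ham', hak', ht₄, hp₄⟩
  simp only at hm₄ ht₄ hp₄
  subst hm₄
  set F := (m.children k).filter fun j => I.dist j k ≤ I.dist i k + I.rho * r with hF
  set G := F.filter fun j => I.dist i j ≤ I.rho * r with hG
  have hFnd : F.Nodup := (hinv.nodup_children k).filter _
  have hGnd : G.Nodup := hFnd.filter _
  have hFB : F.length ≤ ballCard I i r := by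
    rw [← List.toFinset_card_of_nodup hFnd]
    refine Finset.card_le_card fun j hj => ?_
    simp only [hF, List.mem_toFinset, List.mem_filter, decide_eq_true_eq] at hj
    simp only [Finset.mem_filter, Finset.mem_univ, true_and]
    exact hnext.dist_le_three hI hj.2
  have hGF : G.length ≤ F.length := List.length_filter_le _ _
  have hmemG : ∀ j, j ∈ G ↔ j ∈ m.children k ∧ I.dist i j ≤ I.rho * r := fun j => by
    simp only [hG, hF, List.mem_filter, decide_eq_true_eq]
    constructor
    · exact fun h => ⟨h.1.1, h.2⟩
    · exact fun h => ⟨⟨h.1, IsNext.dist_le_bound hI h.2⟩, h.2⟩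
  have hci : m.children i = [] := List.eq_nil_iff_forall_not_mem.2 fun j hj =>
    hi (hinv.child i j hj).1
  simp only [wp_pushOrder]
  set m₅ : Mem N := { m₂.link i G a' with
    order := (m₂.link i G a').order.push i
    rank := Function.update (m₂.link i G a').rank i (some (m₂.link i G a').order.size) } with hm₅
  have hc5 : m₅.children i = G.reverse := by
    have : m₂.children i = m.children i := rfl
    simp [hm₅, Mem.link, this, hci]
  -- Each new child takes one node of two words in either list.
  have hsp5 : m₅.space ≤ m.space + 1 + 4 * G.length := by
    have h1 := sum_length_update m.children i (G.reverse ++ m.children i)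
    have h2 : ∑ j, (m₅.parents j).length ≤ ∑ j, (m.parents j).length + G.length := by
      have : G.length = ∑ j, if j ∈ G then 1 else 0 := by
        rw [← List.toFinset_card_of_nodup hGnd, ← Finset.card_filter]
        congr 1
        ext j; simp
      rw [this, ← Finset.sum_add_distrib]
      refine Finset.sum_le_sum fun j _ => ?_
      have h3 : m₅.parents j = if j ∈ G then i :: m.parents j else m.parents j := rfl
      rw [h3]
      split_ifs <;> simp
    have h4 : m₅.children = Function.update m.children i (G.reverse ++ m.children i) := rfl
    have h5 : m₅.main.arr.size + 1 = m.main.arr.size := by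
      have : m₅.main.arr.size = a'.arr.size := rfl
      rw [this, has']; exact has
    have h6 : m₅.order.size = m.order.size + 1 := by
      simp [hm₅, Mem.link, hm₂, Mem.setHeap]
    have h7 : m₅.aux = m.aux := rfl
    have h8 : m₅.buffer = m.buffer := rfl
    have h9 : m₅.S = m.S := rfl
    rw [Mem.space_eq, Mem.space_eq, h4, h6, h7, h8, h9]
    simp only [List.length_append, List.length_reverse] at h1
    omega
  have hFN := length_le_of_nodup hFnd
  have hGl : (m₅.children i).length = G.length := by rw [hc5, List.length_reverse]
  have h0N : 0 < N := Nat.lt_of_le_of_lt (Nat.zero_le _) i.2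
  refine (sortChildren_spec I (i := i) (m := m₅) (M := M) hinv.aux_valid hinv.aux_empty
    (by rw [hc5]; exact List.nodup_reverse.2 hGnd) (by omega) (by omega)).mono ?_
  rintro _ ⟨m₆, t₆, p₆⟩ ⟨b, cs, hm₆, hb, hbe, hcsnd, hcsm, hsort, ht₆, hp₆⟩
  simp only at hm₆ ht₆ hp₆
  have hm₆' : m₆ = m.select i r G cs a' b := by
    rw [hm₆]
    simp only [Mem.select, Mem.setList, Mem.setHeap, hm₅, Mem.link, hm₂, Function.update_idem]
  subst hm₆'
  have hinv' : Inv I δ (m.select i r G cs a' b) := by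
    refine Inv.select hnext hI hinv htight hmemG (fun j => ?_) hcsnd hsort ha' hao' (fun v => ?_)
      (fun v hv => ?_) hb hbe
    · rw [hcsm, hc5, List.mem_reverse]
    · rw [ham']
      refine (ham v).trans ?_
      rw [hinv.mem_main]
    · have hv' : v ∉ m.sel := (hinv.mem_main v).1 ((ham v).1 ((ham' v).1 hv)).1
      have hkv : m₂.main.key v = distTo I m.sel v := by
        rw [← hinv.main_key v hv']
        exact congrFun hak v
      rw [hak' v hv, hkv]
  have hsel : (m.select i r G cs a' b).sel = m.sel ++ [i] := by
    simp [Mem.select, Mem.sel]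
  refine (truncationLoop_spec hI hinv' (n := n) (M := M) hn (by omega) hp₆).mono ?_
  rintro _ ⟨m₇, t₇, p₇⟩ ⟨n', hinv7, htight7, hord7, hl7, hmain7, hn', ht₇, hp₇⟩
  simp only at hinv7 htight7 hord7 hl7 hmain7 hn' ht₇ hp₇ ⊢
  have hli : m₇.l i = r := by rw [hl7]; simp [Mem.select]
  refine ⟨i, n', hi, hinv7, htight7, ?_, fun v hv => ?_, ?_, ?_, hn', ?_, hp₇⟩
  · rw [Mem.sel, hord7]; exact hsel
  · have : v ≠ i := by rintro rfl; exact hi hv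
    rw [hl7]; simp [Mem.select, this]
  · rw [hli]; exact hnext.distTo_ne_top hinv
  · rw [hmain7]
    have : (m.select i r G cs a' b).main.arr.size = a'.arr.size := rfl
    rw [this, has']; exact has
  · rw [hli]
    have hpl := hinv.length_parents_le hI hi
    have e1 : (m.parents i).length * (I.oracleCost + 9) ≤ K * unitCost I :=
      Nat.mul_le_mul hpl (by unfold unitCost; omega)
    have e2 : (F.length + 1) * scanCost I ≤ (ballCard I i r + 1) * unitCost I :=
      Nat.mul_le_mul (by omega) (by unfold unitCost scanCost; omega)
    have e3 : ((m₅.children i).length + 1) * sortCost I ≤ (ballCard I i r + 1) * unitCost I :=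
      Nat.mul_le_mul (by omega) (by unfold unitCost sortCost; omega)
    have e4 : siftCost N + 40 ≤ unitCost I := by unfold unitCost; omega
    have e5 : (K + 2 * ballCard I i r + 4) * unitCost I = K * unitCost I
      + (ballCard I i r + 1) * unitCost I + (ballCard I i r + 1) * unitCost I
      + 2 * unitCost I := by ring
    omega

end ProcessNext

/-! ## The whole algorithm -/

section Whole

variable {N : ℕ} {I : Input N} {δ Δ : ℝ≥0∞} {K lv : ℕ} {m : Mem N}

/-- The memory after the initialization, where `a` is the main heap. -/
noncomputable def Mem.initial (a : Heap N) : Mem N :=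
  { Mem.empty N with l := fun _ => ⊤, main := a }

theorem initArrays_spec (hI : IsGood I δ Δ K lv) {t p M : ℕ} (hM : 16 + 9 * N ≤ M) (hp : p ≤ M) :
    wp (initArrays I) ⟨Mem.empty N, t, p⟩ (fun _ s' => ∃ a, s'.mem = Mem.initial a ∧
      a.IsValid ∧ OrderedFrom 0 a.keyPos ∧ a.arr.size = N ∧ (∀ v, v ∈ a.arr) ∧
      (∀ v, a.key v = ⊤) ∧ s'.time ≤ t + (N + 1) * unitCost I ∧ s'.peak ≤ M) := by
  simp only [initArrays, wp_bind]
  have hspace : ∀ (l : Fin N → ℝ≥0∞) (a : Heap N),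
      ({ Mem.empty N with l := l, main := a } : Mem N).space = 16 + 8 * N + a.arr.size := by
    intro l a
    simp [Mem.space, Mem.empty]
  refine (wp_forEach _ (fun as s => ∃ pre a l, pre ++ as = List.finRange N ∧
    s.mem = { Mem.empty N with l := l, main := a } ∧ a.IsValid ∧ a.arr.size = pre.length ∧
    (∀ v, v ∈ a.arr ↔ v ∈ pre) ∧ (∀ v ∈ pre, a.key v = ⊤ ∧ l v = ⊤) ∧
    s.time ≤ t + pre.length * (I.oracleCost + 8) ∧ s.peak ≤ M)
    (Q := fun _ s => ∃ a, s.mem = Mem.initial a ∧ a.IsValid ∧ a.arr.size = N ∧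
    (∀ v, v ∈ a.arr) ∧ (∀ v, a.key v = ⊤) ∧
    s.time ≤ t + 1 + N * (I.oracleCost + 8) ∧ s.peak ≤ M) ?_ ?_ ?_).mono ?_
  · rintro i as m₁ t₁ p₁ ⟨pre, a, l, hpre, hm, ha, hsz, hmem, hkey, ht, hp₁⟩
    simp only at hm ht hp₁
    subst hm
    have hi : i ∉ pre := by
      intro hi
      have := List.nodup_finRange N
      rw [← hpre] at this
      exact (List.nodup_append.1 this).2.2 i hi i (by simp) rfl
    have hlen : pre.length + (as.length + 1) = N := by
      have := congrArg List.length hpre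
      simpa using this
    have hset : ∀ w : ListId, ∀ l a, ({ Mem.empty N with l := l, main := a } : Mem N).setList w i []
        = { Mem.empty N with l := l, main := a } := by
      intro w l a
      cases w <;> simp [Mem.setList, Mem.empty]
    simp only [wp_bind, wp_queryBoundary, wp_writeL, wp_clearList, wp_heapAppend, hI.boundary]
    have hset1 := hset .parents (Function.update l i ⊤) a
    have hset2 := hset .children (Function.update l i ⊤) a
    rw [hset1, hset2]
    have happ : ∀ l, ({ Mem.empty N with l := l, main := a } : Mem N).setHeap .main
        ((({ Mem.empty N with l := l, main := a } : Mem N).heap .main).append i ⊤)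
        = { Mem.empty N with l := l, main := a.append i ⊤ } := fun l => rfl
    rw [happ]
    have hsz' : (a.append i ⊤).arr.size = pre.length + 1 := by simp [Heap.append, hsz]
    refine ⟨pre ++ [i], a.append i ⊤, _, by simpa using hpre, rfl,
      ha.append (by rwa [hmem]) _, by simpa using hsz', fun w => by simp [hmem], fun w hw => ?_,
      ?_, ?_⟩
    · simp only [Heap.append, Function.update_apply]
      by_cases hwi : w = i
      · simp [hwi]
      · simp only [hwi, if_false]
        exact hkey w (by simpa [hwi] using hw)
    · simp only [List.length_append, List.length_singleton, Nat.add_mul]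
      omega
    · simp only [hspace, hsz', hsz]
      omega
  · refine ⟨[], (Mem.empty N).main, (Mem.empty N).l, rfl, rfl, ?_, rfl, by simp [Mem.empty],
      by simp, by simp, hp⟩
    intro v q
    simp [Mem.empty]
  · rintro m₁ t₁ p₁ ⟨pre, a, l, hpre, hm, ha, hsz, hmem, hkey, ht, hp₁⟩
    rw [List.append_nil] at hpre
    subst hpre
    have hl : l = fun _ => ⊤ := funext fun v => (hkey v (by simp)).2
    rw [List.length_finRange] at hsz ht
    refine ⟨a, ?_, ha, hsz, fun v => (hmem v).2 (by simp), fun v => (hkey v (by simp)).1, ?_, hp₁⟩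
    · rw [hm, hl]; rfl
    · dsimp only at ht ⊢; omega
  rintro _ ⟨m₁, t₁, p₁⟩ ⟨a, hm, ha, hsz, hmem, hkey, ht, hp₁⟩
  simp only at hm ht hp₁
  subst hm
  have hh : (Mem.initial a).heap .main = a := rfl
  have hsp : (Mem.initial a).space = 16 + 8 * N + a.arr.size := hspace _ a
  refine (heapify_spec (h := .main) (M := M) (m := Mem.initial a) ha (by omega) hp₁).mono ?_
  rintro _ ⟨m₂, t₂, p₂⟩ ⟨b, hm₂, hR, hO, ht₂, hp₂⟩
  simp only at hm₂ ht₂ hp₂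
  rw [hh] at hR ht₂
  refine ⟨b, hm₂, hR.valid, hO, hR.size.trans hsz, fun v => (hR.mem v).2 (hmem v),
    fun v => by rw [hR.key]; exact hkey v, ?_, hp₂⟩
  dsimp only
  rw [hsz] at ht₂
  have e1 : N * (I.oracleCost + 8) + N * (siftCost N + 1) ≤ N * unitCost I := by
    rw [← Nat.mul_add]
    exact Nat.mul_le_mul_left _ (by unfold unitCost; omega)
  have e2 : 40 ≤ unitCost I := by unfold unitCost; omega
  rw [Nat.add_mul, Nat.one_mul]
  omega

theorem Mem.link_concat (m : Mem N) (i j : Fin N) (G : List (Fin N)) (hj : j ∉ G) (a b : Heap N)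
    (m₁ : Mem N) (hm₁ : m₁ = (m.link i G a).setList .children i
      (j :: (m.link i G a).list .children i)) :
    (m₁.setList .parents j (i :: m₁.list .parents j)).setHeap .main b
      = m.link i (G ++ [j]) b := by
  subst hm₁
  simp only [Mem.link, Mem.setHeap, Mem.setList, Mem.list, Mem.mk.injEq, true_and, and_true,
    Function.update_self, List.reverse_append, List.reverse_singleton, List.nil_append,
    List.cons_append, Function.update_idem]
  funext v
  by_cases h : v = j
  · subst h; simp [hj]
  · simp [h]

theorem Mem.space_link (m : Mem N) (i : Fin N) (G : List (Fin N)) (hG : G.Nodup) (a : Heap N) :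
    (m.link i G a).space + m.main.arr.size = m.space + a.arr.size + 4 * G.length := by
  classical
  have h1 := sum_length_update m.children i (G.reverse ++ m.children i)
  have h2 : ∑ j, ((m.link i G a).parents j).length = ∑ j, (m.parents j).length + G.length := by
    have : G.length = ∑ j, if j ∈ G then 1 else 0 := by
      rw [← List.toFinset_card_of_nodup hG, ← Finset.card_filter]
      congr 1
      ext j; simp
    rw [this, ← Finset.sum_add_distrib]
    refine Finset.sum_congr rfl fun j _ => ?_
    simp only [Mem.link]
    split_ifs <;> simp
  simp only [List.length_append, List.length_reverse] at h1
  rw [Mem.space_eq, Mem.space_eq, h2]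
  simp only [Mem.link]
  omega

/-- Every index is a child of the first one, whose scale is `⊤`, so both completeness clauses are
immediate. As `w` is farthest from `i`, the value `2 * I.dist i w` gives `dist_le_trunc` as well as
`Tight`. -/
theorem Inv.first (hI : IsGood I δ Δ K lv) {i w : Fin N} {cs : List (Fin N)} {a b : Heap N}
    {m : Mem N} (hl : ∀ v, m.l v = ⊤) (hord : m.order = #[i])
    (hrank : ∀ v q, m.rank v = some q ↔ m.order[q]? = some v)
    (hpar : ∀ j, m.parents j = [i]) (hch : m.children = Function.update (fun _ => []) i cs)
    (hbuf : m.buffer = []) (hS : m.S = #[]) (hmain : m.main = a) (haux : m.aux = b)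
    (htr : m.trunc = 2 * I.dist i w) (hw : w ≠ i)
    (hcs : ∀ j, j ∈ cs) (hcsnd : cs.Nodup)
    (hsort : cs.Pairwise fun v w => I.dist v i ≤ I.dist w i)
    (ha : a.IsValid) (hao : OrderedFrom 0 a.keyPos) (ham : ∀ v, v ∈ a.arr ↔ v ≠ i)
    (hak : ∀ v, v ≠ i → a.key v = I.dist i v) (hmax : ∀ v, v ≠ i → I.dist i v ≤ I.dist i w)
    (hb : b.IsValid) (hbe : b.arr = #[]) : Inv I δ m ∧ Tight I m := by
  have hsel : m.sel = [i] := by simp [Mem.sel, hord]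
  have hci : m.children i = cs := by simp [hch]
  have hcv : ∀ v, v ≠ i → m.children v = [] := fun v hv => by simp [hch, hv]
  have hrho : I.rho ≠ 0 := fun h => absurd hI.two_le (by rw [h]; norm_num)
  have htop : ∀ j, I.rho * m.l j = ⊤ := fun j => by rw [hl]; exact ENNReal.mul_top hrho
  have h12 : ∀ c : ℝ≥0∞, c ≤ 2 * c := fun c => by
    calc c = 1 * c := (one_mul c).symm
      _ ≤ 2 * c := by gcongr; norm_num
  have hsingle : ∀ L₁ (j : Fin N) L₂, [i] = L₁ ++ j :: L₂ → L₁ = [] ∧ j = i := by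
    intro L₁ j L₂ h
    rcases append_singleton_eq_append_cons (L := []) L₁ j L₂ h with h | ⟨L₃, h⟩
    · exact h
    · simp at h
  refine ⟨?_, ?_⟩
  · refine
    { maximin := ?_
      rank := hrank
      main_valid := by rwa [hmain]
      main_ordered := by rwa [hmain]
      mem_main := ?_
      main_key := ?_
      aux_valid := by rwa [haux]
      aux_empty := by rwa [haux]
      buffer := hbuf
      pairs := hS
      trunc_ne_top := ?_
      le_trunc := ?_
      trunc_le := ?_
      dist_le_trunc := ?_
      dual := ?_
      nodup_children := ?_
      nodup_parents := ?_
      child := ?_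
      mem_of_not_mem := ?_
      mem_of_mem := ?_
      sorted := ?_ }
    · rw [hsel]
      refine ⟨by simp, fun L₁ a L₂ h v _ => ?_, fun L₁ a L₂ h => ?_⟩
      · rw [(hsingle _ _ _ h).1]; simp
      · rw [(hsingle _ _ _ h).1, hl]; simp
    · intro v; simp [hsel, hmain, ham]
    · intro v hv
      rw [hsel, List.mem_singleton] at hv
      rw [hmain, hak v hv, hsel, distTo_singleton]
    · rw [htr]; exact ENNReal.mul_ne_top (by norm_num) (hI.dist_ne_top _ _)
    · rw [htr]; gcongr; exact hI.le_dist _ _ hw.symm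
    · intro j _
      rw [hl, ENNReal.mul_top (by norm_num)]; exact le_top
    · intro v hv
      rw [hsel, List.mem_singleton] at hv
      rw [hsel, distTo_singleton, htr]
      gcongr
      exact hmax v hv
    · intro v j
      rw [hpar, List.mem_singleton]
      by_cases hv : v = i
      · subst hv; simp [hci, hcs]
      · simp [hv, hcv v hv]
    · intro v
      by_cases hv : v = i
      · subst hv; rwa [hci]
      · simp [hcv v hv]
    · intro v; simp [hpar]
    · intro v j hj
      by_cases hv : v = i
      · subst hv
        simp only [hsel, List.mem_singleton, htop, true_and]
        refine ⟨le_top, fun hj => ?_, fun _ => by simp⟩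
        rw [htr]
        exact (hmax j hj).trans ((h12 _).trans (IsNext.le_rho_mul hI _))
      · simp [hcv v hv] at hj
    · intro v hv j _ _ _
      rw [hsel, List.mem_singleton] at hv
      subst hv
      rw [hci]; exact hcs j
    · intro L₁ j L₂ hL v hv _
      rw [hsel] at hL
      obtain ⟨rfl, rfl⟩ := hsingle _ _ _ hL
      have : v = j := by simpa using hv
      subst this
      rw [hci]; exact hcs v
    · intro v
      by_cases hv : v = i
      · subst hv; rwa [hci]
      · simp [hcv v hv]
  · intro v _
    refine ⟨w, by simpa [hsel] using hw, ?_⟩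
    rw [htr, hsel, distTo_singleton]
    gcongr
    norm_num

/-- All keys are `⊤`, so the first index is arbitrary and one decrease turns a key into the distance
to it. The index is also entered in its own lists; its own key is not touched, since it has left the
heap. -/
theorem processFirst_spec (hI : IsGood I δ Δ K lv) {a : Heap N} (ha : a.IsValid)
    (hao : OrderedFrom 0 a.keyPos) (hsz : a.arr.size = N) (hall : ∀ v, v ∈ a.arr)
    (hkey : ∀ v, a.key v = ⊤) {t p M : ℕ} (hM : 17 + 14 * N ≤ M) (hp : p ≤ M) :
    wp (processFirst I) ⟨Mem.initial a, t, p⟩ (fun _ s' => Inv I δ s'.mem ∧ Tight I s'.mem ∧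
      s'.mem.trunc < 2 * δ * 2 ^ lv ∧
      s'.time ≤ t + (2 * N + 4) * unitCost I ∧ s'.peak ≤ M) := by
  have hN := hI.two_le_card
  have hh : (Mem.initial a).heap .main = a := rfl
  have hsp0 : (Mem.initial a).space = 16 + 8 * N + a.arr.size := by
    simp [Mem.space, Mem.initial, Mem.empty]
  simp only [processFirst, wp_bind]
  refine (heapPop_spec (h := .main) (m := Mem.initial a) (M := M) ha hao (by rw [hh]; omega)
    (by omega) hp).mono ?_
  rintro ⟨i, li⟩ ⟨m₁, t₁, p₁⟩ ⟨-, -, -, b, hm₁, hb, hbo, hbk, hbs, hbm, ht₁, hp₁⟩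
  simp only [hh] at hm₁ ht₁ hp₁ hbk hbs hbm
  subst hm₁
  simp only [wp_pushOrder]
  set m₂ : Mem N := { (Mem.initial a).setHeap .main b with
    order := ((Mem.initial a).setHeap .main b).order.push i
    rank := Function.update ((Mem.initial a).setHeap .main b).rank i
      (some ((Mem.initial a).setHeap .main b).order.size) } with hm₂
  have hm₂b : m₂.main = b := rfl
  have hsp2 : m₂.space = 17 + 8 * N + b.arr.size := by
    simp [hm₂, Mem.space, Mem.setHeap, Mem.initial, Mem.empty]; omega
  have hlink0 : m₂.link i [] b = m₂ := by rw [Mem.link_nil]; rfl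
  refine (wp_forEach _ (fun as s => ∃ pre c, pre ++ as = List.finRange N ∧
    s.mem = m₂.link i pre c ∧ c.IsValid ∧ OrderedFrom 0 c.keyPos ∧ c.arr.size = b.arr.size ∧
    (∀ v, v ∈ c.arr ↔ v ∈ b.arr) ∧
    (∀ v ∈ c.arr, v ∈ pre → c.key v = I.dist i v) ∧ (∀ v ∈ c.arr, v ∉ pre → c.key v = ⊤) ∧
    s.time ≤ t₁ + 2 + pre.length * (I.oracleCost + siftCost N + 12) ∧ s.peak ≤ M)
    (Q := fun _ s => ∃ c, s.mem = m₂.link i (List.finRange N) c ∧ c.IsValid ∧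
    OrderedFrom 0 c.keyPos ∧ c.arr.size = b.arr.size ∧ (∀ v, v ∈ c.arr ↔ v ∈ b.arr) ∧
    (∀ v ∈ c.arr, c.key v = I.dist i v) ∧
    s.time ≤ t₁ + 3 + N * (I.oracleCost + siftCost N + 12) ∧ s.peak ≤ M) ?_ ?_ ?_).mono ?_
  · rintro j as m₃ t₃ p₃ ⟨pre, c, hpre, hm, hc, hco, hcs, hcm, hck, hck', ht, hp₃⟩
    simp only at hm ht hp₃
    subst hm
    have hnd := List.nodup_finRange N
    rw [← hpre] at hnd
    have hj : j ∉ pre := fun hj => (List.nodup_append.1 hnd).2.2 j hj j (by simp) rfl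
    have hlen : pre.length + (as.length + 1) = N := by
      have := congrArg List.length hpre
      simpa using this
    have hspl := m₂.space_link i pre (List.nodup_append.1 hnd).1 c
    simp only [wp_bind, wp_pushList, wp_queryDist]
    set m₄ := (m₂.link i pre c).setList .children i (j :: (m₂.link i pre c).list .children i)
      with hm₄
    set m₅ := m₄.setList .parents j (i :: m₄.list .parents j) with hm₅
    have hsp4 := (m₂.link i pre c).space_setList .children i
      (j :: (m₂.link i pre c).list .children i)
    have hsp5 := m₄.space_setList .parents j (i :: m₄.list .parents j)
    rw [← hm₄, List.length_cons] at hsp4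
    rw [← hm₅, List.length_cons] at hsp5
    rw [hm₂b] at hspl
    refine (heapDecrease_spec (h := .main) (m := m₅) (M := M) hc hco (by omega) (by omega)).mono ?_
    rintro _ ⟨m₆, t₆, p₆⟩ ⟨d, hm₆, hd, hdo, hds, hdm, hdk, ht₆, hp₆⟩
    simp only at hm₆ ht₆ hp₆
    have hc5 : m₅.heap .main = c := rfl
    rw [hc5] at hds hdm hdk
    refine ⟨pre ++ [j], d, by simpa using hpre, ?_, hd, hdo, hds.trans hcs,
      fun v => (hdm v).trans (hcm v), fun v hv hvp => ?_, fun v hv hvp => ?_, ?_, hp₆⟩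
    · exact hm₆.trans (m₂.link_concat i j pre hj c d m₄ hm₄)
    · rw [hdk v hv]
      by_cases hvj : v = j
      · subst hvj
        rw [if_pos rfl, hck' v ((hdm v).1 hv) hj]
        simp
      · rw [if_neg hvj]
        exact hck v ((hdm v).1 hv) (by simpa [hvj] using hvp)
    · simp only [List.mem_append, List.mem_singleton, not_or] at hvp
      rw [hdk v hv, if_neg hvp.2]
      exact hck' v ((hdm v).1 hv) hvp.1
    · simp only [List.length_append, List.length_singleton, Nat.add_mul]
      omega
  · refine ⟨[], b, rfl, hlink0.symm, hb, hbo, rfl, fun _ => Iff.rfl, by simp, fun v _ _ => ?_,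
      by simp, ?_⟩
    · rw [hbk]; exact hkey v
    · change max p₁ m₂.space ≤ M
      omega
  · rintro m₃ t₃ p₃ ⟨pre, c, hpre, hm, hc, hco, hcs, hcm, hck, hck', ht, hp₃⟩
    rw [List.append_nil] at hpre
    subst hpre
    rw [List.length_finRange] at ht
    exact ⟨c, hm, hc, hco, hcs, hcm, fun v hv => hck v hv (by simp),
      by dsimp only at ht ⊢; omega, hp₃⟩
  rintro _ ⟨m₃, t₃, p₃⟩ ⟨c, hm, hc, hco, hcs, hcm, hck, ht₃, hp₃⟩
  simp only at hm ht₃ hp₃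
  subst hm
  set m₃ := m₂.link i (List.finRange N) c with hm₃
  have hspl := m₂.space_link i (List.finRange N) (List.nodup_finRange N) c
  rw [hm₂b, List.length_finRange, ← hm₃] at hspl
  have hc3 : m₃.children i = (List.finRange N).reverse := by
    simp [hm₃, Mem.link, hm₂, Mem.setHeap, Mem.initial, Mem.empty]
  have hc3l : (m₃.children i).length = N := by rw [hc3]; simp
  refine (sortChildren_spec I (i := i) (m := m₃) (M := M) (by intro v q; simp [hm₃, hm₂, Mem.link,
    Mem.setHeap, Mem.initial, Mem.empty]) rfl
    (by rw [hc3]; exact List.nodup_reverse.2 (List.nodup_finRange N)) (by omega) hp₃).mono ?_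
  rintro _ ⟨m₄, t₄, p₄⟩ ⟨x, cs, hm₄, hx, hxe, hcsnd, hcsm, hsort, ht₄, hp₄⟩
  simp only at hm₄ ht₄ hp₄
  subst hm₄
  set m₄ := (m₃.setHeap .aux x).setList .children i cs with hm₄
  have hm4c : m₄.heap .main = c := rfl
  have hcsz : c.arr.size ≠ 0 := by omega
  simp only [wp_heapSize, hm4c, if_pos hcsz, wp_bind]
  have hlt : 0 < (m₄.heap .main).arr.size := by rw [hm4c]; omega
  obtain ⟨w, hw, hroot, hmax⟩ := exists_root hco hcsz
  simp only [wp_keyAt hlt, wp_op, wp_writeTrunc, hm4c, hroot, hck w hw]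
  have hcm' : ∀ v, v ∈ c.arr ↔ v ≠ i := fun v => by rw [hcm, hbm]; simp [hall v]
  have hsp4a := m₃.space_setHeap .aux x
  have hsp4b := (m₃.setHeap .aux x).space_setList .children i cs
  rw [← hm₄] at hsp4b
  have hl4 : ((m₃.setHeap .aux x).list .children i).length = N := hc3l
  have hx0 : x.arr.size = 0 := by simp [hxe]
  have hcsl : cs.length ≤ N := length_le_of_nodup hcsnd
  have hsp4 : ({ m₄ with trunc := 2 * I.dist i w } : Mem N).space = m₄.space := rfl
  have hfirst := Inv.first hI (i := i) (w := w) (cs := cs) (a := c) (b := x)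
    (m := { m₄ with trunc := 2 * I.dist i w }) (fun v => rfl) (by
      simp [hm₄, hm₃, hm₂, Mem.link, Mem.setList, Mem.setHeap, Mem.initial, Mem.empty])
    (by
      refine rank_push (m := (Mem.initial a).setHeap .main b) (fun v q => ?_) ?_
      · simp [Mem.setHeap, Mem.initial, Mem.empty]
      · simp [Mem.setHeap, Mem.initial, Mem.empty])
    (fun j => by
      simp [hm₄, hm₃, hm₂, Mem.link, Mem.setList, Mem.setHeap, Mem.initial, Mem.empty])
    (by
      simp [hm₄, hm₃, hm₂, Mem.link, Mem.setList, Mem.setHeap, Mem.initial, Mem.empty])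
    rfl rfl rfl rfl rfl ((hcm' w).1 hw) (fun j => by rw [hcsm, hc3]; simp) hcsnd hsort hc hco hcm'
    (fun v hv => hck v ((hcm' v).2 hv))
    (fun v hv => by
      have hv' := (hcm' v).2 hv
      rw [← hck v hv', ← hck w hw]; exact hmax v hv') hx hxe
  refine ⟨hfirst.1, hfirst.2, ?_, ?_, ?_⟩
  · have h1 : 2 * I.dist i w < 2 * (δ * 2 ^ lv) := by
      refine (ENNReal.mul_lt_mul_iff_right (by norm_num) (by norm_num)).2 ?_
      exact (hI.dist_le i w).trans_lt hI.lt_pow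
    rwa [← mul_assoc] at h1
  · rw [hc3l] at ht₄
    have e1 : N * (I.oracleCost + siftCost N + 12) ≤ N * unitCost I :=
      Nat.mul_le_mul_left _ (by unfold unitCost; omega)
    have e2 : (N + 1) * sortCost I ≤ (N + 1) * unitCost I :=
      Nat.mul_le_mul_left _ (by unfold unitCost sortCost; omega)
    have e3 : siftCost N + 40 ≤ unitCost I := by unfold unitCost; omega
    have e4 : (2 * N + 4) * unitCost I = N * unitCost I + (N + 1) * unitCost I
      + 3 * unitCost I := by ring
    omega
  · omega

end Whole

/-! ### The main loop, the aggregation and the total cost -/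

section Total

variable {N : ℕ} {I : Input N} {δ Δ : ℝ≥0∞} {K lv : ℕ} {m : Mem N}

open Classical in
/-- The bound for the number of units of time that are spent on the selected indices. -/
noncomputable def selectionUnits (I : Input N) (K : ℕ) (l : Fin N → ℝ≥0∞) (L : List (Fin N)) : ℕ :=
  L.length * (K + 5) + 2 * (L.map fun i => if l i = ⊤ then 0 else ballCard I i (l i)).sum

theorem selectionUnits_le {l : Fin N → ℝ≥0∞} {L : List (Fin N)} (h : IsMaximin I l L)
    (hI : IsGood I δ Δ K lv) : selectionUnits I K l L ≤ N * (K + 5) + 2 * (N * (lv * K)) := by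
  have h1 := h.sum_ballCard_le hI
  have h2 := Nat.mul_le_mul_right (K + 5) (length_le_of_nodup h.nodup)
  unfold selectionUnits
  omega

theorem selectionUnits_append {l l' : Fin N → ℝ≥0∞} {L : List (Fin N)} {i : Fin N}
    (hl : ∀ v ∈ L, l' v = l v) (hi : l' i ≠ ⊤) : selectionUnits I K l' (L ++ [i])
      = selectionUnits I K l L + (K + 2 * ballCard I i (l' i) + 5) := by
  have h1 : (L.map fun i => if l' i = ⊤ then 0 else ballCard I i (l' i))
      = L.map fun i => if l i = ⊤ then 0 else ballCard I i (l i) :=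
    List.map_congr_left fun v hv => by rw [hl v hv]
  simp only [selectionUnits, List.map_append, List.sum_append, List.map_cons, List.map_nil, h1,
    List.length_append, List.length_singleton, List.sum_singleton, if_neg hi]
  ring

theorem mainLoop_spec (hI : IsGood I δ Δ K lv) (hinv : Inv I δ m) (htight : Tight I m)
    {t p M n : ℕ} (hn : m.trunc < 2 * δ * 2 ^ n)
    (hM : 16 + 16 * N + 8 * K * N ≤ M) (hp : p ≤ M) :
    wp (mainLoop I) ⟨m, t, p⟩ (fun _ s' => Inv I δ s'.mem ∧ (∀ v, v ∈ s'.mem.sel) ∧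
      s'.time ≤ t + 1 + n * passCost I K
        + (N * (K + 5) + 2 * (N * (lv * K))) * unitCost I ∧ s'.peak ≤ M) := by
  -- The heap size `k` bounds the passes, while the exponent `n'` remains as potential for
  -- truncations.
  refine wp_loop _ (fun k _ s => Inv I δ s.mem ∧ Tight I s.mem ∧ s.mem.main.arr.size = k ∧
    s.peak ≤ M ∧ ∃ n', s.mem.trunc < 2 * δ * 2 ^ n' ∧ s.time + n' * passCost I K ≤
      t + n * passCost I K + selectionUnits I K s.mem.l s.mem.sel * unitCost I)
    ?_ ⟨hinv, htight, rfl, hp, n, hn, Nat.le_add_right _ _⟩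
  rintro k _ m₁ t₁ p₁ ⟨h, hti, hk, hp₁, n₁, hn₁, ht⟩
  simp only at h hti hk hp₁ hn₁ ht
  have hheap : m₁.heap .main = m₁.main := rfl
  simp only [wp_bind, wp_heapSize, hheap]
  split_ifs with h0
  · rw [wp_bind]
    refine (processNext_spec hI h hti h0 (M := M) hn₁ hM hp₁).mono ?_
    rintro _ ⟨m₂, t₂, p₂⟩ ⟨i, n₂, hi, h2, hti2, hsel, hl, hli, hsz, hn₂, ht₂, hp₂⟩
    rw [wp_pure]
    simp only at h2 hti2 hsel hl hli hsz hn₂ ht₂ hp₂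
    refine ⟨m₂.main.arr.size, by omega, h2, hti2, rfl, hp₂, n₂, hn₂, ?_⟩
    dsimp only
    rw [hsel, selectionUnits_append hl hli]
    -- The fifth unit of an index in `selectionUnits` covers the control of the loop.
    have e1 : 1 ≤ unitCost I := by unfold unitCost; omega
    have e2 : (selectionUnits I K m₁.l m₁.sel + (K + 2 * ballCard I i (m₂.l i) + 5)) * unitCost I
      = selectionUnits I K m₁.l m₁.sel * unitCost I
        + (K + 2 * ballCard I i (m₂.l i) + 4) * unitCost I + unitCost I := by ring
    omega
  · rw [wp_pure]
    refine ⟨h, fun v => ?_, ?_, hp₁⟩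
    · by_contra hv
      have := (h.mem_main v).2 hv
      rw [not_not, Array.size_eq_zero_iff] at h0
      rw [h0] at this
      simp at this
    · have := Nat.mul_le_mul_right (unitCost I) (selectionUnits_le h.maximin hI)
      dsimp only
      omega

@[simp] theorem wp_pushS (i j : Fin N) (m : Mem N) (t p : ℕ) (Q : Unit → Config N → Prop) :
    wp (pushS i j) ⟨m, t, p⟩ Q ↔ Q () ⟨{ m with S := m.S.push (i, j) }, t + 2,
      max p ({ m with S := m.S.push (i, j) } : Mem N).space⟩ := wp_store ..

theorem Mem.space_setS (m : Mem N) (S : Array (Fin N × Fin N)) :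
    ({ m with S := S } : Mem N).space + 2 * m.S.size = m.space + 2 * S.size := by
  simp only [Mem.space_eq]; omega

/-- The child `j` of `i` contributes the pair `q` to the sparsity pattern. -/
def Mem.Contributes (I : Input N) (m : Mem N) (i j : Fin N) (q : Fin N × Fin N) : Prop :=
  (m.rank i).getD 0 ≤ (m.rank j).getD 0 ∧ I.dist i j ≤ I.rho * m.l j ∧ (q = (i, j) ∨ q = (j, j))

/-- A child contributes at most two pairs of two words each, hence the margin in `hM`. Pairs may
repeat in `S`; only membership is claimed. -/
theorem aggregate_spec {t p M : ℕ} (hS : m.S = #[])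
    (hM : m.space + 4 * ∑ i, (m.children i).length ≤ M) (hp : p ≤ M) :
    wp (aggregate I) ⟨m, t, p⟩ (fun _ s' => ∃ S, s'.mem = { m with S := S } ∧
      (∀ q, q ∈ S ↔ ∃ i, ∃ j ∈ m.children i, m.Contributes I i j q) ∧
      s'.time ≤ t + (N + ∑ i, (m.children i).length + 1) * unitCost I ∧ s'.peak ≤ M) := by
  have hS0 : m.S.size = 0 := by simp [hS]
  have hsum : ((List.finRange N).map fun i => (m.children i).length).sum
      = ∑ i, (m.children i).length := (Fin.sum_univ_def _).symm
  refine wp_forEach _ (fun as s => ∃ pre S, pre ++ as = List.finRange N ∧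
    s.mem = { m with S := S } ∧ S.size ≤ 2 * (pre.map fun i => (m.children i).length).sum ∧
    (∀ q, q ∈ S ↔ ∃ i ∈ pre, ∃ j ∈ m.children i, m.Contributes I i j q) ∧
    s.time ≤ t + (pre.length + (pre.map fun i => (m.children i).length).sum) * unitCost I ∧
    s.peak ≤ M) ?_ ?_ ?_
  · rintro i as m₁ t₁ p₁ ⟨pre, S, hpre, hm, hsz, hmem, ht, hp₁⟩
    simp only at hm ht hp₁
    subst hm
    simp only [wp_bind, wp_readList]
    have hcl : ({ m with S := S } : Mem N).list .children i = m.children i := rfl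
    rw [hcl]
    have htot : (pre.map fun i => (m.children i).length).sum + (m.children i).length
        ≤ ∑ i, (m.children i).length := by
      rw [← hsum, ← hpre]
      simp only [List.map_append, List.map_cons, List.sum_append, List.sum_cons]
      omega
    refine (wp_forEach _ (fun js s => ∃ done S', done ++ js = m.children i ∧
      s.mem = { m with S := S' } ∧ S'.size ≤ S.size + 2 * done.length ∧
      (∀ q, q ∈ S' ↔ q ∈ S ∨ ∃ j ∈ done, m.Contributes I i j q) ∧
      s.time ≤ t₁ + 2 + done.length * unitCost I ∧ s.peak ≤ M)
      (Q := fun _ s => ∃ S', s.mem = { m with S := S' } ∧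
      S'.size ≤ S.size + 2 * (m.children i).length ∧
      (∀ q, q ∈ S' ↔ q ∈ S ∨ ∃ j ∈ m.children i, m.Contributes I i j q) ∧
      s.time ≤ t₁ + 3 + (m.children i).length * unitCost I ∧ s.peak ≤ M) ?_ ?_ ?_).mono ?_
    · rintro j js m₂ t₂ p₂ ⟨done, S', hdone, hm, hsz', hmem', ht₂, hp₂⟩
      simp only at hm ht₂ hp₂
      subst hm
      have hlen : done.length + (js.length + 1) = (m.children i).length := by rw [← hdone]; simp
      have hU : I.oracleCost + 12 ≤ unitCost I := by unfold unitCost; omega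
      have hstep : (done ++ [j]).length * unitCost I = done.length * unitCost I + unitCost I := by
        simp [Nat.add_mul]
      have hskip : ¬ ((m.rank i).getD 0 ≤ (m.rank j).getD 0 ∧ I.dist i j ≤ I.rho * m.l j) →
          ∀ q, q ∈ S' ↔ q ∈ S ∨ ∃ v ∈ done ++ [j], m.Contributes I i v q := by
        intro hno q
        rw [hmem']
        refine or_congr_right ⟨?_, ?_⟩
        · rintro ⟨v, hv, hc⟩
          exact ⟨v, by simp [hv], hc⟩
        · rintro ⟨v, hv, hc⟩
          rcases List.mem_append.1 hv with hv | hv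
          · exact ⟨v, hv, hc⟩
          · rw [List.mem_singleton] at hv
            subst hv
            exact absurd ⟨hc.1, hc.2.1⟩ hno
      simp only [wp_bind, wp_readRank, wp_readL, wp_queryDist, wp_op, decide_eq_true_eq]
      split_ifs with h1
      · simp only [wp_bind, wp_op, decide_eq_true_eq]
        split_ifs with h2
        · simp only [wp_bind, wp_pushS]
          have hsp1 := m.space_setS (S'.push (i, j))
          have hsp2 := m.space_setS ((S'.push (i, j)).push (j, j))
          simp only [Array.size_push] at hsp1 hsp2
          refine ⟨done ++ [j], (S'.push (i, j)).push (j, j), by simpa using hdone, rfl, ?_,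
            fun q => ?_, ?_, ?_⟩
          · simp only [Array.size_push, List.length_append, List.length_singleton]
            omega
          · have hj : ∀ q, m.Contributes I i j q ↔ (q = (i, j) ∨ q = (j, j)) := fun q =>
              ⟨fun h => h.2.2, fun h => ⟨h1, h2, h⟩⟩
            simp only [Array.mem_push, hmem', List.mem_append, List.mem_singleton, or_and_right,
              exists_or, exists_eq_left, hj]
            simp only [or_assoc]
          · rw [hstep]; omega
          · omega
        · rw [wp_pure]
          refine ⟨done ++ [j], S', by simpa using hdone, rfl, ?_, hskip fun h => h2 h.2, ?_, hp₂⟩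
          · simp only [List.length_append, List.length_singleton]; omega
          · rw [hstep]; dsimp only; omega
      · rw [wp_pure]
        refine ⟨done ++ [j], S', by simpa using hdone, rfl, ?_, hskip fun h => h1 h.1, ?_, hp₂⟩
        · simp only [List.length_append, List.length_singleton]; omega
        · rw [hstep]; dsimp only; omega
    · exact ⟨[], S, rfl, rfl, by simp, by simp, by simp, hp₁⟩
    · rintro m₂ t₂ p₂ ⟨done, S', hdone, hm, hsz', hmem', ht₂, hp₂⟩
      rw [List.append_nil] at hdone
      subst hdone
      exact ⟨S', hm, hsz', hmem', by dsimp only at ht₂ ⊢; omega, hp₂⟩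
    · rintro _ ⟨m₂, t₂, p₂⟩ ⟨S', hm, hsz', hmem', ht₂, hp₂⟩
      simp only at hm ht₂ hp₂
      subst hm
      refine ⟨pre ++ [i], S', by simpa using hpre, rfl, ?_, fun q => ?_, ?_, hp₂⟩
      · simp only [List.map_append, List.map_cons, List.map_nil, List.sum_append,
          List.sum_singleton]
        omega
      · simp only [hmem', hmem, List.mem_append, List.mem_singleton, or_and_right, exists_or,
          exists_eq_left]
      · have hU : 40 ≤ unitCost I := by unfold unitCost; omega
        simp only [List.map_append, List.map_cons, List.map_nil, List.sum_append,
          List.sum_singleton, List.length_append, List.length_singleton]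
        have : (pre.length + 1 + ((pre.map fun i => (m.children i).length).sum
            + (m.children i).length)) * unitCost I
          = (pre.length + (pre.map fun i => (m.children i).length).sum) * unitCost I
            + (m.children i).length * unitCost I + unitCost I := by ring
        omega
  · refine ⟨[], #[], rfl, ?_, by simp, by simp, by simp, hp⟩
    rw [← hS]
  · rintro m₁ t₁ p₁ ⟨pre, S, hpre, hm, hsz, hmem, ht, hp₁⟩
    rw [List.append_nil] at hpre
    subst hpre
    rw [hsum, List.length_finRange] at ht
    refine ⟨S, hm, fun q => by simp [hmem], ?_, hp₁⟩
    have hU : 40 ≤ unitCost I := by unfold unitCost; omega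
    rw [Nat.add_mul _ 1]
    dsimp only at ht ⊢
    omega

/-- Splitting the selection at the rank of `j`, an index of smaller rank lies in the first part and
one of equal rank is `j`; so `mem_of_mem` applies. -/
theorem Inv.mem_of_rank_le (h : Inv I δ m) (hall : ∀ v, v ∈ m.sel)
    {i j : Fin N} (hr : (m.rank i).getD 0 ≤ (m.rank j).getD 0)
    (hd : I.dist i j ≤ I.rho * m.l j) : j ∈ m.children i := by
  obtain ⟨q, hq⟩ := Option.isSome_iff_exists.1 ((rank_isSome_iff h.rank i).2 (hall i))
  obtain ⟨r, hr'⟩ := Option.isSome_iff_exists.1 ((rank_isSome_iff h.rank j).2 (hall j))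
  rw [hq, hr'] at hr
  simp only [Option.getD_some] at hr
  rw [h.rank, ← Array.getElem?_toList] at hq hr'
  obtain ⟨hrlt, hrj⟩ := List.getElem?_eq_some_iff.1 hr'
  refine h.mem_of_mem (m.sel.take r) j (m.sel.drop (r + 1)) ?_ i ?_ hd
  · rw [← hrj, List.getElem_cons_drop, List.take_append_drop]
  · rcases hr.lt_or_eq with hlt | rfl
    · left
      rw [List.mem_take_iff_getElem]
      obtain ⟨hqlt, hqi⟩ := List.getElem?_eq_some_iff.1 hq
      exact ⟨q, lt_min hlt hqlt, hqi⟩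
    · right
      exact Option.some.inj (hq.symm.trans hr')

/-- The bound for the total number of steps. -/
def totalCost (I : Input N) (K lv : ℕ) : ℕ :=
  1 + lv * passCost I K + (4 * N + 6 + N * (K + 5) + 2 * (N * (lv * K)) + 2 * K * N) * unitCost I

theorem sortSparse_spec (hI : IsGood I δ Δ K lv) : ∃ s, finalConfig I = some s ∧
    IsMaximin I s.mem.l s.mem.sel ∧ (∀ v, v ∈ s.mem.sel) ∧
    (∀ v q, s.mem.rank v = some q ↔ s.mem.order[q]? = some v) ∧
    (∀ q, q ∈ s.mem.S ↔ (s.mem.rank q.1).getD 0 ≤ (s.mem.rank q.2).getD 0 ∧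
      I.dist q.1 q.2 ≤ I.rho * s.mem.l q.2) ∧
    s.peak ≤ 17 + 16 * N + 16 * K * N ∧ s.time ≤ totalCost I K lv := by
  have hsp0 : (Mem.empty N).space ≤ 17 + 16 * N + 16 * K * N := by
    simp [Mem.space, Mem.empty]; omega
  -- One half is for the lists of parents and children, the other for `S`.
  have hKN : 16 * K * N = 8 * K * N + 8 * K * N := by ring
  suffices h : wp (sortSparse I) ⟨Mem.empty N, 0, (Mem.empty N).space⟩ (fun _ s =>
      IsMaximin I s.mem.l s.mem.sel ∧ (∀ v, v ∈ s.mem.sel) ∧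
      (∀ v q, s.mem.rank v = some q ↔ s.mem.order[q]? = some v) ∧
      (∀ q, q ∈ s.mem.S ↔ (s.mem.rank q.1).getD 0 ≤ (s.mem.rank q.2).getD 0 ∧
        I.dist q.1 q.2 ≤ I.rho * s.mem.l q.2) ∧
      s.peak ≤ 17 + 16 * N + 16 * K * N ∧ s.time ≤ totalCost I K lv) by
    obtain ⟨u, s, h1, h2⟩ := h
    refine ⟨s, ?_, h2⟩
    have h1' : (sortSparse I).run ⟨Mem.empty N, 0, (Mem.empty N).space⟩ = some (u, s) := h1
    rw [finalConfig, h1']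
    rfl
  simp only [sortSparse, wp_bind]
  refine (initArrays_spec hI (M := 17 + 16 * N + 16 * K * N) (by omega) hsp0).mono ?_
  rintro _ ⟨m₁, t₁, p₁⟩ ⟨a, hm₁, ha, hao, hasz, hall, hkey, ht₁, hp₁⟩
  simp only at hm₁ ht₁ hp₁
  subst hm₁
  refine (processFirst_spec hI ha hao hasz hall hkey (M := 17 + 16 * N + 16 * K * N) (by omega)
    hp₁).mono ?_
  rintro _ ⟨m₂, t₂, p₂⟩ ⟨hinv₂, htight₂, hn₂, ht₂, hp₂⟩
  simp only at hinv₂ htight₂ hn₂ ht₂ hp₂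
  refine (mainLoop_spec hI hinv₂ htight₂ hn₂ (M := 17 + 16 * N + 16 * K * N) (by omega)
    hp₂).mono ?_
  rintro _ ⟨m₃, t₃, p₃⟩ ⟨hinv₃, hall₃, ht₃, hp₃⟩
  simp only at hinv₃ hall₃ ht₃ hp₃
  have hsp := hinv₃.space_le hI
  have hc := hinv₃.sum_children_le hI
  have hN := hI.two_le_card
  have h4 : 4 * ∑ i, (m₃.children i).length ≤ 8 * K * N := by
    calc _ ≤ 4 * (2 * K * N) := Nat.mul_le_mul_left _ hc
      _ = 8 * K * N := by ring
  refine (aggregate_spec hinv₃.pairs (M := 17 + 16 * N + 16 * K * N) (by omega) hp₃).mono ?_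
  rintro _ ⟨m₄, t₄, p₄⟩ ⟨S, hm₄, hS, ht₄, hp₄⟩
  simp only at hm₄ ht₄ hp₄
  subst hm₄
  refine ⟨hinv₃.maximin, hall₃, hinv₃.rank, fun q => ?_, hp₄, ?_⟩
  · refine (hS q).trans ⟨?_, fun h => ?_⟩
    · rintro ⟨i, j, hj, h1, h2, rfl | rfl⟩
      · exact ⟨h1, h2⟩
      -- The diagonal pairs belong to the pattern because `dist(j,j) = 0`.
      · exact ⟨le_rfl, by dsimp only; rw [hI.self]; exact zero_le⟩
    · exact ⟨q.1, q.2, hinv₃.mem_of_rank_le hall₃ h.1 h.2, h.1, h.2, Or.inl rfl⟩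
  · have e1 : (N + ∑ i, (m₃.children i).length + 1) * unitCost I
        ≤ (N + 2 * K * N + 1) * unitCost I := Nat.mul_le_mul_right _ (by omega)
    have e2 : totalCost I K lv = 1 + lv * passCost I K + (N + 1) * unitCost I
      + (2 * N + 4) * unitCost I + (N * (K + 5) + 2 * (N * (lv * K))) * unitCost I
      + (N + 2 * K * N + 1) * unitCost I := by unfold totalCost; ring
    dsimp only
    omega

end Total

/-! ## Point sets -/

section Points

variable {d N : ℕ} {x : Fin N → EuclideanSpace ℝ (Fin d)} {dt Cdim ρ : ℝ} {p : Polynomial ℝ}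

/-- A packing number at the ratio `6 ρ`. -/
noncomputable def packingNumber (dt Cdim ρ : ℝ) : ℕ := ⌊Cdim * (6 * ρ) ^ dt⌋₊

/-- A bound for the number of dyadic scales of the distances. -/
noncomputable def scaleNumber (p : Polynomial ℝ) (N : ℕ) : ℕ := Nat.log 2 ⌊p.eval (N : ℝ)⌋₊ + 1

theorem lt_two_pow_scaleNumber (p : Polynomial ℝ) (N : ℕ) :
    p.eval (N : ℝ) < 2 ^ scaleNumber p N := by
  have h1 := Nat.lt_pow_succ_log_self (b := 2) (by norm_num) ⌊p.eval (N : ℝ)⌋₊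
  refine (Nat.lt_floor_add_one _).trans_le ?_
  exact_mod_cast h1

/-- `δ` is the smallest distance `e` of two points and `Δ = p(N) e`. Intrinsic dimension is applied
with radius `6 ρ r` and separation `r`, whose ratio does not depend on `r`. -/
theorem exists_isGood (hN : 2 ≤ N) (hρ : 2 ≤ ρ) (hdim : HasIntrinsicDimension x dt Cdim)
    (hpol : HasPolynomialScaling x p) (Cdist : ℕ) : ∃ δ Δ, IsGood (inputOf Set.univ x ρ Cdist) δ Δ
      (packingNumber dt Cdim ρ) (scaleNumber p N) := by
  classical
  have hne : (Finset.univ.filter fun q : Fin N × Fin N => q.1 ≠ q.2).Nonempty :=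
    ⟨(⟨0, by omega⟩, ⟨1, by omega⟩), by simp⟩
  obtain ⟨⟨k, k'⟩, hk, hmin⟩ := Finset.exists_min_image _
    (fun q : Fin N × Fin N => dist (x q.1) (x q.2)) hne
  simp only [Finset.mem_filter, Finset.mem_univ, true_and, Prod.forall] at hk hmin
  set e := dist (x k) (x k') with he
  have he0 : 0 < e := (hpol k k' k k' hk hk).1
  have hle : ∀ i j, dist (x i) (x j) ≤ p.eval (N : ℝ) * e := by
    have h1 : ∀ i j, i ≠ j → dist (x i) (x j) ≤ p.eval (N : ℝ) * e := fun i j hij =>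
      (div_le_iff₀ he0).1 (hpol i j k k' hij hk).2
    intro i j
    by_cases hij : i = j
    · rw [hij, dist_self]
      exact dist_nonneg.trans (h1 k k' hk)
    · exact h1 i j hij
  refine ⟨ENNReal.ofReal e, ENNReal.ofReal (p.eval (N : ℝ) * e), ?_⟩
  refine
    { symm := fun i j => edist_comm _ _
      self := fun i => edist_self _
      triangle := fun i j k => edist_triangle _ _ _
      dist_le := fun i j => ?_
      le_dist := fun i j hij => ?_
      pos := by simpa using he0
      lt_top := ENNReal.ofReal_ne_top
      lt_pow := ?_
      two_le := ?_
      boundary := fun i => by simp [inputOf]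
      two_le_card := hN
      packing := ?_ }
  · simp only [inputOf, edist_dist]
    exact ENNReal.ofReal_le_ofReal (hle i j)
  · simp only [inputOf, edist_dist]
    exact ENNReal.ofReal_le_ofReal (hmin i j hij)
  · have h2 : (2 : ℝ≥0∞) ^ scaleNumber p N = ENNReal.ofReal (2 ^ scaleNumber p N) := by
      rw [ENNReal.ofReal_pow (by norm_num)]; norm_num
    rw [h2, ← ENNReal.ofReal_mul he0.le, ENNReal.ofReal_lt_ofReal_iff (by positivity), mul_comm e]
    exact mul_lt_mul_of_pos_right (lt_two_pow_scaleNumber p N) he0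
  · have : (2 : ℝ≥0∞) = ENNReal.ofReal 2 := by norm_num
    rw [this]
    exact ENNReal.ofReal_le_ofReal hρ
  · intro r hr0 hrt y A hA hsep
    have hr : 0 < r.toReal := ENNReal.toReal_pos hr0 hrt
    have h6 : 6 * ENNReal.ofReal ρ * r = ENNReal.ofReal (6 * ρ * r.toReal) := by
      rw [ENNReal.ofReal_mul (by positivity), ENNReal.ofReal_mul (by norm_num),
        ENNReal.ofReal_toReal hrt]
      norm_num
    refine Nat.le_floor ?_
    have := hdim r.toReal (6 * ρ * r.toReal) hr (by nlinarith) (x y) A (fun i hi => ?_)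
      (fun i hi j hj hij => ?_)
    · rwa [mul_div_cancel_right₀ _ hr.ne'] at this
    · have h1 := hA i hi
      simp only [inputOf, edist_dist] at h1
      rw [h6] at h1
      exact (ENNReal.ofReal_le_ofReal_iff (by positivity)).1 h1
    · have h1 := hsep i hi j hj hij
      simp only [inputOf, edist_dist] at h1
      exact (ENNReal.le_ofReal_iff_toReal_le hrt dist_nonneg).1 h1

theorem exists_polynomial_bound (p : Polynomial ℝ) : ∃ A : ℝ, 1 ≤ A ∧ ∀ y : ℝ, 1 ≤ y →
    p.eval y ≤ A * y ^ p.natDegree := by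
  -- The summand `1` makes the logarithm of the constant nonnegative.
  refine ⟨1 + ∑ i ∈ Finset.range (p.natDegree + 1), |p.coeff i|, ?_, fun y hy => ?_⟩
  · have : 0 ≤ ∑ i ∈ Finset.range (p.natDegree + 1), |p.coeff i| :=
      Finset.sum_nonneg fun i _ => abs_nonneg _
    linarith
  · rw [Polynomial.eval_eq_sum_range, add_mul, Finset.sum_mul]
    have h1 : ∑ i ∈ Finset.range (p.natDegree + 1), p.coeff i * y ^ i
        ≤ ∑ i ∈ Finset.range (p.natDegree + 1), |p.coeff i| * y ^ p.natDegree := by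
      refine Finset.sum_le_sum fun i hi => ?_
      have h2 : y ^ i ≤ y ^ p.natDegree :=
        pow_le_pow_right₀ hy (Nat.lt_succ_iff.1 (Finset.mem_range.1 hi))
      exact mul_le_mul (le_abs_self _) h2 (by positivity) (abs_nonneg _)
    have h3 : 0 ≤ 1 * y ^ p.natDegree := by positivity
    linarith

/-- `log₂ (A N ^ deg) = log₂ A + deg * log₂ N`, and `log₂ N ≥ 1` absorbs the constants. A vanishing
floor, as for negative `p(N)`, is treated separately. -/
theorem exists_scaleNumber_le (p : Polynomial ℝ) : ∃ a : ℝ, 1 ≤ a ∧ ∀ N : ℕ, 2 ≤ N →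
    (scaleNumber p N : ℝ) ≤ a * Real.logb 2 N := by
  obtain ⟨A, hA, hbound⟩ := exists_polynomial_bound p
  have hlA : 0 ≤ Real.logb 2 A := Real.logb_nonneg (by norm_num) hA
  refine ⟨Real.logb 2 A + p.natDegree + 1, by linarith [Nat.cast_nonneg (α := ℝ) p.natDegree], fun N hN => ?_⟩
  have hN2 : (2 : ℝ) ≤ N := by exact_mod_cast hN
  have hL : 1 ≤ Real.logb 2 N := by
    rw [Real.le_logb_iff_rpow_le (by norm_num) (by linarith)]; simpa using hN2
  have h1 : (Nat.log 2 ⌊p.eval (N : ℝ)⌋₊ : ℝ) ≤ Real.logb 2 A + p.natDegree * Real.logb 2 N := by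
    have h2 : Real.logb 2 (A * (N : ℝ) ^ p.natDegree)
        = Real.logb 2 A + p.natDegree * Real.logb 2 N := by
      rw [Real.logb_mul (by positivity) (by positivity), Real.logb_pow]
    rw [← h2]
    by_cases h0 : ⌊p.eval (N : ℝ)⌋₊ = 0
    · rw [h0, h2]
      simp only [Nat.log_zero_right, Nat.cast_zero]
      positivity
    · rw [Real.le_logb_iff_rpow_le (by norm_num) (by positivity), Real.rpow_natCast]
      have h3 : ((2 ^ Nat.log 2 ⌊p.eval (N : ℝ)⌋₊ : ℕ) : ℝ) ≤ ⌊p.eval (N : ℝ)⌋₊ := by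
        exact_mod_cast Nat.pow_log_le_self 2 h0
      push_cast at h3
      refine h3.trans ((Nat.floor_le ?_).trans (hbound N (by linarith)))
      by_contra hneg
      exact h0 (Nat.floor_of_nonpos (not_le.1 hneg).le)
  simp only [scaleNumber, Nat.cast_add, Nat.cast_one]
  nlinarith

theorem totalCost_le {I : Input N} {K lv : ℕ} {a : ℝ} (ha : 1 ≤ a) (hN : 2 ≤ N) (hK : 1 ≤ K)
    (hlv : (lv : ℝ) ≤ a * Real.logb 2 N) : (totalCost I K lv : ℝ) ≤
      4000 * (K * N * (a * Real.logb 2 N) * (Real.logb 2 N + I.oracleCost)) := by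
  have hN2 : (2 : ℝ) ≤ N := by exact_mod_cast hN
  have hL : 1 ≤ Real.logb 2 N := by
    rw [Real.le_logb_iff_rpow_le (by norm_num) (by linarith)]; simpa using hN2
  have hlog : (Nat.log 2 N : ℝ) ≤ Real.logb 2 N := Real.natLog_le_logb N 2
  set ℓ := Real.logb 2 N with hℓ
  set c : ℝ := (I.oracleCost : ℝ) with hc
  have hc0 : 0 ≤ c := Nat.cast_nonneg _
  set k : ℝ := (K : ℝ) with hk
  have hk1 : 1 ≤ k := Nat.one_le_cast.2 hK
  set n : ℝ := (N : ℝ) with hn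
  set v : ℝ := (lv : ℝ) with hv
  have hv0 : 0 ≤ v := Nat.cast_nonneg _
  set e := a * ℓ with he
  have he1 : 1 ≤ e := one_le_mul_of_one_le_of_one_le ha hL
  set u := ℓ + c with hu
  have hu1 : 1 ≤ u := by linarith
  have hkn : n ≤ k * n := le_mul_of_one_le_left (by linarith) hk1
  have hkn0 : 0 ≤ k * n := by linarith
  have hpass : (passCost I K : ℝ) ≤ 75 * (k * n * u) := by
    have h1 : k * n ≤ k * n * u := le_mul_of_one_le_right hkn0 hu1
    have h2 : k * n * c ≤ k * n * u := mul_le_mul_of_nonneg_left (by linarith) hkn0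
    simp only [passCost]
    push_cast
    nlinarith
  -- `unitCost` is `2 c + 38 log + 116`, and `38 + 116 = 154` since `ℓ ≥ 1`.
  have hunit : (unitCost I : ℝ) ≤ 154 * u := by
    simp only [unitCost, siftCost]
    push_cast
    linarith
  have hmid : 4 * n + 6 + n * (k + 5) + 2 * (n * (v * k)) + 2 * k * n ≤ 20 * (k * n * e) := by
    have h1 : k * n ≤ k * n * e := le_mul_of_one_le_right hkn0 he1
    have h2 : k * n * v ≤ k * n * e := mul_le_mul_of_nonneg_left hlv hkn0
    nlinarith
  have h1 : v * passCost I K ≤ e * (75 * (k * n * u)) :=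
    mul_le_mul hlv hpass (Nat.cast_nonneg _) (by linarith)
  have h2 : (4 * n + 6 + n * (k + 5) + 2 * (n * (v * k)) + 2 * k * n) * (unitCost I : ℝ)
      ≤ 20 * (k * n * e) * (154 * u) :=
    mul_le_mul hmid hunit (Nat.cast_nonneg _) (by positivity)
  have h3 : 1 ≤ k * n * e * u :=
    one_le_mul_of_one_le_of_one_le
      (one_le_mul_of_one_le_of_one_le (by linarith) he1) hu1
  -- The constants add up to `1 + 75 + 20 * 154 ≤ 4000`.
  simp only [totalCost]
  push_cast
  nlinarith

/-! ### From the array `P` to an elimination ordering -/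

theorem exists_perm {order : List (Fin N)} (hnd : order.Nodup) (hall : ∀ v, v ∈ order) :
    ∃ e : Equiv.Perm (Fin N), order = (List.ofFn e).reverse := by
  have hlen : order.reverse.length = N := by
    have h1 : order.toFinset = Finset.univ := by ext v; simp [hall]
    rw [List.length_reverse, ← List.toFinset_card_of_nodup hnd, h1, Finset.card_fin]
  refine ⟨(finCongr hlen.symm).trans (List.Nodup.getEquivOfForallMemList order.reverse
    (List.nodup_reverse.2 hnd) fun v => List.mem_reverse.2 (hall v)), ?_⟩
  rw [eq_comm, List.reverse_eq_iff]
  refine List.ext_getElem (by simp [hlen.symm]) fun q h1 h2 => ?_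
  simp [List.Nodup.getEquivOfForallMemList]

/-- `P` lists the elimination ordering backwards, so position `k` of the ordering has rank `N - 1 -
k`. -/
theorem getElem?_reverse_ofFn (e : Equiv.Perm (Fin N)) (v : Fin N) :
    ((List.ofFn e).reverse)[N - 1 - (e.symm v : ℕ)]? = some v := by
  have h1 := (e.symm v).2
  rw [List.getElem?_reverse (by simp; omega), List.length_ofFn,
    List.getElem?_eq_getElem (by simp; omega), List.getElem_ofFn]
  congr 1
  rw [← Equiv.eq_symm_apply]
  apply Fin.ext
  simp only
  omega

theorem reverse_ofFn_eq (e : Equiv.Perm (Fin N)) (k : Fin N) : ∃ L₁ L₂,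
    (List.ofFn e).reverse = L₁ ++ e k :: L₂ ∧ ∀ i, i ∈ L₁ ↔ ∃ m, k < m ∧ i = e m := by
  refine ⟨((List.ofFn e).drop (k + 1)).reverse, ((List.ofFn e).take k).reverse, ?_, fun i => ?_⟩
  · have h1 : List.ofFn e = (List.ofFn e).take k ++ e k :: (List.ofFn e).drop (k + 1) := by
      have h2 : e k = (List.ofFn e)[(k : ℕ)]'(by simp) := by simp
      rw [h2, List.getElem_cons_drop, List.take_append_drop]
    conv_lhs => rw [h1]
    simp
  · rw [List.mem_reverse, List.mem_drop_iff_getElem]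
    constructor
    · rintro ⟨j, hj, rfl⟩
      rw [List.length_ofFn] at hj
      refine ⟨⟨k + 1 + j, by omega⟩, by rw [Fin.lt_def]; simp only; omega, by simp⟩
    · rintro ⟨m, hm, rfl⟩
      rw [Fin.lt_def] at hm
      refine ⟨m - (k + 1), by rw [List.length_ofFn]; omega, ?_⟩
      rw [List.getElem_ofFn]
      congr 1
      apply Fin.ext
      simp only
      omega

/-- The members of the reversed list before `e k` are those at later positions of `e`, and the
boundary is empty; so `distToLater` is `distTo` of this prefix. -/
theorem isReverseMaximin_of_isMaximin {Cdist : ℕ} {l : Fin N → ℝ≥0∞} {e : Equiv.Perm (Fin N)}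
    (h : IsMaximin (inputOf Set.univ x ρ Cdist) l (List.ofFn e).reverse) :
    IsReverseMaximin Set.univ x e l := by
  have key : ∀ k L₁, (∀ i, i ∈ L₁ ↔ ∃ m, k < m ∧ i = e m) → ∀ v,
      distToLater Set.univ x e k v = distTo (inputOf Set.univ x ρ Cdist) L₁ v := by
    intro k L₁ hL v
    rw [distToLater, frontier_univ, Set.union_empty]
    refine le_antisymm (le_distTo fun i hi => ?_) (Metric.le_infEDist.2 ?_)
    · obtain ⟨m, hm, rfl⟩ := (hL i).1 hi
      simp only [inputOf]
      rw [edist_comm]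
      exact Metric.infEDist_le_edist_of_mem ⟨m, hm, rfl⟩
    · rintro _ ⟨m, hm, rfl⟩
      rw [edist_comm]
      exact distTo_le ((hL (e m)).2 ⟨m, hm, rfl⟩) v
  constructor
  · intro k m hmk
    obtain ⟨L₁, L₂, hL, hmem⟩ := reverse_ofFn_eq e k
    rw [key k L₁ hmem, key k L₁ hmem]
    refine h.isMax L₁ (e k) L₂ hL (e m) fun hm => ?_
    obtain ⟨m', hm', h'⟩ := (hmem _).1 hm
    rw [e.injective h'] at hmk
    exact absurd hm' (not_lt.2 hmk)
  · intro k
    obtain ⟨L₁, L₂, hL, hmem⟩ := reverse_ofFn_eq e k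
    rw [key k L₁ hmem]
    exact h.scale L₁ (e k) L₂ hL

end Points

end SparseOrdering

/-! ### The theorem -/

theorem theoremC1 (dt Cdim : ℝ) (p : Polynomial ℝ) :
    ∃ C : ℝ, 0 < C ∧
      ∀ (d N : ℕ) (x : Fin N → EuclideanSpace ℝ (Fin d)) (ρ : ℝ) (Cdist : ℕ),
        2 ≤ N → 2 ≤ ρ →
        SparseOrdering.HasIntrinsicDimension x dt Cdim →
        SparseOrdering.HasPolynomialScaling x p →
        ∃ (s : SparseOrdering.Config N) (e : Equiv.Perm (Fin N)),
          SparseOrdering.finalConfig (SparseOrdering.inputOf Set.univ x ρ Cdist) = some s ∧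
          s.mem.order.toList = (List.ofFn e).reverse ∧
          SparseOrdering.IsReverseMaximin Set.univ x e s.mem.l ∧
          {q | q ∈ s.mem.S} = SparseOrdering.sparsityPattern x e s.mem.l ρ ∧
          (s.peak : ℝ) ≤ C * ρ ^ dt * N ∧
          (s.time : ℝ) ≤ C * N * Real.log N * ρ ^ dt * (Real.log N + Cdist) := by
  obtain ⟨a, ha, hscale⟩ := SparseOrdering.exists_scaleNumber_le p
  -- The maximum keeps `B` positive for any `Cdim`; the power of `6` comes from the packing ratio `6
  -- ρ`.
  set B : ℝ := max Cdim 1 * 6 ^ dt with hB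
  have hB0 : 0 < B := mul_pos (lt_max_of_lt_right one_pos) (Real.rpow_pos_of_pos (by norm_num) _)
  have hlog2 : 0 < Real.log 2 := Real.log_pos (by norm_num)
  have hlog2' : Real.log 2 ≤ 1 := by
    have := Real.log_two_lt_d9
    linarith
  -- One factor `log 2` converts the number of scales from base 2, the other the unit cost.
  set C₁ : ℝ := 4000 * B * (a / (Real.log 2 * Real.log 2)) with hC₁
  have hC₁0 : 0 < C₁ := by positivity
  -- `17 + 16 N + 16 K N ≤ 41 K N`, because `N ≥ 2` and `K ≥ 1`.
  refine ⟨C₁ + 41 * B, by positivity, ?_⟩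
  intro d N x ρ Cdist hN hρ hdim hpol
  obtain ⟨δ, Δ, hI⟩ := SparseOrdering.exists_isGood hN hρ hdim hpol Cdist
  obtain ⟨s, hs, hmax, hall, hrank, hS, hpeak, htime⟩ := SparseOrdering.sortSparse_spec hI
  obtain ⟨e, he⟩ := SparseOrdering.exists_perm hmax.nodup hall
  have hN2 : (2 : ℝ) ≤ N := by exact_mod_cast hN
  have hρ0 : 0 ≤ ρ ^ dt := Real.rpow_nonneg (by linarith) _
  have hK1 := hI.one_le
  have hKB : (SparseOrdering.packingNumber dt Cdim ρ : ℝ) ≤ B * ρ ^ dt := by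
    have h6 : (0 : ℝ) ≤ (6 * ρ) ^ dt := Real.rpow_nonneg (by linarith) _
    have h1 : (SparseOrdering.packingNumber dt Cdim ρ : ℝ) ≤ max Cdim 1 * (6 * ρ) ^ dt := by
      refine (Nat.cast_le.2 (Nat.floor_mono
        (mul_le_mul_of_nonneg_right (le_max_left Cdim 1) h6))).trans (Nat.floor_le ?_)
      exact mul_nonneg (le_max_of_le_right zero_le_one) h6
    rwa [Real.mul_rpow (by norm_num) (by linarith), ← mul_assoc] at h1
  refine ⟨s, e, hs, he, ?_, ?_, ?_, ?_⟩
  · rw [he] at hmax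
    exact SparseOrdering.isReverseMaximin_of_isMaximin hmax
  · have hr : ∀ v, s.mem.rank v = some (N - 1 - (e.symm v : ℕ)) := fun v => by
      have h1 : s.mem.order.toList = (List.ofFn e).reverse := he
      rw [hrank, ← Array.getElem?_toList, h1]
      exact SparseOrdering.getElem?_reverse_ofFn e v
    ext ⟨i, j⟩
    have hi := (e.symm i).2
    have hj := (e.symm j).2
    simp only [Set.mem_ofPred_eq, hS, hr, Option.getD_some, SparseOrdering.sparsityPattern,
      SparseOrdering.inputOf, Fin.le_def]
    -- Passing from ranks to elimination positions reverses the order of the indices.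
    refine and_congr_left fun _ => ?_
    omega
  · have h1 : (s.peak : ℝ) ≤ 17 + 16 * N + 16 * SparseOrdering.packingNumber dt Cdim ρ * N := by
      exact_mod_cast hpeak
    set K : ℝ := (SparseOrdering.packingNumber dt Cdim ρ : ℝ)
    have hK1' : 1 ≤ K := Nat.one_le_cast.2 hK1
    have h2 : (N : ℝ) ≤ K * N := le_mul_of_one_le_left (by linarith) hK1'
    have h3 : K * N ≤ B * ρ ^ dt * N := mul_le_mul_of_nonneg_right hKB (by linarith)
    have h4 : 0 ≤ C₁ * ρ ^ dt * N := by positivity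
    nlinarith
  · have h1 : (s.time : ℝ) ≤ SparseOrdering.totalCost (SparseOrdering.inputOf Set.univ x ρ Cdist)
        (SparseOrdering.packingNumber dt Cdim ρ) (SparseOrdering.scaleNumber p N) := by
      exact_mod_cast htime
    refine h1.trans ((SparseOrdering.totalCost_le ha hN hK1 (hscale N hN)).trans ?_)
    have hlogN : 0 < Real.log N := Real.log_pos (by linarith)
    have hoc : ((SparseOrdering.inputOf Set.univ x ρ Cdist).oracleCost : ℝ) = Cdist := rfl
    rw [hoc, Real.logb]
    have h2 : Real.log N / Real.log 2 + Cdist ≤ (Real.log N + Cdist) / Real.log 2 := by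
      rw [add_div]
      gcongr
      exact le_div_self (Nat.cast_nonneg _) hlog2 hlog2'
    calc 4000 * (SparseOrdering.packingNumber dt Cdim ρ * N * (a * (Real.log N / Real.log 2))
          * (Real.log N / Real.log 2 + Cdist))
        ≤ 4000 * (B * ρ ^ dt * N * (a * (Real.log N / Real.log 2))
          * ((Real.log N + Cdist) / Real.log 2)) := by gcongr
      _ = C₁ * N * Real.log N * ρ ^ dt * (Real.log N + Cdist) := by
          rw [hC₁]; field_simp
      _ ≤ (C₁ + 41 * B) * N * Real.log N * ρ ^ dt * (Real.log N + Cdist) := by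
          gcongr
          linarith
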